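/- Let $d\ge 0$ be an integer and let $\mathbb R^{d+1}$ have coordinates $(x^0,x^1,\dots,x^d)$, $x^0=t$; Greek indices run over $0,\dots,d$, Latin indices over $1,\dots,d$, and repeated indices are summed. Let $U\subset\mathbb R^{d+1}$ be open and let $g$ be a smooth Lorentzian metric on $U$ of the form $$g=-\mathfrak N(\mathrm dt-\mathfrak a_i\,\mathrm dx^i)^2+\sum_{i}\mathfrak c_i(\mathrm dx^i+\mathfrak b^i\,\mathrm dt+\mathfrak B^i_j\,\mathrm dx^j)^2,$$ where $\mathfrak N,\mathfrak a_i,\mathfrak b^i,\mathfrak c_i,\mathfrak B^i_j$ are smooth real functions on $U$ with $$|\mathfrak N-1|,\ |\mathfrak c_i-1|,\ |\mathfrak a_i|,\ |\mathfrak b^i|,\ |\mathfrak B^i_j|\le 10^{-5}\quad\text{on } U.$$ Let $\Box_g u=g^{\mu\nu}(\partial_\mu\partial_\nu u-\Gamma^\alpha_{\mu\nu}\partial_\alpha u)$ be the wave operator of $g$ on functions, where $\Gamma^\alpha_{\mu\nu}$ are the Christoffel symbols of $g$. For $p\in[1,\infty]$, $\lambda>0$ and $u\in C_c^\infty(U;\mathbb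 C)$ put $$\|u\|_{X^p_\lambda(g)}=\sum_{k=0}^2\lambda^{k-1}\|\partial^k u\|_{L^p}+\|\Box_g u\|_{L^p}$$ (with $L^p$ taken with respect to Lebesgue measure), and let $$\mathfrak Q_{\mu\nu}(\phi,\psi)=\partial_\mu\phi\,\partial_\nu\psi-\partial_\nu\phi\,\partial_\mu\psi,\qquad \langle u,v\rangle_{L^2(\mathrm{dVol}_g)}=\int_U u\,\overline v\,\sqrt{|\det g|}\,\mathrm dx.$$ Then for every compact set $K\subset U$ and every $f\in C^\infty(U;\mathbb C)$ there is a constant $C$, depending on $f$, $g$ and $K$ (and hence on $U$ and $d$) only, such that for all indices $\alpha,\mu,\nu\in\{0,\dots,d\}$, all $\lambda>0$ and all $\phi^{(1)},\phi^{(2)},\phi^{(3)}\in C_c^\infty(U;\mathbb C)$ supported in $K$, $$\Big|\big\langle f\,\partial_\alpha\phi^{(3)},\ \mathfrak Q_{\mu\nu}(\phi^{(1)},\phi^{(2)})\big\rangle_{L^2(\mathrm{dVol}_g)}\Big|\le C\,\lambda^{\frac1{15}}\,\|\phi^{(1)}\|_{X^\infty_\lambda(g)}\,\|\phi^{(2)}\|_{X^2_\lambda(g)}\,\|\phi^{(3)}\|_{X^2_\lambda(g)}.$$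 -/

import Mathlib

open MeasureTheory
open scoped ContDiff ENNReal

noncomputable section

/-- The coordinate space `ℝ^{d+1}`; the coordinates are `(x^0, x^1, …, x^d)` with `x^0 = t`. -/
abbrev Spacetime (d : ℕ) : Type := EuclideanSpace ℝ (Fin (d + 1))

/-- The coordinate partial derivative `∂_μ u`. -/
def partialD {d : ℕ} {F : Type*} [NormedAddCommGroup F] [NormedSpace ℝ F]
    (μ : Fin (d + 1)) (u : Spacetime d → F) (x : Spacetime d) : F :=
  fderiv ℝ u x (EuclideanSpace.single μ (1 : ℝ))

/-- The Minkowski matrix `diag(-1, 1, …, 1)`. -/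
def minkowskiMatrix (d : ℕ) : Matrix (Fin (d + 1)) (Fin (d + 1)) ℝ :=
  Matrix.diagonal (Fin.cons (-1) (fun _ : Fin d => (1 : ℝ)))

/-- `G` is the Gram matrix of a (symmetric) bilinear form of signature `(-, +, …, +)`, i.e. it is
congruent to the Minkowski matrix. -/
def IsLorentzianMatrix {d : ℕ} (G : Matrix (Fin (d + 1)) (Fin (d + 1)) ℝ) : Prop :=
  ∃ P : Matrix (Fin (d + 1)) (Fin (d + 1)) ℝ,
    IsUnit P.det ∧ P.transpose * G * P = minkowskiMatrix d

/-- `g`, given by its coordinate components `g_{μν}`, is a smooth Lorentzian metric on `U`. -/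
def IsSmoothLorentzianMetricOn {d : ℕ}
    (g : Spacetime d → Matrix (Fin (d + 1)) (Fin (d + 1)) ℝ) (U : Set (Spacetime d)) : Prop :=
  (∀ μ ν, ContDiffOn ℝ ∞ (fun x => g x μ ν) U) ∧ ∀ x ∈ U, IsLorentzianMatrix (g x)

/-- The components of the one-form `dt - a_i dx^i`. -/
def timeCovector {d : ℕ} (a : Fin d → ℝ) : Fin (d + 1) → ℝ :=
  Fin.cons 1 (fun i => -a i)

/-- The components of the one-form `dx^i + b^i dt + B^i_j dx^j`. -/
def spaceCovector {d : ℕ} (b : Fin d → ℝ) (B : Fin d → Fin d → ℝ) (i : Fin d) :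
    Fin (d + 1) → ℝ :=
  Fin.cons (b i) (fun j => (if j = i then 1 else 0) + B i j)

/-- The components of the quadratic form
`-N (dt - a_i dx^i)^2 + c_i (dx^i + b^i dt + B^i_j dx^j)^2`. -/
def framedMetric {d : ℕ} (N : ℝ) (a b c : Fin d → ℝ) (B : Fin d → Fin d → ℝ) :
    Matrix (Fin (d + 1)) (Fin (d + 1)) ℝ :=
  Matrix.of fun μ ν =>
    -N * (timeCovector a μ * timeCovector a ν) +
      ∑ i, c i * (spaceCovector b B i μ * spaceCovector b B i ν)

/-- The Christoffel symbols
`Γ^α_{μν} = (1/2) g^{αβ} (∂_μ g_{βν} + ∂_ν g_{βμ} - ∂_β g_{μν})`. -/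
def christoffel {d : ℕ} (g : Spacetime d → Matrix (Fin (d + 1)) (Fin (d + 1)) ℝ)
    (α μ ν : Fin (d + 1)) (x : Spacetime d) : ℝ :=
  (1 / 2) * ∑ β, (g x)⁻¹ α β *
    (partialD μ (fun y => g y β ν) x + partialD ν (fun y => g y β μ) x
      - partialD β (fun y => g y μ ν) x)

/-- The wave operator on scalar functions,
`□_g u = g^{μν} (∂_μ ∂_ν u - Γ^α_{μν} ∂_α u)`. -/
def waveOp {d : ℕ} (g : Spacetime d → Matrix (Fin (d + 1)) (Fin (d + 1)) ℝ)
    (u : Spacetime d → ℂ) (x : Spacetime d) : ℂ :=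
  ∑ μ, ∑ ν, (((g x)⁻¹ μ ν : ℝ) : ℂ) *
    (partialD μ (partialD ν u) x - ∑ α, ((christoffel g α μ ν x : ℝ) : ℂ) * partialD α u x)

/-- The norm `‖u‖_{X^p_λ(g)} = ∑_{k=0}^{2} λ^{k-1} ‖∂^k u‖_{L^p} + ‖□_g u‖_{L^p}`. -/
def XNorm {d : ℕ} (p : ℝ≥0∞) (lam : ℝ)
    (g : Spacetime d → Matrix (Fin (d + 1)) (Fin (d + 1)) ℝ) (u : Spacetime d → ℂ) : ℝ :=
  (∑ k ∈ Finset.range 3,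
      lam ^ ((k : ℤ) - 1) * (eLpNorm (iteratedFDeriv ℝ k u) p volume).toReal)
    + (eLpNorm (waveOp g u) p volume).toReal

/-- The null form `Q_{μν}(φ, ψ) = ∂_μ φ ∂_ν ψ - ∂_ν φ ∂_μ ψ`. -/
def nullFormQ {d : ℕ} (μ ν : Fin (d + 1)) (φ ψ : Spacetime d → ℂ) (x : Spacetime d) : ℂ :=
  partialD μ φ x * partialD ν ψ x - partialD ν φ x * partialD μ ψ x

/-- The pairing `⟨u, v⟩_{L²(dVol_g)} = ∫_U u v̄ dVol_g`, where `dVol_g = √|det g| dx`. -/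
def pairingL2 {d : ℕ} (g : Spacetime d → Matrix (Fin (d + 1)) (Fin (d + 1)) ℝ)
    (U : Set (Spacetime d)) (u v : Spacetime d → ℂ) : ℂ :=
  ∫ x in U, ((Real.sqrt |(g x).det| : ℝ) : ℂ) * (u x * (starRingEnd ℂ) (v x))

end

/-! Each φ is dominated pointwise by one function e (`jetSize`): φ is at most λe, ∂φ at most e, ∂²φ
at most e/λ and □φ at most e. For λ ≥ 1, Hölder with exponents ∞, 2, 2 suffices. For λ ≤ 1 the
functions are cut off at scale r = √λ and the principal coefficients are frozen at a nearby point.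
The coefficients vary by O(r), which costs r·e/λ, and the commutator with the cutoff costs e/r =
(r/λ)e. Hence the frozen wave operator of a localized function is O(εe/λ) with ε = r, better by ε
than a general second derivative (`CutoffBound.norm_frozenBox_mul_le`). A linear frame diagonalizes
the frozen operator (`exists_frame`), and dilating it by λ brings frequencies to unit scale.

For constant coefficients the pairing is the integral of conj p₃(ξ) p₁(ξ-ζ) p₂(ζ) against a symbol.
Product symbols a(ξ)b(ζ) are harmless: undoing the Fourier transform bounds them by sup |φ₁| and two
L² norms (`norm_symbolForm_le`). Let τ, η be the time and space frequencies, q = |η|² - τ², and Ω =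
±η/|η| the null direction. The wedge ξ∧ζ of the null form is, up to terms containing |τ| - |η|, made
of |η(ξ)||η(ζ)|(Ω(ξ) - Ω(ζ)) times bounded factors. Terms with |τ| - |η| gain at least √ε, since
(|τ| - |η|)² ≤ |q|. Moreover |η(ξ)||η(ζ)||Ω(ξ) - Ω(ζ)|² is a combination of q(ξ), q(ζ), q(ξ-ζ) and
such terms, so it also gains √ε (`formBound_norm_nullDir_sub_sq`).

What is needed is the first power of Ω(ξ) - Ω(ζ), in a form with no positivity. Insert the phase
exp(i⟨s, Ω(ξ) - Ω(ζ)⟩): it is a unimodular product symbol, so every bound above is uniform in s. The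
form becomes a bounded function of s with Laplacian O(√ε), and a Landau-Kolmogorov inequality
(`norm_integral_inner_mul_le`) bounds its gradient at 0 by the geometric mean, of order ε^(1/4) =
λ^(1/8) (`formBound_nullDir_sub`).

The local estimates are then integrated over the centre of the cutoff. Derivatives falling on the
cutoff average to zero (`integral_integral_conj_partialD_localized`), and Cauchy-Schwarz in the
centre restores the global L² norms (`integral_localL2_mul_le`). The exponent 1/8 is more than the
required 1/15. -/

set_option linter.unusedSectionVars false

/-! ### A Landau-Kolmogorov inequality by Gaussian averaging -/

section Landau

open ProbabilityTheory Complex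
open scoped RealInnerProductSpace

variable {E : Type*} [NormedAddCommGroup E] [InnerProductSpace ℝ E] [FiniteDimensional ℝ E]
  [MeasurableSpace E] [BorelSpace E]

/-- Differentiating the characteristic function exp(-‖x‖²/2) of the Gaussian in the direction e
brings down a factor i⟨z, e⟩ under the integral. -/
theorem integral_inner_mul_exp_stdGaussian (x e : E) :
    ∫ z, ((⟪z, e⟫ : ℝ) : ℂ) * exp ((⟪z, x⟫ : ℝ) * I) ∂(stdGaussian E)
      = I * ((⟪x, e⟫ : ℝ) : ℂ) * ((Real.exp (-(‖x‖ ^ 2 / 2)) : ℝ) : ℂ) := by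
  have hm : MemLp id (1 : ℕ) (stdGaussian E) := IsGaussian.memLp_id _ _ (by simp)
  have h1 := iteratedFDeriv_charFun (μ := stdGaussian E) (n := 1) (t := x) hm (fun _ => e)
  have h2 : HasFDerivAt (charFun (stdGaussian E))
      ((ofRealCLM.comp (Real.exp (-(‖x‖ ^ 2 / 2)) • (-((1 / 2 : ℝ) • (2 • innerSL ℝ x)))))) x := by
    have hf : charFun (stdGaussian E) = fun t : E => ((Real.exp (-(‖t‖ ^ 2 / 2)) : ℝ) : ℂ) := by
      funext t
      rw [charFun_stdGaussian]
      push_cast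
      congr 1
      ring
    rw [hf]
    have h3 : HasFDerivAt (fun t : E => -(‖t‖ ^ 2 / 2))
        (-((1 / 2 : ℝ) • (2 • innerSL ℝ x))) x := by
      have := ((hasStrictFDerivAt_norm_sq x).hasFDerivAt.const_mul (1 / 2 : ℝ)).neg
      refine this.congr_of_eventuallyEq (Filter.Eventually.of_forall fun t => ?_)
      simp only [Pi.neg_apply]
      ring
    exact ofRealCLM.hasFDerivAt.comp x h3.exp
  rw [iteratedFDeriv_one_apply, h2.fderiv] at h1
  simp only [pow_one, Finset.univ_unique, Finset.prod_singleton] at h1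
  have h4 := congrArg (fun w => -I * w) h1
  simp only [← mul_assoc, neg_mul, I_mul_I, neg_neg, one_mul] at h4
  rw [← h4]
  simp [innerSL_apply_apply]
  ring

theorem integrable_norm_stdGaussian : Integrable (fun z : E => ‖z‖) (stdGaussian E) := by
  have hm : MemLp id (1 : ℕ) (stdGaussian E) := IsGaussian.memLp_id _ _ (by simp)
  have := memLp_one_iff_integrable.1 (by simpa using hm)
  exact this.norm

variable {X : Type*} [MeasurableSpace X] {μ : Measure X} [SFinite μ]

/-- The multiplier ⟨x, e⟩ exp(-t‖x‖²/2) is t^(-1/2) times a Gaussian average of the plane waves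
exp(i⟨√t z, x⟩) with weight -i⟨z, e⟩, so a bound uniform over plane waves passes to it. This is the
gradient estimate for the heat flow in the variable s. -/
theorem norm_integral_inner_mul_gaussian_le {w : X → ℂ} (hw : Integrable w μ) {x : X → E}
    (hx : Measurable x) {M t : ℝ} (ht : 0 < t)
    (hM : ∀ s : E, ‖∫ p, w p * exp ((⟪s, x p⟫ : ℝ) * I) ∂μ‖ ≤ M) (e : E) (he : ‖e‖ ≤ 1) :
    ‖∫ p, w p * ((⟪x p, e⟫ * Real.exp (-(t * ‖x p‖ ^ 2 / 2)) : ℝ) : ℂ) ∂μ‖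
      ≤ t ^ (-(1 / 2) : ℝ) * ((∫ z, ‖z‖ ∂(stdGaussian E)) * M) := by
  have hst : 0 < √t := Real.sqrt_pos.2 ht
  have hpt : ∀ p, w p * ((⟪x p, e⟫ * Real.exp (-(t * ‖x p‖ ^ 2 / 2)) : ℝ) : ℂ)
      = (-I * ((√t)⁻¹ : ℝ)) * ∫ z, ((⟪z, e⟫ : ℝ) : ℂ) *
        (w p * exp ((⟪√t • z, x p⟫ : ℝ) * I)) ∂(stdGaussian E) := by
    intro p
    have h := integral_inner_mul_exp_stdGaussian (√t • x p) e
    have h' : ∀ z : E, ((⟪z, e⟫ : ℝ) : ℂ) * (w p * exp ((⟪√t • z, x p⟫ : ℝ) * I))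
        = w p * (((⟪z, e⟫ : ℝ) : ℂ) * exp ((⟪z, √t • x p⟫ : ℝ) * I)) := by
      intro z
      rw [real_inner_smul_left, real_inner_smul_right]
      ring
    simp_rw [h']
    rw [integral_const_mul, h, norm_smul, Real.norm_of_nonneg hst.le, mul_pow,
      Real.sq_sqrt ht.le, real_inner_smul_left]
    push_cast
    have : (√t : ℂ) ≠ 0 := by exact_mod_cast hst.ne'
    field_simp
    linear_combination ((⟪x p, e⟫ : ℝ) : ℂ) * w p * I_sq
  have hint : Integrable (Function.uncurry fun (p : X) (z : E) => ((⟪z, e⟫ : ℝ) : ℂ) *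
      (w p * exp ((⟪√t • z, x p⟫ : ℝ) * I))) (μ.prod (stdGaussian E)) := by
    have h0 : Integrable (fun q : X × E => w q.1 * ((‖q.2‖ : ℝ) : ℂ)) (μ.prod (stdGaussian E)) :=
      hw.mul_prod integrable_norm_stdGaussian.ofReal
    refine h0.mono ?_ (Filter.Eventually.of_forall fun q => ?_)
    · have hw1 : AEStronglyMeasurable (fun q : X × E => w q.1) (μ.prod (stdGaussian E)) :=
        hw.1.comp_fst
      have hx1 : Measurable fun q : X × E => x q.1 := hx.comp measurable_fst
      refine AEStronglyMeasurable.mul ?_ (hw1.mul ?_)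
      · exact (by fun_prop : Measurable fun q : X × E => ((⟪q.2, e⟫ : ℝ) : ℂ)).aestronglyMeasurable
      · exact (by fun_prop : Measurable fun q : X × E =>
          exp ((⟪√t • q.2, x q.1⟫ : ℝ) * I)).aestronglyMeasurable
    · simp only [Function.uncurry, norm_mul, norm_exp_ofReal_mul_I, mul_one, norm_real, norm_norm]
      rw [mul_comm]
      gcongr
      exact (norm_inner_le_norm _ _).trans (mul_le_of_le_one_right (norm_nonneg _) he)
  simp_rw [hpt]
  rw [integral_const_mul, integral_integral_swap hint, norm_mul]
  have h1 : ‖(-I * ((√t)⁻¹ : ℝ) : ℂ)‖ = t ^ (-(1 / 2) : ℝ) := by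
    rw [norm_mul, norm_neg, norm_I, one_mul, norm_real, Real.norm_of_nonneg (by positivity),
      Real.rpow_neg ht.le, Real.sqrt_eq_rpow]
  rw [h1]
  gcongr
  rw [← integral_mul_const]
  refine norm_integral_le_of_norm_le (integrable_norm_stdGaussian.mul_const M)
    (Filter.Eventually.of_forall fun z => ?_)
  rw [integral_const_mul, norm_mul, norm_real]
  have hM0 : 0 ≤ M := (norm_nonneg _).trans (hM 0)
  gcongr
  · exact (norm_inner_le_norm _ _).trans (mul_le_of_le_one_right (norm_nonneg _) he)
  · exact hM _

/-- A Landau-Kolmogorov inequality with the Laplacian in place of the second derivative, for the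
function `s ↦ ∫ w e^{i⟨s, x⟩}`. -/
theorem norm_integral_inner_mul_le {w : X → ℂ} (hw : Integrable w μ) {x : X → E}
    (hx : Measurable x) {R : ℝ} (hR : ∀ p, ‖x p‖ ≤ R) {M δ T : ℝ} (hT : 0 < T)
    (hM : ∀ s : E, ‖∫ p, w p * exp ((⟪s, x p⟫ : ℝ) * I) ∂μ‖ ≤ M)
    (hδ : ∀ s : E, ‖∫ p, ((‖x p‖ ^ 2 : ℝ) : ℂ) * w p * exp ((⟪s, x p⟫ : ℝ) * I) ∂μ‖ ≤ δ)
    (e : E) (he : ‖e‖ ≤ 1) :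
    ‖∫ p, w p * ((⟪x p, e⟫ : ℝ) : ℂ) ∂μ‖
      ≤ (∫ z, ‖z‖ ∂(stdGaussian E)) * (T ^ (-(1 / 2) : ℝ) * M + T ^ (1 / 2 : ℝ) * δ) := by
  set G := ∫ z, ‖z‖ ∂(stdGaussian E)
  have hw2 : Integrable (fun p => ((‖x p‖ ^ 2 : ℝ) : ℂ) * w p) μ := by
    refine hw.bdd_mul (c := R ^ 2) (by fun_prop) (Filter.Eventually.of_forall fun p => ?_)
    rw [norm_real, Real.norm_of_nonneg (by positivity)]
    have := hR p
    gcongr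
  have hRp : ∀ p, |⟪x p, e⟫| ≤ R := fun p =>
    (abs_real_inner_le_norm _ _).trans ((mul_le_of_le_one_right (norm_nonneg _) he).trans (hR p))
  have hexp : ∀ (t : ℝ) (p : X), 0 ≤ t → Real.exp (-(t * ‖x p‖ ^ 2 / 2)) ≤ 1 := fun t p ht =>
    Real.exp_le_one_iff.2 (by have : 0 ≤ t * ‖x p‖ ^ 2 := by positivity
                              linarith)
  -- Heat-flow splitting: 1 = exp(-T‖x‖²/2) + ½ ∫₀ᵀ ‖x‖² exp(-t‖x‖²/2) dt. The first term uses the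
  -- bound M, the integrand the bound δ for the Laplacian.
  have hsplit : ∀ p, w p * ((⟪x p, e⟫ : ℝ) : ℂ)
      = w p * ((⟪x p, e⟫ * Real.exp (-(T * ‖x p‖ ^ 2 / 2)) : ℝ) : ℂ)
        + (1 / 2 : ℂ) * ∫ t in (0 : ℝ)..T, ((‖x p‖ ^ 2 : ℝ) : ℂ) * w p *
          ((⟪x p, e⟫ * Real.exp (-(t * ‖x p‖ ^ 2 / 2)) : ℝ) : ℂ) := by
    intro p
    have h1 : ∫ t in (0 : ℝ)..T, (-(‖x p‖ ^ 2 / 2)) * Real.exp (-(t * ‖x p‖ ^ 2 / 2))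
        = Real.exp (-(T * ‖x p‖ ^ 2 / 2)) - Real.exp (-(0 * ‖x p‖ ^ 2 / 2)) := by
      refine intervalIntegral.integral_eq_sub_of_hasDerivAt
        (f := fun t => Real.exp (-(t * ‖x p‖ ^ 2 / 2))) (fun t _ => ?_)
        (Continuous.intervalIntegrable (by fun_prop) _ _)
      have := (((hasDerivAt_id t).mul_const (‖x p‖ ^ 2)).div_const 2).neg.exp
      convert! this using 1
      simp
      ring
    have h2 : (∫ t in (0 : ℝ)..T, ((‖x p‖ ^ 2 : ℝ) : ℂ) * w p *
          ((⟪x p, e⟫ * Real.exp (-(t * ‖x p‖ ^ 2 / 2)) : ℝ) : ℂ))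
        = (-2 * w p * (⟪x p, e⟫ : ℝ)) * ((∫ t in (0 : ℝ)..T,
          (-(‖x p‖ ^ 2 / 2)) * Real.exp (-(t * ‖x p‖ ^ 2 / 2)) : ℝ) : ℂ) := by
      rw [← intervalIntegral.integral_ofReal, ← intervalIntegral.integral_const_mul]
      congr 1
      funext t
      push_cast
      ring
    rw [h2, h1]
    push_cast
    simp
    ring
  have hA : Integrable (fun p => w p * ((⟪x p, e⟫ * Real.exp (-(T * ‖x p‖ ^ 2 / 2)) : ℝ) : ℂ)) μ := by
    refine hw.mul_bdd (c := R * 1) (by fun_prop) (Filter.Eventually.of_forall fun p => ?_)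
    rw [norm_real, norm_mul, Real.norm_eq_abs, Real.norm_of_nonneg (Real.exp_pos _).le]
    have := hRp p
    have := hexp T p hT.le
    gcongr
    exact (abs_nonneg _).trans (hRp p)
  have hprod : Integrable (Function.uncurry fun (t : ℝ) (p : X) => ((‖x p‖ ^ 2 : ℝ) : ℂ) * w p *
      ((⟪x p, e⟫ * Real.exp (-(t * ‖x p‖ ^ 2 / 2)) : ℝ) : ℂ))
      ((volume.restrict (Set.uIoc 0 T)).prod μ) := by
    have h0 : Integrable (fun q : ℝ × X => (R : ℂ) * (((‖x q.2‖ ^ 2 : ℝ) : ℂ) * w q.2))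
        ((volume.restrict (Set.uIoc 0 T)).prod μ) := by
      have : IsFiniteMeasure (volume.restrict (Set.uIoc (0 : ℝ) T)) :=
        ⟨by simp [Set.uIoc, Real.volume_Ioc]⟩
      exact (integrable_const (μ := volume.restrict (Set.uIoc (0 : ℝ) T)) (R : ℂ)).mul_prod hw2
    refine h0.mono ?_ ?_
    · have hw1 : AEStronglyMeasurable (fun q : ℝ × X => ((‖x q.2‖ ^ 2 : ℝ) : ℂ) * w q.2)
        ((volume.restrict (Set.uIoc 0 T)).prod μ) := hw2.1.comp_snd
      refine hw1.mul ?_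
      exact (by fun_prop : Measurable fun q : ℝ × X =>
        ((⟪x q.2, e⟫ * Real.exp (-(q.1 * ‖x q.2‖ ^ 2 / 2)) : ℝ) : ℂ)).aestronglyMeasurable
    · have hmem : ∀ᵐ q ∂((volume.restrict (Set.uIoc (0 : ℝ) T)).prod μ), q.1 ∈ Set.uIoc (0 : ℝ) T := by
        have := Measure.quasiMeasurePreserving_fst (μ := volume.restrict (Set.uIoc (0 : ℝ) T)) (ν := μ)
        exact this.ae (ae_restrict_mem measurableSet_uIoc)
      filter_upwards [hmem] with q hq
      rw [Set.uIoc_of_le hT.le] at hq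
      simp only [Function.uncurry]
      rw [norm_mul, mul_comm, norm_mul (R : ℂ)]
      gcongr
      rw [norm_real, norm_mul, norm_real, Real.norm_of_nonneg (Real.exp_pos _).le]
      have h1 := hRp q.2
      have h2 := hexp q.1 q.2 hq.1.le
      calc ‖⟪x q.2, e⟫‖ * Real.exp (-(q.1 * ‖x q.2‖ ^ 2 / 2)) ≤ ‖⟪x q.2, e⟫‖ * 1 := by gcongr
        _ ≤ ‖R‖ := by rw [mul_one, Real.norm_eq_abs]; exact h1.trans (le_abs_self _)
  have hB : Integrable (fun p => ∫ t in (0 : ℝ)..T, ((‖x p‖ ^ 2 : ℝ) : ℂ) * w p *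
          ((⟪x p, e⟫ * Real.exp (-(t * ‖x p‖ ^ 2 / 2)) : ℝ) : ℂ)) μ := by
    have := hprod.integral_prod_right
    simpa [Function.uncurry, intervalIntegral.integral_of_le hT.le, Set.uIoc_of_le hT.le] using this
  simp_rw [hsplit]
  rw [integral_add hA (hB.const_mul _), integral_const_mul,
    ← intervalIntegral_integral_swap hprod]
  have hδ' : ∀ t : ℝ, 0 < t → ‖∫ p, ((‖x p‖ ^ 2 : ℝ) : ℂ) * w p *
      ((⟪x p, e⟫ * Real.exp (-(t * ‖x p‖ ^ 2 / 2)) : ℝ) : ℂ) ∂μ‖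
      ≤ t ^ (-(1 / 2) : ℝ) * (G * δ) := fun t ht =>
    norm_integral_inner_mul_gaussian_le hw2 hx ht hδ e he
  have hI : IntervalIntegrable (fun t : ℝ => t ^ (-(1 / 2) : ℝ) * (G * δ)) volume 0 T :=
    (intervalIntegral.intervalIntegrable_rpow' (by norm_num)).mul_const _
  -- The singularity t^(-1/2) of the gradient bound is integrable at 0; its integral 2T^(1/2)
  -- cancels the factor ½ of the splitting.
  have h2 : ‖∫ t in (0 : ℝ)..T, ∫ p, ((‖x p‖ ^ 2 : ℝ) : ℂ) * w p *
      ((⟪x p, e⟫ * Real.exp (-(t * ‖x p‖ ^ 2 / 2)) : ℝ) : ℂ) ∂μ‖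
      ≤ 2 * (T ^ (1 / 2 : ℝ) * (G * δ)) := by
    refine (intervalIntegral.norm_integral_le_of_norm_le hT.le
      (Filter.Eventually.of_forall fun t ht => hδ' t ht.1) hI).trans_eq ?_
    rw [intervalIntegral.integral_mul_const, integral_rpow (Or.inl (by norm_num))]
    norm_num
    ring
  calc _ ≤ _ := norm_add_le _ _
    _ ≤ T ^ (-(1 / 2) : ℝ) * (G * M) + 1 / 2 * (2 * (T ^ (1 / 2 : ℝ) * (G * δ))) := by
        gcongr
        · exact norm_integral_inner_mul_gaussian_le hw hx hT hM e he
        · rw [norm_mul]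
          gcongr
          simp
    _ = _ := by ring

end Landau

/-! ### Plancherel for integrable functions and the basic trilinear bound -/

section FourierForm

open FourierTransform SchwartzMap ComplexConjugate
open scoped RealInnerProductSpace

variable {V : Type*} [NormedAddCommGroup V] [InnerProductSpace ℝ V] [FiniteDimensional ℝ V]
  [MeasurableSpace V] [BorelSpace V]

theorem continuous_fourierInv_of_integrable {v : V → ℂ} (hv : Integrable v) :
    Continuous (𝓕⁻ v) :=
  VectorFourier.fourierIntegral_continuous Real.continuous_fourierChar
    (by exact continuous_inner.neg) hv

theorem integral_schwartz_mul_fourierInv {v : V → ℂ} (h1 : Integrable v) (G : 𝓢(V, ℂ)) :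
    ∫ x, G x • 𝓕⁻ v x = ∫ x, (𝓕⁻ G) x • v x := by
  have h := VectorFourier.integral_fourierIntegral_smul_eq_flip (f := v) (g := (G : V → ℂ))
    (μ := volume) (ν := volume) (L := -innerₗ V) Real.continuous_fourierChar
    (by exact continuous_inner.neg) h1 G.integrable
  have h' : VectorFourier.fourierIntegral Real.fourierChar volume (-innerₗ V).flip (G : V → ℂ)
      = 𝓕⁻ (G : V → ℂ) := by
    have : (-innerₗ V).flip = -innerₗ V := by
      ext x y
      simp [real_inner_comm]
    rw [this]
    rfl
  rw [h'] at h
  rw [fourierInv_coe]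
  simp_rw [smul_eq_mul, mul_comm (G _), mul_comm _ (v _)]
  exact h

theorem integral_schwartz_mul_Lp_fourierInv {v : V → ℂ} (h2 : MemLp v 2) (G : 𝓢(V, ℂ)) :
    ∫ x, G x • (𝓕⁻ (h2.toLp v) : Lp ℂ 2 (volume : Measure V)) x = ∫ x, (𝓕⁻ G) x • v x := by
  have := DFunLike.congr_fun (Lp.fourierInv_toTemperedDistribution_eq (h2.toLp v)) G
  rw [TemperedDistribution.fourierInv_apply, Lp.toTemperedDistribution_apply,
    Lp.toTemperedDistribution_apply] at this
  rw [← this]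
  refine integral_congr_ae ?_
  filter_upwards [h2.coeFn_toLp] with x hx
  rw [hx]

/-- Both versions of the inverse transform, the integral and the L² extension, have the same pairing
with every Schwartz function. This makes Plancherel available for multipliers of Schwartz functions
that are merely measurable, such as those built from signs and null directions. -/
theorem fourierInv_ae_eq_Lp {v : V → ℂ} (h1 : Integrable v) (h2 : MemLp v 2) :
    𝓕⁻ v =ᵐ[volume] ((𝓕⁻ (h2.toLp v) : Lp ℂ 2 (volume : Measure V)) : V → ℂ) := by
  have hl1 : LocallyIntegrable (𝓕⁻ v) := (continuous_fourierInv_of_integrable h1).locallyIntegrable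
  have hl2 : MemLp ((𝓕⁻ (h2.toLp v) : Lp ℂ 2 (volume : Measure V)) : V → ℂ) 2 := Lp.memLp _
  have h3 := integral_schwartz_mul_fourierInv h1
  have h4 := integral_schwartz_mul_Lp_fourierInv h2
  generalize ((𝓕⁻ (h2.toLp v) : Lp ℂ 2 (volume : Measure V)) : V → ℂ) = F2 at hl2 h4 ⊢
  generalize 𝓕⁻ v = F1 at hl1 h3 ⊢
  refine ae_eq_of_integral_contDiff_smul_eq hl1 (hl2.locallyIntegrable (by norm_num))
    fun g hg hgc => ?_
  have hgc' : HasCompactSupport (fun x => (g x : ℂ)) := hgc.comp_left (g := fun x : ℝ => (x : ℂ)) Complex.ofReal_zero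
  have hg' : ContDiff ℝ ∞ (fun x => (g x : ℂ)) := Complex.ofRealCLM.contDiff.comp hg
  have h5 := (h3 (hgc'.toSchwartzMap hg')).trans (h4 (hgc'.toSchwartzMap hg')).symm
  simpa using h5

theorem memLp_fourierInv {v : V → ℂ} (h1 : Integrable v) (h2 : MemLp v 2) :
    MemLp (𝓕⁻ v) 2 := (memLp_congr_ae (fourierInv_ae_eq_Lp h1 h2)).2 (Lp.memLp _)

theorem eLpNorm_fourierInv {v : V → ℂ} (h1 : Integrable v) (h2 : MemLp v 2) :
    eLpNorm (𝓕⁻ v) 2 = eLpNorm v 2 := by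
  rw [eLpNorm_congr_ae (fourierInv_ae_eq_Lp h1 h2), ← Lp.enorm_def, ← Lp.enorm_toLp (hf := h2)]
  have h : ‖(𝓕⁻ (h2.toLp v) : Lp ℂ 2 (volume : Measure V))‖ = ‖h2.toLp v‖ := by
    exact LinearIsometryEquiv.norm_map (Lp.fourierTransformₗᵢ V ℂ).symm _
  rw [← ofReal_norm, ← ofReal_norm, h]

/-- Write 𝓕 φ (ξ-ζ) as an integral over x and apply Fubini: the phase splits into a factor in ξ and
a factor in ζ, which form the two inverse transforms. -/
theorem integral_prod_fourier_sub {φ v₂ v₃ : V → ℂ} (hφ : Integrable φ) (h₂ : Integrable v₂)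
    (h₃ : Integrable v₃) :
    ∫ z : V × V, conj (v₃ z.1) * 𝓕 φ (z.1 - z.2) * v₂ z.2
      = ∫ x, φ x * (conj (𝓕⁻ v₃ x) * 𝓕⁻ v₂ x) := by
  have hint : Integrable (Function.uncurry fun (z : V × V) (x : V) =>
      (conj (v₃ z.1) * v₂ z.2) * (Real.fourierChar (-⟪x, z.1 - z.2⟫) • φ x))
      ((volume : Measure (V × V)).prod volume) := by
    have h3' : Integrable (fun ξ => conj (v₃ ξ)) :=
      h₃.congr' (Complex.continuous_conj.comp_aestronglyMeasurable h₃.1)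
        (Filter.Eventually.of_forall fun x => by simp)
    have h0 : Integrable (fun q : (V × V) × V => (conj (v₃ q.1.1) * v₂ q.1.2) * φ q.2)
        ((volume : Measure (V × V)).prod volume) := (h3'.mul_prod h₂).mul_prod hφ
    have hc : Continuous fun q : (V × V) × V =>
        Circle.coeHom (Real.fourierChar (-⟪q.2, q.1.1 - q.1.2⟫)) :=
      continuous_subtype_val.comp (Real.continuous_fourierChar.comp (by fun_prop))
    refine (h0.bdd_mul (c := 1) hc.aestronglyMeasurable
      (Filter.Eventually.of_forall fun q => (Circle.norm_coe _).le)).congr (Filter.Eventually.of_forall fun q => ?_)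
    have : ∀ c : Circle, Circle.coeHom c = (c : ℂ) := fun _ => rfl
    simp only [Function.uncurry, Circle.smul_def, smul_eq_mul, this]
    ring
  calc _ = ∫ z : V × V, ∫ x, (conj (v₃ z.1) * v₂ z.2) *
        (Real.fourierChar (-⟪x, z.1 - z.2⟫) • φ x) := by
        congr 1; funext z
        rw [integral_const_mul, ← Real.fourier_eq]
        ring
    _ = ∫ x, ∫ z : V × V, (conj (v₃ z.1) * v₂ z.2) *
        (Real.fourierChar (-⟪x, z.1 - z.2⟫) • φ x) := integral_integral_swap hint
    _ = _ := by
        congr 1; funext x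
        have : ∀ z : V × V, (conj (v₃ z.1) * v₂ z.2) *
            (Real.fourierChar (-⟪x, z.1 - z.2⟫) • φ x)
            = φ x * (conj (Real.fourierChar ⟪z.1, x⟫ • v₃ z.1) *
              (Real.fourierChar ⟪z.2, x⟫ • v₂ z.2)) := by
          intro z
          rw [inner_sub_right, neg_sub, sub_eq_add_neg, AddChar.map_add_eq_mul,
            AddChar.map_neg_eq_inv, real_inner_comm, real_inner_comm x z.1]
          simp only [Circle.smul_def, smul_eq_mul, map_mul, Circle.coe_mul, Circle.coe_inv_eq_conj]
          ring
        simp_rw [this]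
        rw [integral_const_mul, Measure.volume_eq_prod,
          integral_prod_mul (fun ξ => conj (Real.fourierChar ⟪ξ, x⟫ • v₃ ξ))
            (fun ζ => Real.fourierChar ⟪ζ, x⟫ • v₂ ζ), integral_conj, Real.fourierInv_eq,
          Real.fourierInv_eq]

/-- The `L²` norm as a real number. -/
noncomputable def normL2 (u : V → ℂ) : ℝ := (eLpNorm u 2 volume).toReal

theorem normL2_nonneg (u : V → ℂ) : 0 ≤ normL2 u := ENNReal.toReal_nonneg

theorem norm_integral_mul_le_of_bound {φ u₂ u₃ : V → ℂ} {M : ℝ}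
    (hM : ∀ᵐ x, ‖φ x‖ ≤ M) (hM0 : 0 ≤ M) (h₂ : MemLp u₂ 2) (h₃ : MemLp u₃ 2) :
    ‖∫ x, φ x * (conj (u₃ x) * u₂ x)‖ ≤ M * (normL2 u₃ * normL2 u₂) := by
  have hi : Integrable (fun x => ‖u₃ x‖ * ‖u₂ x‖) := h₃.norm.integrable_mul h₂.norm
  have h1 : ∫ x, ‖u₃ x‖ * ‖u₂ x‖ ≤ normL2 u₃ * normL2 u₂ := by
    have := integral_mul_norm_le_Lp_mul_Lq (f := u₃) (g := u₂) (p := 2) (q := 2) (μ := volume)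
      Real.HolderConjugate.two_two (by simpa using h₃) (by simpa using h₂)
    refine this.trans_eq ?_
    rw [normL2, normL2, h₃.eLpNorm_eq_integral_rpow_norm (by norm_num) (by norm_num),
      h₂.eLpNorm_eq_integral_rpow_norm (by norm_num) (by norm_num),
      ENNReal.toReal_ofReal (by positivity), ENNReal.toReal_ofReal (by positivity)]
    simp
  calc _ ≤ ∫ x, M * (‖u₃ x‖ * ‖u₂ x‖) := by
        refine norm_integral_le_of_norm_le (hi.const_mul M) ?_
        filter_upwards [hM] with x hx
        rw [norm_mul, norm_mul, RCLike.norm_conj]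
        gcongr
    _ ≤ _ := by
        rw [integral_const_mul]
        gcongr

theorem norm_integral_prod_fourier_sub_le {φ v₂ v₃ : V → ℂ} {M : ℝ} (hφ : Integrable φ)
    (hM : ∀ᵐ x, ‖φ x‖ ≤ M) (hM0 : 0 ≤ M) (h₂ : Integrable v₂) (h₂' : MemLp v₂ 2)
    (h₃ : Integrable v₃) (h₃' : MemLp v₃ 2) :
    ‖∫ z : V × V, conj (v₃ z.1) * 𝓕 φ (z.1 - z.2) * v₂ z.2‖
      ≤ M * (normL2 v₃ * normL2 v₂) := by
  rw [integral_prod_fourier_sub hφ h₂ h₃]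
  refine (norm_integral_mul_le_of_bound hM hM0 (memLp_fourierInv h₂ h₂')
    (memLp_fourierInv h₃ h₃')).trans_eq ?_
  rw [normL2, normL2, eLpNorm_fourierInv h₂ h₂', eLpNorm_fourierInv h₃ h₃', normL2, normL2]

end FourierForm

/-! ### Symbols of polynomial growth -/

section PolyGrowth

/-- Measurable functions of at most polynomial growth. -/
structure PolyGrowth {E : Type*} [NormedAddCommGroup E] [MeasurableSpace E] (m : E → ℂ) :
    Prop where
  measurable : Measurable m
  bound : ∃ C : ℝ, ∃ k : ℕ, 0 ≤ C ∧ ∀ z, ‖m z‖ ≤ C * (1 + ‖z‖) ^ k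

namespace PolyGrowth

variable {E : Type*} [NormedAddCommGroup E] [MeasurableSpace E] {m n : E → ℂ}

theorem of_bounded (hm : Measurable m) {C : ℝ} (h : ∀ z, ‖m z‖ ≤ C) : PolyGrowth m :=
  ⟨hm, C, 0, (norm_nonneg _).trans (h 0), fun z => by simpa using h z⟩

theorem const (c : ℂ) : PolyGrowth (fun _ : E => c) :=
  of_bounded measurable_const fun _ => le_rfl

theorem mul (hm : PolyGrowth m) (hn : PolyGrowth n) : PolyGrowth (fun z => m z * n z) := by
  obtain ⟨C, k, hC, h⟩ := hm.bound
  obtain ⟨D, l, hD, h'⟩ := hn.bound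
  refine ⟨hm.measurable.mul hn.measurable, C * D, k + l, by positivity, fun z => ?_⟩
  rw [norm_mul]
  calc _ ≤ (C * (1 + ‖z‖) ^ k) * (D * (1 + ‖z‖) ^ l) := by
        gcongr
        · exact h z
        · exact h' z
    _ = _ := by ring

theorem add (hm : PolyGrowth m) (hn : PolyGrowth n) : PolyGrowth (fun z => m z + n z) := by
  obtain ⟨C, k, hC, h⟩ := hm.bound
  obtain ⟨D, l, hD, h'⟩ := hn.bound
  refine ⟨hm.measurable.add hn.measurable, C + D, k + l, by positivity, fun z => ?_⟩
  have h1 : 1 ≤ 1 + ‖z‖ := by linarith [norm_nonneg z]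
  calc _ ≤ ‖m z‖ + ‖n z‖ := norm_add_le _ _
    _ ≤ C * (1 + ‖z‖) ^ k + D * (1 + ‖z‖) ^ l := add_le_add (h z) (h' z)
    _ ≤ C * (1 + ‖z‖) ^ (k + l) + D * (1 + ‖z‖) ^ (k + l) := by
        gcongr
        · omega
        · omega
    _ = _ := by ring

theorem neg (hm : PolyGrowth m) : PolyGrowth (fun z => -m z) := by
  simpa using (const (-1)).mul hm

theorem sub (hm : PolyGrowth m) (hn : PolyGrowth n) : PolyGrowth (fun z => m z - n z) := by
  simpa [sub_eq_add_neg] using hm.add hn.neg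

theorem sum {ι : Type*} (s : Finset ι) {f : ι → E → ℂ} (h : ∀ i, PolyGrowth (f i)) :
    PolyGrowth (fun z => ∑ i ∈ s, f i z) := by
  classical
  induction s using Finset.induction_on with
  | empty => simpa using const 0
  | insert i s hi ih => simpa [Finset.sum_insert hi] using (h i).add ih

theorem of_le (hm : Measurable m) (hn : PolyGrowth n) (h : ∀ z, ‖m z‖ ≤ ‖n z‖) :
    PolyGrowth m := by
  obtain ⟨D, l, hD, h'⟩ := hn.bound
  exact ⟨hm, D, l, hD, fun z => (h z).trans (h' z)⟩

theorem ofReal_norm (hm : PolyGrowth m) : PolyGrowth (fun z => ((‖m z‖ : ℝ) : ℂ)) :=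
  of_le (by have := hm.measurable; fun_prop) hm fun z => by simp

theorem comp_fst {F : Type*} [NormedAddCommGroup F] [MeasurableSpace F] (hm : PolyGrowth m) :
    PolyGrowth (fun z : E × F => m z.1) := by
  obtain ⟨C, k, hC, h⟩ := hm.bound
  refine ⟨hm.measurable.comp measurable_fst, C, k, hC, fun z => (h z.1).trans ?_⟩
  gcongr
  exact norm_fst_le z

theorem comp_snd {F : Type*} [NormedAddCommGroup F] [MeasurableSpace F] (hm : PolyGrowth m) :
    PolyGrowth (fun z : F × E => m z.2) := by
  obtain ⟨C, k, hC, h⟩ := hm.bound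
  refine ⟨hm.measurable.comp measurable_snd, C, k, hC, fun z => (h z.2).trans ?_⟩
  gcongr
  exact norm_snd_le z

end PolyGrowth

end PolyGrowth

/-! ### Trilinear forms given by a symbol -/

section SymbolForm

open FourierTransform SchwartzMap ComplexConjugate
open scoped RealInnerProductSpace

variable {V : Type*} [NormedAddCommGroup V] [InnerProductSpace ℝ V] [FiniteDimensional ℝ V]
  [MeasurableSpace V] [BorelSpace V]

theorem PolyGrowth.integrable_mul_schwartz {a : V → ℂ} (ha : PolyGrowth a) (p : 𝓢(V, ℂ)) :
    Integrable (fun ξ => a ξ * p ξ) := by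
  obtain ⟨C, k, hC, h⟩ := ha.bound
  have h1 : Integrable (fun ξ => C * (2 ^ k * (‖p ξ‖ + ‖ξ‖ ^ k * ‖p ξ‖))) :=
    ((p.integrable.norm.add (p.integrable_pow_mul volume k)).const_mul _).const_mul _
  refine h1.mono' (ha.measurable.aestronglyMeasurable.mul p.continuous.aestronglyMeasurable)
    (Filter.Eventually.of_forall fun ξ => ?_)
  have h2 : (1 + ‖ξ‖) ^ k ≤ 2 ^ k * (1 + ‖ξ‖ ^ k) := by
    have hx := norm_nonneg ξ
    rcases le_total ‖ξ‖ 1 with h1 | h1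
    · calc (1 + ‖ξ‖) ^ k ≤ 2 ^ k := by gcongr; linarith
        _ ≤ _ := le_mul_of_one_le_right (by positivity) (by linarith [pow_nonneg hx k])
    · calc (1 + ‖ξ‖) ^ k ≤ (2 * ‖ξ‖) ^ k := by gcongr; linarith
        _ = 2 ^ k * ‖ξ‖ ^ k := mul_pow _ _ _
        _ ≤ _ := by gcongr; linarith
  calc ‖a ξ * p ξ‖ = ‖a ξ‖ * ‖p ξ‖ := norm_mul _ _
    _ ≤ (C * (2 ^ k * (1 + ‖ξ‖ ^ k))) * ‖p ξ‖ := by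
        gcongr
        exact (h ξ).trans (by gcongr)
    _ = _ := by ring

theorem PolyGrowth.exists_norm_mul_schwartz_le {a : V → ℂ} (ha : PolyGrowth a) (p : 𝓢(V, ℂ)) :
    ∃ M, ∀ ξ, ‖a ξ * p ξ‖ ≤ M := by
  obtain ⟨C, k, hC, h⟩ := ha.bound
  refine ⟨C * (2 ^ k * (Finset.Iic (k, 0)).sup (fun m => SchwartzMap.seminorm ℝ m.1 m.2) p),
    fun ξ => ?_⟩
  have h1 := SchwartzMap.one_add_le_sup_seminorm_apply (𝕜 := ℝ) (m := (k, 0)) le_rfl le_rfl p ξ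
  rw [norm_iteratedFDeriv_zero] at h1
  rw [norm_mul]
  calc _ ≤ (C * (1 + ‖ξ‖) ^ k) * ‖p ξ‖ := by
        gcongr
        exact h ξ
    _ = C * ((1 + ‖ξ‖) ^ k * ‖p ξ‖) := by ring
    _ ≤ _ := by gcongr

theorem PolyGrowth.memLp_mul_schwartz {a : V → ℂ} (ha : PolyGrowth a) (p : 𝓢(V, ℂ)) :
    MemLp (fun ξ => a ξ * p ξ) 2 := by
  obtain ⟨M, hM⟩ := ha.exists_norm_mul_schwartz_le p
  have h1 := ha.integrable_mul_schwartz p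
  rw [memLp_two_iff_integrable_sq_norm h1.1]
  refine (h1.norm.const_mul M).mono' (h1.1.norm.pow 2) (Filter.Eventually.of_forall fun ξ => ?_)
  rw [Real.norm_of_nonneg (by positivity), sq]
  gcongr
  exact hM ξ

/-- The trilinear form with symbol `m`. -/
noncomputable def symbolForm (p₁ p₂ p₃ : 𝓢(V, ℂ)) (m : V × V → ℂ) : ℂ :=
  ∫ z : V × V, m z * (conj (p₃ z.1) * p₁ (z.1 - z.2) * p₂ z.2)

/-- Since 1 + ‖z‖ ≤ (1 + ‖z.1‖)(1 + ‖z.2‖), the decay of `p₃` and `p₂` absorbs the growth of the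
symbol; of `p₁` only boundedness is used. -/
theorem integrable_symbolForm (p₁ p₂ p₃ : 𝓢(V, ℂ)) {m : V × V → ℂ} (hm : PolyGrowth m) :
    Integrable (fun z : V × V => m z * (conj (p₃ z.1) * p₁ (z.1 - z.2) * p₂ z.2)) := by
  obtain ⟨C, k, hC, h⟩ := hm.bound
  have hk : PolyGrowth (fun ξ : V => (((1 + ‖ξ‖) ^ k : ℝ) : ℂ)) :=
    ⟨by fun_prop, 1, k, zero_le_one, fun z => by
      rw [Complex.norm_real, Real.norm_of_nonneg (by positivity), one_mul]⟩
  obtain ⟨M, hM⟩ := (PolyGrowth.const (E := V) 1).exists_norm_mul_schwartz_le p₁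
  have h0 := ((hk.integrable_mul_schwartz p₃).norm.mul_prod
    (hk.integrable_mul_schwartz p₂).norm).const_mul (C * M)
  refine h0.mono' ?_ (Filter.Eventually.of_forall fun z => ?_)
  · refine hm.measurable.aestronglyMeasurable.mul ?_
    have h3 := p₃.continuous
    have h1 := p₁.continuous
    have h2 := p₂.continuous
    have hc : Continuous fun z : V × V => conj (p₃ z.1) * p₁ (z.1 - z.2) * p₂ z.2 :=
      ((Complex.continuous_conj.comp (h3.comp continuous_fst)).mul
        (h1.comp (continuous_fst.sub continuous_snd))).mul (h2.comp continuous_snd)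
    exact hc.aestronglyMeasurable
  · have h1 : 1 + ‖z‖ ≤ (1 + ‖z.1‖) * (1 + ‖z.2‖) := by
      have := norm_nonneg z.1
      have := norm_nonneg z.2
      rcases max_cases ‖z.1‖ ‖z.2‖ with ⟨h, -⟩ | ⟨h, -⟩ <;> rw [Prod.norm_def, h] <;> nlinarith
    have h2 := hM (z.1 - z.2)
    rw [one_mul] at h2
    have h3 : 0 ≤ M := (norm_nonneg _).trans h2
    rw [norm_mul, norm_mul, norm_mul, RCLike.norm_conj, norm_mul, norm_mul, Complex.norm_real,
      Complex.norm_real, Real.norm_of_nonneg (by positivity), Real.norm_of_nonneg (by positivity)]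
    calc _ ≤ (C * ((1 + ‖z.1‖) * (1 + ‖z.2‖)) ^ k) * (‖p₃ z.1‖ * M * ‖p₂ z.2‖) := by
          gcongr
          exact (h z).trans (by gcongr)
      _ = _ := by rw [mul_pow]; ring

theorem symbolForm_add (p₁ p₂ p₃ : 𝓢(V, ℂ)) {m n : V × V → ℂ} (hm : PolyGrowth m)
    (hn : PolyGrowth n) : symbolForm p₁ p₂ p₃ (fun z => m z + n z)
      = symbolForm p₁ p₂ p₃ m + symbolForm p₁ p₂ p₃ n := by
  rw [symbolForm, symbolForm, symbolForm,
    ← integral_add (integrable_symbolForm p₁ p₂ p₃ hm) (integrable_symbolForm p₁ p₂ p₃ hn)]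
  simp_rw [add_mul]

theorem symbolForm_const_mul (p₁ p₂ p₃ : 𝓢(V, ℂ)) (c : ℂ) (m : V × V → ℂ) :
    symbolForm p₁ p₂ p₃ (fun z => c * m z) = c * symbolForm p₁ p₂ p₃ m := by
  rw [symbolForm, symbolForm, ← integral_const_mul]
  simp_rw [mul_assoc]

theorem norm_symbolForm_add_le (p₁ p₂ p₃ : 𝓢(V, ℂ)) {m n : V × V → ℂ} (hm : PolyGrowth m)
    (hn : PolyGrowth n) {M N : ℝ} (hM : ‖symbolForm p₁ p₂ p₃ m‖ ≤ M)
    (hN : ‖symbolForm p₁ p₂ p₃ n‖ ≤ N) :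
    ‖symbolForm p₁ p₂ p₃ (fun z => m z + n z)‖ ≤ M + N := by
  rw [symbolForm_add p₁ p₂ p₃ hm hn]
  exact (norm_add_le _ _).trans (add_le_add hM hN)

/-- A product symbol is absorbed into the two L² factors, so the bound sees only the sup norm of φ
in physical space. No smoothness of `a` or `b` is required, which is what later admits discontinuous
factors. -/
theorem norm_symbolForm_le (φ p₂ p₃ : 𝓢(V, ℂ)) {a b : V → ℂ} (ha : PolyGrowth a)
    (hb : PolyGrowth b) {M N₂ N₃ : ℝ} (hM : ∀ᵐ x, ‖φ x‖ ≤ M) (hM0 : 0 ≤ M)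
    (h₃ : normL2 (fun ξ => a ξ * p₃ ξ) ≤ N₃) (h₂ : normL2 (fun ξ => b ξ * p₂ ξ) ≤ N₂) :
    ‖symbolForm (𝓕 φ) p₂ p₃ (fun z => a z.1 * b z.2)‖ ≤ M * (N₃ * N₂) := by
  have ha' : PolyGrowth fun ξ => conj (a ξ) := by
    obtain ⟨C, k, hC, h⟩ := ha.bound
    exact ⟨Complex.continuous_conj.measurable.comp ha.measurable, C, k, hC, fun z => by
      simpa using h z⟩
  have h := norm_integral_prod_fourier_sub_le (φ := φ) (v₃ := fun ξ => conj (a ξ) * p₃ ξ)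
    (v₂ := fun ξ => b ξ * p₂ ξ) φ.integrable hM hM0 (hb.integrable_mul_schwartz p₂)
    (hb.memLp_mul_schwartz p₂) (ha'.integrable_mul_schwartz p₃) (ha'.memLp_mul_schwartz p₃)
  have e1 : symbolForm (𝓕 φ) p₂ p₃ (fun z => a z.1 * b z.2)
      = ∫ z : V × V, conj (conj (a z.1) * p₃ z.1) * 𝓕 (φ : V → ℂ) (z.1 - z.2)
        * (b z.2 * p₂ z.2) := by
    rw [symbolForm]
    congr 1
    funext z
    rw [map_mul, Complex.conj_conj, fourier_coe]
    ring
  rw [e1]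
  refine h.trans ?_
  have e2 : normL2 (fun ξ => conj (a ξ) * p₃ ξ) = normL2 (fun ξ => a ξ * p₃ ξ) := by
    have : eLpNorm (fun ξ => conj (a ξ) * p₃ ξ) 2 volume = eLpNorm (fun ξ => a ξ * p₃ ξ) 2 volume :=
      eLpNorm_congr_norm_ae (Filter.Eventually.of_forall fun ξ => by simp)
    rw [normL2, normL2, this]
  rw [e2]
  exact mul_le_mul_of_nonneg_left (mul_le_mul h₃ h₂ (normL2_nonneg _)
    ((normL2_nonneg _).trans h₃)) hM0

theorem normL2_le_of_norm_le_sum {ι : Type*} (s : Finset ι) {f : V → ℂ} {g : ι → V → ℂ}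
    (hg : ∀ i ∈ s, MemLp (g i) 2) (h : ∀ ξ, ‖f ξ‖ ≤ ∑ i ∈ s, ‖g i ξ‖) :
    normL2 f ≤ ∑ i ∈ s, normL2 (g i) := by
  have h1 : eLpNorm f 2 volume ≤ ∑ i ∈ s, eLpNorm (fun ξ => ‖g i ξ‖) 2 volume := by
    refine (eLpNorm_mono_real h).trans ?_
    have := eLpNorm_sum_le (μ := (volume : Measure V)) (p := 2) (s := s)
      (f := fun i ξ => ‖g i ξ‖) (fun i hi => (hg i hi).1.norm) (by norm_num)
    convert! this using 2
    ext ξ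
    simp
  simp_rw [eLpNorm_norm] at h1
  unfold normL2
  rw [← ENNReal.toReal_sum fun i hi => (hg i hi).2.ne]
  exact ENNReal.toReal_mono (ENNReal.sum_lt_top.2 fun i hi => (hg i hi).2).ne h1

theorem normL2_mono {f g : V → ℂ} (hg : MemLp g 2) (h : ∀ ξ, ‖f ξ‖ ≤ ‖g ξ‖) :
    normL2 f ≤ normL2 g := by
  simpa using normL2_le_of_norm_le_sum (Finset.univ : Finset Unit) (f := f) (g := fun _ => g)
    (fun _ _ => hg) (by simpa using h)

theorem normL2_sq_eq {f : V → ℂ} (hf : MemLp f 2) : normL2 f ^ 2 = ∫ ξ, ‖f ξ‖ ^ 2 := by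
  rw [normL2, hf.eLpNorm_eq_integral_rpow_norm (by norm_num) (by norm_num),
    ENNReal.toReal_ofReal (by positivity)]
  have h0 : 0 ≤ ∫ ξ, ‖f ξ‖ ^ 2 := integral_nonneg fun _ => by positivity
  simp only [ENNReal.toReal_ofNat, Real.rpow_ofNat, ← one_div]
  rw [← Real.sqrt_eq_rpow, Real.sq_sqrt h0]

/-- The geometric-mean bound for multipliers. -/
theorem normL2_sq_le_of_sq_le {f g h : V → ℂ} (hf : MemLp f 2) (hg : MemLp g 2) (hh : MemLp h 2)
    (hle : ∀ ξ, ‖f ξ‖ ^ 2 ≤ ‖g ξ‖ * ‖h ξ‖) : normL2 f ^ 2 ≤ normL2 g * normL2 h := by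
  rw [normL2_sq_eq hf]
  have hi : Integrable (fun x => ‖g x‖ * ‖h x‖) := hg.norm.integrable_mul hh.norm
  calc _ ≤ ∫ ξ, ‖g ξ‖ * ‖h ξ‖ := integral_mono ((memLp_two_iff_integrable_sq_norm hf.1).1 hf) hi hle
    _ ≤ _ := by
      have := integral_mul_norm_le_Lp_mul_Lq (f := g) (g := h) (p := 2) (q := 2) (μ := volume)
        Real.HolderConjugate.two_two (by simpa using hg) (by simpa using hh)
      refine this.trans_eq ?_
      rw [normL2, normL2, hg.eLpNorm_eq_integral_rpow_norm (by norm_num) (by norm_num),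
        hh.eLpNorm_eq_integral_rpow_norm (by norm_num) (by norm_num),
        ENNReal.toReal_ofReal (by positivity), ENNReal.toReal_ofReal (by positivity)]
      simp

end SymbolForm

/-! ### Geometry of the light cone and multiplier bounds -/

section ConeGeometry

open FourierTransform SchwartzMap ComplexConjugate LineDeriv
open scoped RealInnerProductSpace

variable {V : Type*} [NormedAddCommGroup V] [InnerProductSpace ℝ V] [FiniteDimensional ℝ V]
  [MeasurableSpace V] [BorelSpace V] {d : ℕ}

/-- The frequency dual to the direction `v c`. -/
noncomputable def freq (v : Fin (d + 1) → V) (c : Fin (d + 1)) (ξ : V) : ℝ :=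
  2 * Real.pi * ⟪ξ, v c⟫

/-- The vector of spatial frequencies. -/
noncomputable def spaceFreq (v : Fin (d + 1) → V) (ξ : V) : EuclideanSpace ℝ (Fin d) :=
  WithLp.toLp 2 fun i => freq v i.succ ξ

/-- The sign of the temporal frequency. -/
noncomputable def timeSign (v : Fin (d + 1) → V) (ξ : V) : ℝ :=
  if 0 ≤ freq v 0 ξ then 1 else -1

/-- The null direction, `±η/|η|`, of a frequency. -/
noncomputable def nullDir (v : Fin (d + 1) → V) (ξ : V) : EuclideanSpace ℝ (Fin d) :=
  (timeSign v ξ / ‖spaceFreq v ξ‖) • spaceFreq v ξ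

/-- The quantity `|τ| - |η|`. -/
noncomputable def coneDefect (v : Fin (d + 1) → V) (ξ : V) : ℝ :=
  |freq v 0 ξ| - ‖spaceFreq v ξ‖

/-- The quadratic form `|η|² - τ²`. -/
noncomputable def quadForm (v : Fin (d + 1) → V) (ξ : V) : ℝ :=
  ‖spaceFreq v ξ‖ ^ 2 - freq v 0 ξ ^ 2

variable (v : Fin (d + 1) → V) (c : Fin (d + 1))

@[fun_prop]
theorem measurable_freq : Measurable (freq v c) := by
  unfold freq; fun_prop

@[fun_prop]
theorem measurable_spaceFreq : Measurable (spaceFreq v) := by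
  unfold spaceFreq; fun_prop

@[fun_prop]
theorem measurable_timeSign : Measurable (timeSign v) :=
  Measurable.ite (measurableSet_le measurable_const (measurable_freq v 0)) measurable_const
    measurable_const

@[fun_prop]
theorem measurable_nullDir : Measurable (nullDir v) := by
  unfold nullDir; fun_prop

@[fun_prop]
theorem measurable_coneDefect : Measurable (coneDefect v) := by
  unfold coneDefect
  exact (measurable_freq v 0).abs.sub (measurable_spaceFreq v).norm

theorem polyGrowth_freq : PolyGrowth (fun ξ => (freq v c ξ : ℂ)) := by
  refine ⟨by fun_prop, 2 * Real.pi * ‖v c‖, 1, by positivity, fun z => ?_⟩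
  rw [Complex.norm_real, freq, norm_mul, Real.norm_of_nonneg (by positivity)]
  have : ‖⟪z, v c⟫‖ ≤ ‖z‖ * ‖v c‖ := norm_inner_le_norm _ _
  have h2 : 0 ≤ 2 * Real.pi * ‖v c‖ := by positivity
  calc _ ≤ 2 * Real.pi * (‖z‖ * ‖v c‖) := by gcongr
    _ = 2 * Real.pi * ‖v c‖ * ‖z‖ := by ring
    _ ≤ _ := by
      gcongr
      linarith

theorem freq_sub (ξ ζ : V) : freq v c (ξ - ζ) = freq v c ξ - freq v c ζ := by
  simp only [freq, inner_sub_left]; ring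

theorem spaceFreq_apply (ξ : V) (i : Fin d) : spaceFreq v ξ i = freq v i.succ ξ := rfl

theorem spaceFreq_sub (ξ ζ : V) : spaceFreq v (ξ - ζ) = spaceFreq v ξ - spaceFreq v ζ := by
  ext i
  simp [spaceFreq_apply, freq_sub]

theorem norm_spaceFreq_sq (ξ : V) : ‖spaceFreq v ξ‖ ^ 2 = ∑ i : Fin d, freq v i.succ ξ ^ 2 := by
  simp [EuclideanSpace.norm_sq_eq, spaceFreq_apply]

theorem norm_spaceFreq_le (ξ : V) : ‖spaceFreq v ξ‖ ≤ ∑ i : Fin d, |freq v i.succ ξ| := by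
  refine le_of_sq_le_sq ?_ (Finset.sum_nonneg fun _ _ => abs_nonneg _)
  rw [norm_spaceFreq_sq]
  simp_rw [← sq_abs (freq v _ ξ)]
  exact Finset.sum_sq_le_sq_sum_of_nonneg fun _ _ => abs_nonneg _

theorem abs_freq_succ_le (ξ : V) (i : Fin d) : |freq v i.succ ξ| ≤ ‖spaceFreq v ξ‖ := by
  have := PiLp.norm_apply_le (spaceFreq v ξ) i
  rwa [spaceFreq_apply] at this

theorem timeSign_sq (ξ : V) : timeSign v ξ * timeSign v ξ = 1 := by
  unfold timeSign; split_ifs <;> norm_num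

theorem abs_timeSign (ξ : V) : |timeSign v ξ| = 1 := by
  unfold timeSign; split_ifs <;> norm_num

theorem timeSign_mul_abs (ξ : V) : timeSign v ξ * |freq v 0 ξ| = freq v 0 ξ := by
  unfold timeSign
  split_ifs with h
  · rw [abs_of_nonneg h, one_mul]
  · rw [abs_of_neg (not_le.1 h)]; ring

theorem smul_nullDir (ξ : V) :
    (timeSign v ξ * ‖spaceFreq v ξ‖) • nullDir v ξ = spaceFreq v ξ := by
  rw [nullDir, smul_smul]
  by_cases h : ‖spaceFreq v ξ‖ = 0
  · rw [norm_eq_zero.1 h, smul_zero]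
  · have : timeSign v ξ * ‖spaceFreq v ξ‖ * (timeSign v ξ / ‖spaceFreq v ξ‖) = 1 := by
      field_simp
      rw [sq, timeSign_sq]
    rw [this, one_smul]

theorem freq_succ_eq (ξ : V) (i : Fin d) :
    freq v i.succ ξ = timeSign v ξ * ‖spaceFreq v ξ‖ * nullDir v ξ i := by
  rw [← spaceFreq_apply, ← smul_nullDir v ξ, PiLp.smul_apply, smul_nullDir, smul_eq_mul]

theorem norm_nullDir_le (ξ : V) : ‖nullDir v ξ‖ ≤ 1 := by
  rw [nullDir, norm_smul, Real.norm_eq_abs, abs_div, abs_timeSign, abs_norm]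
  rw [div_mul_eq_mul_div, one_mul]
  exact div_self_le_one _

/-- The null direction is a unit vector except where the spatial frequency vanishes, where division
by zero makes it 0; the weight `‖spaceFreq v ξ‖` removes the exception. -/
theorem norm_mul_norm_nullDir_sq (ξ : V) :
    ‖spaceFreq v ξ‖ * ‖nullDir v ξ‖ ^ 2 = ‖spaceFreq v ξ‖ := by
  by_cases h : ‖spaceFreq v ξ‖ = 0
  · rw [h, zero_mul]
  · rw [nullDir, norm_smul, Real.norm_eq_abs, abs_div, abs_timeSign, abs_norm]
    field_simp

theorem abs_nullDir_apply_le (ξ : V) (i : Fin d) : |nullDir v ξ i| ≤ 1 :=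
  (PiLp.norm_apply_le (nullDir v ξ) i).trans (norm_nullDir_le v ξ)

theorem quadForm_eq (ξ : V) :
    quadForm v ξ = -(coneDefect v ξ * (|freq v 0 ξ| + ‖spaceFreq v ξ‖)) := by
  rw [quadForm, coneDefect, ← sq_abs (freq v 0 ξ)]; ring

/-- In |q| = ||τ| - |η||·(|τ| + |η|) the second factor dominates the first. Near zero frequency
nothing better is true, hence only √ε for the defect alone. -/
theorem abs_coneDefect_sq_le (ξ : V) : |coneDefect v ξ| ^ 2 ≤ |quadForm v ξ| := by
  rw [quadForm_eq, abs_neg, abs_mul, sq]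
  refine mul_le_mul_of_nonneg_left ?_ (abs_nonneg _)
  have h1 := abs_nonneg (freq v 0 ξ)
  have h2 := norm_nonneg (spaceFreq v ξ)
  rw [coneDefect, abs_of_nonneg (add_nonneg h1 h2), abs_le]
  constructor <;> linarith

theorem abs_freq_le (ξ : V) : |freq v c ξ| ≤ |freq v 0 ξ| + ‖spaceFreq v ξ‖ := by
  refine Fin.cases ?_ (fun i => ?_) c
  · linarith [norm_nonneg (spaceFreq v ξ)]
  · linarith [abs_freq_succ_le v ξ i, abs_nonneg (freq v 0 ξ)]

/-- When a frequency multiplies the defect, that frequency takes the place of |τ| + |η|, and the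
full gain ε of the quadratic form is kept. -/
theorem abs_freq_mul_coneDefect_le (ξ : V) :
    |freq v c ξ * coneDefect v ξ| ≤ |quadForm v ξ| := by
  rw [quadForm_eq, abs_neg, abs_mul, abs_mul, mul_comm]
  refine mul_le_mul_of_nonneg_left ?_ (abs_nonneg _)
  exact (abs_freq_le v c ξ).trans (le_abs_self _)

/-- Up to terms that vanish on the light cone, the squared distance of two null directions is the
product of the frequencies. -/
theorem norm_nullDir_sub_sq (ξ ζ : V) :
    ‖spaceFreq v ξ‖ * ‖spaceFreq v ζ‖ * ‖nullDir v ξ - nullDir v ζ‖ ^ 2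
      = -(timeSign v ξ * timeSign v ζ * (quadForm v ξ + quadForm v ζ - quadForm v (ξ - ζ)))
        - 2 * coneDefect v ξ * ‖spaceFreq v ζ‖ - 2 * |freq v 0 ξ| * coneDefect v ζ := by
  -- Polarization gives the Lorentzian product of ξ and ζ. Writing it in terms of the null
  -- directions, it would be proportional to ⟨Ω(ξ), Ω(ζ)⟩ - 1 on the cone; the defects record the
  -- distance from it.
  have h1 : quadForm v ξ + quadForm v ζ - quadForm v (ξ - ζ)
      = 2 * (⟪spaceFreq v ξ, spaceFreq v ζ⟫ - freq v 0 ξ * freq v 0 ζ) := by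
    rw [quadForm, quadForm, quadForm, spaceFreq_sub, freq_sub, norm_sub_sq_real]; ring
  have h2 : ⟪spaceFreq v ξ, spaceFreq v ζ⟫
      = timeSign v ξ * timeSign v ζ * (‖spaceFreq v ξ‖ * ‖spaceFreq v ζ‖
        * ⟪nullDir v ξ, nullDir v ζ⟫) := by
    conv_lhs => rw [← smul_nullDir v ξ, ← smul_nullDir v ζ]
    rw [real_inner_smul_left, real_inner_smul_right]; ring
  have h3 : freq v 0 ξ * freq v 0 ζ
      = timeSign v ξ * timeSign v ζ * (|freq v 0 ξ| * |freq v 0 ζ|) := by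
    conv_lhs => rw [← timeSign_mul_abs v ξ, ← timeSign_mul_abs v ζ]
    ring
  have h4 := norm_mul_norm_nullDir_sq v ξ
  have h5 := norm_mul_norm_nullDir_sq v ζ
  have h6 := timeSign_sq v ξ
  have h7 := timeSign_sq v ζ
  rw [h1, h2, h3, norm_sub_sq_real, coneDefect, coneDefect]
  linear_combination ‖spaceFreq v ζ‖ * h4 + ‖spaceFreq v ξ‖ * h5
    + (2 * (‖spaceFreq v ξ‖ * ‖spaceFreq v ζ‖ * ⟪nullDir v ξ, nullDir v ζ⟫
      - |freq v 0 ξ| * |freq v 0 ζ|)) * (timeSign v ζ * timeSign v ζ) * h6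
    + (2 * (‖spaceFreq v ξ‖ * ‖spaceFreq v ζ‖ * ⟪nullDir v ξ, nullDir v ζ⟫
      - |freq v 0 ξ| * |freq v 0 ζ|)) * h7

/-- The bound `‖a p‖_{L²} ≤ N` for a multiplier `a` of polynomial growth. -/
structure MultBound (p : 𝓢(V, ℂ)) (a : V → ℂ) (N : ℝ) : Prop where
  growth : PolyGrowth a
  le : normL2 (fun ξ => a ξ * p ξ) ≤ N

variable {v c} {p p₂ p₃ φ : 𝓢(V, ℂ)}

theorem MultBound.mono {a g : V → ℂ} {N : ℝ} (h : MultBound p g N) (ha : Measurable a)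
    (hle : ∀ ξ, ‖a ξ‖ ≤ ‖g ξ‖) : MultBound p a N :=
  ⟨.of_le ha h.growth hle, (normL2_mono (h.growth.memLp_mul_schwartz p) fun ξ => by
    rw [norm_mul, norm_mul]; gcongr; exact hle ξ).trans h.le⟩

theorem MultBound.of_le_sum {ι : Type*} (s : Finset ι) {a : V → ℂ} {g : ι → V → ℂ} {N : ℝ}
    (h : ∀ i, MultBound p (g i) N) (ha : Measurable a)
    (hle : ∀ ξ, ‖a ξ‖ ≤ ∑ i ∈ s, ‖g i ξ‖) : MultBound p a (s.card * N) := by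
  refine ⟨.of_le (n := fun ξ => ∑ i ∈ s, ((‖g i ξ‖ : ℝ) : ℂ)) ha
    (PolyGrowth.sum s fun i => ?_) fun ξ => ?_, ?_⟩
  · have hm := (h i).growth.measurable
    exact .of_le (by fun_prop) (h i).growth fun ξ => by simp
  · rw [← Complex.ofReal_sum, Complex.norm_real]
    exact (hle ξ).trans (le_abs_self _)
  · refine (normL2_le_of_norm_le_sum s (f := fun ξ => a ξ * p ξ) (g := fun i ξ => g i ξ * p ξ)
      (fun i _ => (h i).growth.memLp_mul_schwartz p) fun ξ => ?_).trans ?_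
    · rw [norm_mul]
      simp_rw [norm_mul, ← Finset.sum_mul]
      gcongr
      exact hle ξ
    · refine (Finset.sum_le_sum fun i _ => (h i).le).trans ?_
      simp

/-- `L²` bounds for a function and its first two derivatives along the frame `v`, and a better one
for the flat wave operator of the frame, in terms of the Fourier transform `p`. -/
structure FreqBound (v : Fin (d + 1) → V) (p : 𝓢(V, ℂ)) (ε a : ℝ) : Prop where
  zero : MultBound p (fun _ => 1) a
  one : ∀ c, MultBound p (fun ξ => (freq v c ξ : ℂ)) a
  two : ∀ c c', MultBound p (fun ξ => ((freq v c ξ * freq v c' ξ : ℝ) : ℂ)) a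
  quad : MultBound p (fun ξ => (quadForm v ξ : ℂ)) (ε * a)

namespace FreqBound

variable {ε a : ℝ} (h : FreqBound v p ε a)
include h

theorem nonneg : 0 ≤ a := (normL2_nonneg _).trans h.zero.le

/-- |η| is at most the sum of the |ηᵢ|, so d second-order bounds add up. -/
theorem freq_mul_norm (c : Fin (d + 1)) :
    MultBound p (fun ξ => ((freq v c ξ * ‖spaceFreq v ξ‖ : ℝ) : ℂ)) (d * a) := by
  have := MultBound.of_le_sum (Finset.univ : Finset (Fin d))
    (a := fun ξ => ((freq v c ξ * ‖spaceFreq v ξ‖ : ℝ) : ℂ)) (fun i => h.two c i.succ)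
    (by fun_prop) fun ξ => by
      simp only [Complex.norm_real, norm_mul, norm_norm, ← Finset.mul_sum]
      gcongr
      exact norm_spaceFreq_le v ξ
  simpa using this

theorem norm_space : MultBound p (fun ξ => ((‖spaceFreq v ξ‖ : ℝ) : ℂ)) (d * a) := by
  have := MultBound.of_le_sum (Finset.univ : Finset (Fin d))
    (a := fun ξ => ((‖spaceFreq v ξ‖ : ℝ) : ℂ)) (fun i => h.one i.succ)
    (by fun_prop) fun ξ => by
      simp only [Complex.norm_real, norm_norm]
      exact norm_spaceFreq_le v ξ
  simpa using this

theorem freq_mul_coneDefect (c : Fin (d + 1)) :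
    MultBound p (fun ξ => ((freq v c ξ * coneDefect v ξ : ℝ) : ℂ)) (ε * a) :=
  h.quad.mono (by fun_prop) fun ξ => by
    rw [Complex.norm_real, Complex.norm_real]
    exact abs_freq_mul_coneDefect_le v c ξ

/-- Geometric mean of the bounds `εa` for the quadratic form and `a` for the constant 1, by
`abs_coneDefect_sq_le` and Cauchy-Schwarz. -/
theorem coneDefect (hε : 0 ≤ ε) : MultBound p (fun ξ => (coneDefect v ξ : ℂ)) (√ε * a) := by
  have ha := h.nonneg
  have hg : PolyGrowth (fun ξ => (_root_.coneDefect v ξ : ℂ)) := by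
    simpa [_root_.coneDefect] using (polyGrowth_freq v 0).ofReal_norm.sub h.norm_space.growth
  refine ⟨hg, ?_⟩
  have h1 := normL2_sq_le_of_sq_le (hg.memLp_mul_schwartz p)
    (h.quad.growth.memLp_mul_schwartz p) (h.zero.growth.memLp_mul_schwartz p) fun ξ => by
      simp only [norm_mul, Complex.norm_real, one_mul]
      rw [mul_pow, sq ‖p ξ‖, ← mul_assoc]
      gcongr
      exact abs_coneDefect_sq_le v ξ
  have h2 : normL2 (fun ξ => (_root_.coneDefect v ξ : ℂ) * p ξ) ^ 2 ≤ (√ε * a) ^ 2 := by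
    refine h1.trans ((mul_le_mul h.quad.le h.zero.le (normL2_nonneg _)
      (by positivity)).trans_eq ?_)
    rw [mul_pow, Real.sq_sqrt hε]; ring
  exact le_of_sq_le_sq h2 (by positivity)

end FreqBound

end ConeGeometry

/-! ### Symbol calculus, and the squared difference of null directions -/

section FlatEstimate

open FourierTransform SchwartzMap ComplexConjugate LineDeriv
open scoped RealInnerProductSpace

variable {V : Type*} [NormedAddCommGroup V] [InnerProductSpace ℝ V] [FiniteDimensional ℝ V]
  [MeasurableSpace V] [BorelSpace V] {d : ℕ}

/-- The wave operator `-∂_{v 0}² + ∑ ∂_{v i}²` of the constant frame `v`. -/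
noncomputable def boxFlat (v : Fin (d + 1) → V) (φ : 𝓢(V, ℂ)) : 𝓢(V, ℂ) :=
  (∑ i : Fin d, ∂_{v i.succ} (∂_{v i.succ} φ)) - ∂_{v 0} (∂_{v 0} φ)

theorem fourier_lineDeriv_apply (v : Fin (d + 1) → V) (c : Fin (d + 1)) (φ : 𝓢(V, ℂ)) (ξ : V) :
    𝓕 (∂_{v c} φ) ξ = Complex.I * (freq v c ξ * 𝓕 φ ξ) := by
  have : (inner ℝ · (v c)).HasTemperateGrowth := ((innerSL ℝ).flip (v c)).hasTemperateGrowth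
  rw [SchwartzMap.fourier_lineDerivOp_eq, smul_apply, smulLeftCLM_apply_apply this, freq]
  simp only [smul_eq_mul, Complex.real_smul]
  push_cast
  ring

theorem fourier_boxFlat_apply (v : Fin (d + 1) → V) (φ : 𝓢(V, ℂ)) (ξ : V) :
    𝓕 (boxFlat v φ) ξ = -(quadForm v ξ * 𝓕 φ ξ) := by
  have h : 𝓕 (boxFlat v φ) = (∑ i : Fin d, 𝓕 (∂_{v i.succ} (∂_{v i.succ} φ)))
      - 𝓕 (∂_{v 0} (∂_{v 0} φ)) := by
    rw [boxFlat]
    have h1 := map_sub (fourierCLM ℂ 𝓢(V, ℂ)) (∑ i : Fin d, ∂_{v i.succ} (∂_{v i.succ} φ))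
      (∂_{v 0} (∂_{v 0} φ))
    rw [map_sum] at h1
    exact h1
  rw [h, sub_apply, sum_apply]
  simp_rw [fourier_lineDeriv_apply]
  rw [quadForm, norm_spaceFreq_sq]
  push_cast
  have h1 : ∀ c, Complex.I * (freq v c ξ * (Complex.I * (freq v c ξ * 𝓕 φ ξ)))
      = -((freq v c ξ : ℂ) ^ 2 * 𝓕 φ ξ) := fun c => by
    linear_combination ((freq v c ξ : ℂ) ^ 2 * 𝓕 φ ξ) * Complex.I_sq
  simp_rw [h1]
  rw [sub_mul, Finset.sum_mul, Finset.sum_neg_distrib]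
  ring

/-- Sup bounds for a function and its first derivatives along the frame `v`, and a better one
for the flat wave operator of the frame. -/
structure SupBound (v : Fin (d + 1) → V) (φ : 𝓢(V, ℂ)) (ε a : ℝ) : Prop where
  nonneg : 0 ≤ a
  zero : ∀ᵐ x, ‖φ x‖ ≤ a
  one : ∀ c, ∀ᵐ x, ‖(∂_{v c} φ) x‖ ≤ a
  quad : ∀ᵐ x, ‖boxFlat v φ x‖ ≤ ε * a

/-- The bound `N` for the trilinear form with symbol `m`. -/
structure FormBound (φ p₂ p₃ : 𝓢(V, ℂ)) (m : V × V → ℂ) (N : ℝ) : Prop where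
  growth : PolyGrowth m
  le : ‖symbolForm (𝓕 φ) p₂ p₃ m‖ ≤ N

variable {v : Fin (d + 1) → V} {φ p₂ p₃ : 𝓢(V, ℂ)} {a b β : V → ℂ} {m n : V × V → ℂ}
  {ε a₁ a₂ a₃ M N N₂ N₃ : ℝ}

theorem polyGrowth_freq_sub (v : Fin (d + 1) → V) (c : Fin (d + 1)) :
    PolyGrowth (fun z : V × V => (freq v c (z.1 - z.2) : ℂ)) := by
  simpa [freq_sub] using (polyGrowth_freq v c).comp_fst.sub (polyGrowth_freq v c).comp_snd

theorem polyGrowth_quadForm_sub (v : Fin (d + 1) → V) :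
    PolyGrowth (fun z : V × V => (quadForm v (z.1 - z.2) : ℂ)) := by
  have h : (fun z : V × V => (quadForm v (z.1 - z.2) : ℂ)) = fun z : V × V =>
      (∑ i : Fin d, (freq v i.succ (z.1 - z.2) : ℂ) * freq v i.succ (z.1 - z.2))
        - freq v 0 (z.1 - z.2) * freq v 0 (z.1 - z.2) := by
    funext z
    rw [quadForm, norm_spaceFreq_sq]
    push_cast
    simp_rw [sq]
  rw [h]
  exact (PolyGrowth.sum _ fun i => (polyGrowth_freq_sub v _).mul (polyGrowth_freq_sub v _)).sub
    ((polyGrowth_freq_sub v _).mul (polyGrowth_freq_sub v _))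

namespace FormBound

theorem add (hm : FormBound φ p₂ p₃ m M) (hn : FormBound φ p₂ p₃ n N) :
    FormBound φ p₂ p₃ (fun z => m z + n z) (M + N) :=
  ⟨hm.growth.add hn.growth, norm_symbolForm_add_le _ _ _ hm.growth hn.growth hm.le hn.le⟩

theorem const_mul (hm : FormBound φ p₂ p₃ m M) (c : ℂ) :
    FormBound φ p₂ p₃ (fun z => c * m z) (‖c‖ * M) :=
  ⟨(PolyGrowth.const c).mul hm.growth, by
    rw [symbolForm_const_mul, norm_mul]
    exact mul_le_mul_of_nonneg_left hm.le (norm_nonneg _)⟩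

theorem congr (hm : FormBound φ p₂ p₃ m M) (h : ∀ z, m z = n z) : FormBound φ p₂ p₃ n M :=
  (funext h : m = n) ▸ hm

theorem mono (hm : FormBound φ p₂ p₃ m M) (h : M ≤ N) : FormBound φ p₂ p₃ m N :=
  ⟨hm.growth, hm.le.trans h⟩

theorem neg (hm : FormBound φ p₂ p₃ m M) : FormBound φ p₂ p₃ (fun z => -m z) M := by
  simpa using hm.const_mul (-1)

theorem sub (hm : FormBound φ p₂ p₃ m M) (hn : FormBound φ p₂ p₃ n N) :
    FormBound φ p₂ p₃ (fun z => m z - n z) (M + N) := by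
  simpa [sub_eq_add_neg] using hm.add hn.neg

theorem of_multBound (hφ : ∀ᵐ x, ‖φ x‖ ≤ M) (hM : 0 ≤ M) (h₃ : MultBound p₃ a N₃)
    (h₂ : MultBound p₂ b N₂) :
    FormBound φ p₂ p₃ (fun z => a z.1 * b z.2) (M * (N₃ * N₂)) :=
  ⟨h₃.growth.comp_fst.mul h₂.growth.comp_snd,
    norm_symbolForm_le φ p₂ p₃ h₃.growth h₂.growth hφ hM h₃.le h₂.le⟩

/-- The variable ξ-ζ is the frequency of φ, so this factor is a derivative of φ, up to the
unimodular constant i. -/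
theorem freq_sub_mul (c : Fin (d + 1)) (hm : FormBound (∂_{v c} φ) p₂ p₃ m M) :
    FormBound φ p₂ p₃ (fun z => (freq v c (z.1 - z.2) : ℂ) * m z) M := by
  refine ⟨(polyGrowth_freq_sub v c).mul hm.growth, le_trans (le_of_eq ?_) hm.le⟩
  have h : symbolForm (𝓕 (∂_{v c} φ)) p₂ p₃ m = Complex.I * symbolForm (𝓕 φ) p₂ p₃
      (fun z => (freq v c (z.1 - z.2) : ℂ) * m z) := by
    rw [symbolForm, symbolForm, ← integral_const_mul]
    congr 1; funext z
    rw [fourier_lineDeriv_apply]; ring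
  rw [h, norm_mul, Complex.norm_I, one_mul]

/-- Likewise q(ξ-ζ) is, up to sign, the flat wave operator applied to φ. -/
theorem quadForm_sub_mul (hm : FormBound (boxFlat v φ) p₂ p₃ m M) :
    FormBound φ p₂ p₃ (fun z => (quadForm v (z.1 - z.2) : ℂ) * m z) M := by
  refine ⟨(polyGrowth_quadForm_sub v).mul hm.growth, le_trans (le_of_eq ?_) hm.le⟩
  have h : symbolForm (𝓕 (boxFlat v φ)) p₂ p₃ m = (-1) * symbolForm (𝓕 φ) p₂ p₃
      (fun z => (quadForm v (z.1 - z.2) : ℂ) * m z) := by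
    rw [symbolForm, symbolForm, ← integral_const_mul]
    congr 1; funext z
    rw [fourier_boxFlat_apply]; ring
  rw [h, norm_mul, norm_neg, norm_one, one_mul]

end FormBound

/-- Factors of modulus at most 1 in a single frequency cost nothing. Signs, components of null
directions and phases enter the symbols in this way. -/
theorem MultBound.mul_right {p : 𝓢(V, ℂ)} (h : MultBound p a N) (hβ : Measurable β)
    (hβ1 : ∀ ξ, ‖β ξ‖ ≤ 1) : MultBound p (fun ξ => a ξ * β ξ) N :=
  h.mono (h.growth.measurable.mul hβ) fun ξ => by
    rw [norm_mul]
    exact mul_le_of_le_one_right (norm_nonneg _) (hβ1 ξ)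

/-- By `norm_nullDir_sub_sq` the symbol is a sum of product symbols, each with a factor that is
small near the cone. The arbitrary factors `β₂`, `β₃` leave room for the phases of the interpolation
argument. -/
theorem formBound_norm_nullDir_sub_sq (h₁ : SupBound v φ ε a₁) (h₂ : FreqBound v p₂ ε a₂)
    (h₃ : FreqBound v p₃ ε a₃) (hε : 0 ≤ ε) (hε1 : ε ≤ 1) (c : Fin (d + 1)) {β₂ β₃ : V → ℂ}
    (hβ₂ : Measurable β₂) (hβ₂' : ∀ ξ, ‖β₂ ξ‖ ≤ 1) (hβ₃ : Measurable β₃)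
    (hβ₃' : ∀ ξ, ‖β₃ ξ‖ ≤ 1) :
    FormBound φ p₂ p₃ (fun z => ((‖nullDir v z.1 - nullDir v z.2‖ ^ 2 : ℝ) : ℂ) *
      (((freq v c z.1 * ‖spaceFreq v z.1‖ : ℝ) * β₃ z.1) *
        ((‖spaceFreq v z.2‖ : ℝ) * β₂ z.2)))
      ((2 * d + 6) * √ε * (a₁ * a₂ * a₃)) := by
  have n₁ := h₁.nonneg
  have n₂ := h₂.nonneg
  have n₃ := h₃.nonneg
  have hs : ∀ ξ, ‖(timeSign v ξ : ℂ)‖ = 1 := fun ξ => by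
    rw [Complex.norm_real]; exact abs_timeSign v ξ
  have mγ : ∀ {β : V → ℂ}, Measurable β → Measurable fun ξ => (timeSign v ξ : ℂ) * β ξ :=
    fun h => by fun_prop
  have nγ : ∀ {β : V → ℂ}, (∀ ξ, ‖β ξ‖ ≤ 1) → ∀ ξ, ‖(timeSign v ξ : ℂ) * β ξ‖ ≤ 1 :=
    fun h ξ => by rw [norm_mul, hs, one_mul]; exact h ξ
  -- The term `freq v c ξ * quadForm v ξ` is of third order in ξ and not controlled by `h₃`. So the
  -- outer frequency is split as c(ξ) = c(ξ-ζ) + c(ζ), giving `t1` (a derivative of φ) and `t2`. The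
  -- terms `t3`, `t4` carry q(ζ), q(ξ-ζ), and `t5`, `t6` the two defects.
  have t1 := (FormBound.of_multBound (h₁.one c) n₁ (h₃.quad.mul_right (mγ hβ₃) (nγ hβ₃'))
    (h₂.zero.mul_right (mγ hβ₂) (nγ hβ₂'))).freq_sub_mul
  have t2 := FormBound.of_multBound h₁.zero n₁ (h₃.quad.mul_right (mγ hβ₃) (nγ hβ₃'))
    ((h₂.one c).mul_right (mγ hβ₂) (nγ hβ₂'))
  have t3 := FormBound.of_multBound h₁.zero n₁ ((h₃.one c).mul_right (mγ hβ₃) (nγ hβ₃'))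
    (h₂.quad.mul_right (mγ hβ₂) (nγ hβ₂'))
  have t4 := (FormBound.of_multBound h₁.quad (by positivity)
    ((h₃.one c).mul_right (mγ hβ₃) (nγ hβ₃'))
    (h₂.zero.mul_right (mγ hβ₂) (nγ hβ₂'))).quadForm_sub_mul
  have t5 := (FormBound.of_multBound h₁.zero n₁
    ((h₃.freq_mul_coneDefect c).mul_right hβ₃ hβ₃')
    (h₂.norm_space.mul_right hβ₂ hβ₂')).const_mul 2
  have h3' : MultBound p₃ (fun ξ => ((freq v c ξ * |freq v 0 ξ| : ℝ) : ℂ)) a₃ :=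
    (h₃.two c 0).mono (by have := (measurable_freq v 0).abs; fun_prop) fun ξ => by
      rw [Complex.norm_real, Complex.norm_real]
      simp
  have t6 := (FormBound.of_multBound h₁.zero n₁ (h3'.mul_right hβ₃ hβ₃')
    ((h₂.coneDefect hε).mul_right hβ₂ hβ₂')).const_mul 2
  have T := ((((t4.sub t1).sub t2).sub t3).sub t5).sub t6
  -- The total is 4ε + 2dε + 2√ε, hence the constant 2d + 6; only the bare defect in `t6` loses to
  -- √ε.
  have hle : ε ≤ √ε := Real.le_sqrt_of_sq_le (by nlinarith)
  have hA : 0 ≤ a₁ * a₂ * a₃ := by positivity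
  refine (T.congr ?_).mono ?_
  · intro z
    have h := congrArg (fun x : ℝ => (x : ℂ)) (norm_nullDir_sub_sq v z.1 z.2)
    push_cast at h ⊢
    rw [freq_sub]
    push_cast
    linear_combination -(freq v c z.1 * β₃ z.1 * β₂ z.2 : ℂ) * h
  · have h1 : ε * (a₁ * a₂ * a₃) ≤ √ε * (a₁ * a₂ * a₃) := by gcongr
    have h2 : ε * (a₁ * a₂ * a₃) * d ≤ √ε * (a₁ * a₂ * a₃) * d := by gcongr
    rw [Complex.norm_ofNat]
    nlinarith

end FlatEstimate

/-! ### The null form estimate for a constant frame -/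

section FlatNullForm

open FourierTransform SchwartzMap ComplexConjugate LineDeriv ProbabilityTheory
open scoped RealInnerProductSpace

variable {V : Type*} [NormedAddCommGroup V] [InnerProductSpace ℝ V] [FiniteDimensional ℝ V]
  [MeasurableSpace V] [BorelSpace V] {d : ℕ}

variable {v : Fin (d + 1) → V} {φ p₂ p₃ : 𝓢(V, ℂ)} {ε a₁ a₂ a₃ : ℝ}

/-- The constant in the bound for differences of null directions. -/
noncomputable def nullDirConst (d : ℕ) : ℝ :=
  (∫ z, ‖z‖ ∂(stdGaussian (EuclideanSpace ℝ (Fin d)))) * (d ^ 2 + 2 * d + 6)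

theorem nullDirConst_nonneg (d : ℕ) : 0 ≤ nullDirConst d :=
  mul_nonneg (integral_nonneg fun _ => norm_nonneg _) (by positivity)

/-- Landau-Kolmogorov over the product of the two frequency spaces, with x the difference of the
null directions: the zeroth-order bound is d²·a₁a₂a₃, and the Laplacian bound is (2d + 6)√ε·a₁a₂a₃.
-/
theorem formBound_nullDir_sub (h₁ : SupBound v φ ε a₁) (h₂ : FreqBound v p₂ ε a₂)
    (h₃ : FreqBound v p₃ ε a₃) (hε : 0 < ε) (hε1 : ε ≤ 1) (c : Fin (d + 1)) {β₂ β₃ : V → ℂ}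
    (hβ₂ : Measurable β₂) (hβ₂' : ∀ ξ, ‖β₂ ξ‖ ≤ 1) (hβ₃ : Measurable β₃)
    (hβ₃' : ∀ ξ, ‖β₃ ξ‖ ≤ 1) (i : Fin d) :
    FormBound φ p₂ p₃ (fun z => ((nullDir v z.1 i - nullDir v z.2 i : ℝ) : ℂ) *
      (((freq v c z.1 * ‖spaceFreq v z.1‖ : ℝ) * β₃ z.1) *
        ((‖spaceFreq v z.2‖ : ℝ) * β₂ z.2)))
      (nullDirConst d * ε ^ (1 / 4 : ℝ) * (a₁ * a₂ * a₃)) := by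
  have n₁ := h₁.nonneg
  have n₂ := h₂.nonneg
  have n₃ := h₃.nonneg
  set m : V × V → ℂ := fun z => ((freq v c z.1 * ‖spaceFreq v z.1‖ : ℝ) * β₃ z.1) *
        ((‖spaceFreq v z.2‖ : ℝ) * β₂ z.2) with hm_def
  set x : V × V → EuclideanSpace ℝ (Fin d) := fun z => nullDir v z.1 - nullDir v z.2 with hx_def
  have hx : Measurable x := by fun_prop
  have hx2 : ∀ z, ‖x z‖ ≤ 2 := fun z => (norm_sub_le _ _).trans (by
    linarith [norm_nullDir_le v z.1, norm_nullDir_le v z.2])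
  have hmg : PolyGrowth m :=
    ((h₃.freq_mul_norm c).mul_right hβ₃ hβ₃').growth.comp_fst.mul
      (h₂.norm_space.mul_right hβ₂ hβ₂').growth.comp_snd
  set w₀ : V × V → ℂ := fun z => conj (p₃ z.1) * 𝓕 φ (z.1 - z.2) * p₂ z.2
  have hw : Integrable (fun z => m z * w₀ z) := integrable_symbolForm (𝓕 φ) p₂ p₃ hmg
  -- The phase is a product of unimodular functions of ξ and of ζ, so it can be absorbed in `β₃` and
  -- `β₂`; this makes the bounds uniform in s.
  have hphase : ∀ s : EuclideanSpace ℝ (Fin d), ∀ z,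
      Complex.exp ((⟪s, x z⟫ : ℝ) * Complex.I) = Complex.exp ((⟪s, nullDir v z.1⟫ : ℝ) * Complex.I)
        * Complex.exp ((-⟪s, nullDir v z.2⟫ : ℝ) * Complex.I) := by
    intro s z
    rw [← Complex.exp_add, hx_def, inner_sub_right]
    push_cast
    ring_nf
  have hβs : ∀ (s : EuclideanSpace ℝ (Fin d)) {β : V → ℂ}, Measurable β → (∀ ξ, ‖β ξ‖ ≤ 1) →
      Measurable (fun ξ => β ξ * Complex.exp ((⟪s, nullDir v ξ⟫ : ℝ) * Complex.I)) ∧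
      ∀ ξ, ‖β ξ * Complex.exp ((⟪s, nullDir v ξ⟫ : ℝ) * Complex.I)‖ ≤ 1 := by
    intro s β hβ hβ'
    refine ⟨by fun_prop, fun ξ => ?_⟩
    rw [norm_mul, Complex.norm_exp_ofReal_mul_I, mul_one]
    exact hβ' ξ
  have hneg : ∀ (s : EuclideanSpace ℝ (Fin d)) ξ, -⟪s, nullDir v ξ⟫ = ⟪-s, nullDir v ξ⟫ :=
    fun s ξ => (inner_neg_left _ _).symm
  have hM : ∀ s, ‖∫ z, m z * w₀ z * Complex.exp ((⟪s, x z⟫ : ℝ) * Complex.I)‖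
      ≤ d ^ 2 * (a₁ * a₂ * a₃) := by
    intro s
    have h := (FormBound.of_multBound h₁.zero n₁
      ((h₃.freq_mul_norm c).mul_right (hβs s hβ₃ hβ₃').1 (hβs s hβ₃ hβ₃').2)
      (h₂.norm_space.mul_right (hβs (-s) hβ₂ hβ₂').1 (hβs (-s) hβ₂ hβ₂').2)).le
    refine le_trans (le_of_eq ?_) (h.trans_eq (by ring))
    rw [symbolForm]
    congr 2
    funext z
    rw [hphase, hneg, hm_def]
    ring
  have hδ : ∀ s, ‖∫ z, ((‖x z‖ ^ 2 : ℝ) : ℂ) * (m z * w₀ z) *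
      Complex.exp ((⟪s, x z⟫ : ℝ) * Complex.I)‖ ≤ (2 * d + 6) * √ε * (a₁ * a₂ * a₃) := by
    intro s
    have h := (formBound_norm_nullDir_sub_sq h₁ h₂ h₃ hε.le hε1 c (hβs (-s) hβ₂ hβ₂').1
      (hβs (-s) hβ₂ hβ₂').2 (hβs s hβ₃ hβ₃').1 (hβs s hβ₃ hβ₃').2).le
    refine le_trans (le_of_eq ?_) h
    rw [symbolForm]
    congr 2
    funext z
    rw [hphase, hneg, hm_def]
    ring
  have he : ‖EuclideanSpace.single i (1 : ℝ)‖ ≤ 1 := by simp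
  -- T = ε^(-1/2) balances T^(-1/2) against T^(1/2)√ε; both become ε^(1/4).
  have hT : (0 : ℝ) < ε ^ (-(1 / 2) : ℝ) := Real.rpow_pos_of_pos hε _
  have key := norm_integral_inner_mul_le hw hx hx2 hT hM hδ (EuclideanSpace.single i 1) he
  have hxi : ∀ z, ⟪x z, EuclideanSpace.single i (1 : ℝ)⟫ = nullDir v z.1 i - nullDir v z.2 i := by
    intro z
    simp [hx_def, EuclideanSpace.inner_single_right]
  refine ⟨?_, ?_⟩
  · refine PolyGrowth.mul (.of_bounded (C := 2) ?_ fun z => ?_) hmg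
    · simp_rw [← hxi]
      fun_prop
    · rw [← hxi, Complex.norm_real]
      exact (norm_inner_le_norm _ _).trans
        ((mul_le_of_le_one_right (norm_nonneg _) he).trans (hx2 z))
  · have e1 : symbolForm (𝓕 φ) p₂ p₃ (fun z => ((nullDir v z.1 i - nullDir v z.2 i : ℝ) : ℂ) * m z)
        = ∫ z, m z * w₀ z * ((⟪x z, EuclideanSpace.single i (1 : ℝ)⟫ : ℝ) : ℂ) := by
      rw [symbolForm]
      congr 1; funext z
      rw [hxi]; ring
    rw [e1]
    refine key.trans (le_of_eq ?_)
    have r1 : (ε ^ (-(1 / 2) : ℝ)) ^ (-(1 / 2) : ℝ) = ε ^ (1 / 4 : ℝ) := by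
      rw [← Real.rpow_mul hε.le]; norm_num
    have r2 : (ε ^ (-(1 / 2) : ℝ)) ^ (1 / 2 : ℝ) * √ε = ε ^ (1 / 4 : ℝ) := by
      rw [← Real.rpow_mul hε.le, Real.sqrt_eq_rpow, ← Real.rpow_add hε]; norm_num
    rw [r1, nullDirConst]
    linear_combination (∫ z, ‖z‖ ∂(stdGaussian (EuclideanSpace ℝ (Fin d)))) * (2 * d + 6)
      * (a₁ * a₂ * a₃) * r2

/-- Substitute τ = σ(δ + |η|) and ηᵢ = σ|η|Ωᵢ, where σ is the sign of τ and δ the defect. The part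
without δ is |η(ξ)||η(ζ)|(Ωᵢ(ζ) - Ωᵢ(ξ)) up to signs; the two parts with δ gain ε and √ε and account
for 2d. -/
theorem formBound_wedge_zero (h₁ : SupBound v φ ε a₁) (h₂ : FreqBound v p₂ ε a₂)
    (h₃ : FreqBound v p₃ ε a₃) (hε : 0 < ε) (hε1 : ε ≤ 1) (c : Fin (d + 1)) (i : Fin d) :
    FormBound φ p₂ p₃ (fun z => ((freq v c z.1 * (freq v 0 z.1 * freq v i.succ z.2
      - freq v i.succ z.1 * freq v 0 z.2) : ℝ) : ℂ))
      ((nullDirConst d + 2 * d) * ε ^ (1 / 4 : ℝ) * (a₁ * a₂ * a₃)) := by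
  have n₁ := h₁.nonneg
  have n₂ := h₂.nonneg
  have n₃ := h₃.nonneg
  have mσ : Measurable fun ξ => (timeSign v ξ : ℂ) := by fun_prop
  have nσ : ∀ ξ, ‖(timeSign v ξ : ℂ)‖ ≤ 1 := fun ξ => by
    rw [Complex.norm_real]; exact (abs_timeSign v ξ).le
  have mσΩ : Measurable fun ξ => ((timeSign v ξ * nullDir v ξ i : ℝ) : ℂ) := by fun_prop
  have nσΩ : ∀ ξ, ‖((timeSign v ξ * nullDir v ξ i : ℝ) : ℂ)‖ ≤ 1 := fun ξ => by
    rw [Complex.norm_real, norm_mul, Real.norm_eq_abs, Real.norm_eq_abs, abs_timeSign, one_mul]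
    exact abs_nullDir_apply_le v ξ i
  have t1 := formBound_nullDir_sub h₁ h₂ h₃ hε hε1 c mσ nσ mσ nσ i
  have t2 := FormBound.of_multBound h₁.zero n₁ ((h₃.freq_mul_coneDefect c).mul_right mσ nσ)
    (h₂.norm_space.mul_right mσΩ nσΩ)
  have t3 := FormBound.of_multBound h₁.zero n₁ ((h₃.freq_mul_norm c).mul_right mσΩ nσΩ)
    ((h₂.coneDefect hε.le).mul_right mσ nσ)
  refine (((t2.sub t1).sub t3).congr fun z => ?_).mono ?_
  · have e1 := freq_succ_eq v z.1 i
    have e2 := freq_succ_eq v z.2 i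
    have e3 : freq v 0 z.1 = timeSign v z.1 * (coneDefect v z.1 + ‖spaceFreq v z.1‖) := by
      rw [coneDefect, sub_add_cancel, timeSign_mul_abs]
    have e4 : freq v 0 z.2 = timeSign v z.2 * (coneDefect v z.2 + ‖spaceFreq v z.2‖) := by
      rw [coneDefect, sub_add_cancel, timeSign_mul_abs]
    have : freq v 0 z.1 * freq v i.succ z.2 - freq v i.succ z.1 * freq v 0 z.2
        = (timeSign v z.1 * (coneDefect v z.1 + ‖spaceFreq v z.1‖))
            * (timeSign v z.2 * ‖spaceFreq v z.2‖ * nullDir v z.2 i)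
          - (timeSign v z.1 * ‖spaceFreq v z.1‖ * nullDir v z.1 i)
            * (timeSign v z.2 * (coneDefect v z.2 + ‖spaceFreq v z.2‖)) := by
      rw [← e1, ← e2, ← e3, ← e4]
    rw [this]
    push_cast
    ring
  · have r1 : ε ≤ ε ^ (1 / 4 : ℝ) := by
      conv_lhs => rw [← Real.rpow_one ε]
      exact Real.rpow_le_rpow_of_exponent_ge hε hε1 (by norm_num)
    have r2 : √ε ≤ ε ^ (1 / 4 : ℝ) := by
      rw [Real.sqrt_eq_rpow]
      exact Real.rpow_le_rpow_of_exponent_ge hε hε1 (by norm_num)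
    have hA : 0 ≤ a₁ * a₂ * a₃ * d := by positivity
    nlinarith [mul_le_mul_of_nonneg_left r1 hA, mul_le_mul_of_nonneg_left r2 hA]

/-- With Ω = Ω(ξ) and Ω' = Ω(ζ), ΩᵢΩ'ⱼ - ΩⱼΩ'ᵢ = (Ωᵢ - Ω'ᵢ)Ω'ⱼ - (Ωⱼ - Ω'ⱼ)Ω'ᵢ. Purely spatial
wedges produce no defect terms. -/
theorem formBound_wedge_succ (h₁ : SupBound v φ ε a₁) (h₂ : FreqBound v p₂ ε a₂)
    (h₃ : FreqBound v p₃ ε a₃) (hε : 0 < ε) (hε1 : ε ≤ 1) (c : Fin (d + 1)) (i j : Fin d) :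
    FormBound φ p₂ p₃ (fun z => ((freq v c z.1 * (freq v i.succ z.1 * freq v j.succ z.2
      - freq v j.succ z.1 * freq v i.succ z.2) : ℝ) : ℂ))
      (2 * nullDirConst d * ε ^ (1 / 4 : ℝ) * (a₁ * a₂ * a₃)) := by
  have mσ : Measurable fun ξ => (timeSign v ξ : ℂ) := by fun_prop
  have nσ : ∀ ξ, ‖(timeSign v ξ : ℂ)‖ ≤ 1 := fun ξ => by
    rw [Complex.norm_real]; exact (abs_timeSign v ξ).le
  have mσΩ : ∀ i, Measurable fun ξ => ((timeSign v ξ * nullDir v ξ i : ℝ) : ℂ) := by fun_prop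
  have nσΩ : ∀ i ξ, ‖((timeSign v ξ * nullDir v ξ i : ℝ) : ℂ)‖ ≤ 1 := fun i ξ => by
    rw [Complex.norm_real, norm_mul, Real.norm_eq_abs, Real.norm_eq_abs, abs_timeSign, one_mul]
    exact abs_nullDir_apply_le v ξ i
  have t1 := formBound_nullDir_sub h₁ h₂ h₃ hε hε1 c (mσΩ j) (nσΩ j) mσ nσ i
  have t2 := formBound_nullDir_sub h₁ h₂ h₃ hε hε1 c (mσΩ i) (nσΩ i) mσ nσ j
  refine ((t1.sub t2).congr fun z => ?_).mono (le_of_eq (by ring))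
  rw [freq_succ_eq v z.1 i, freq_succ_eq v z.1 j, freq_succ_eq v z.2 i, freq_succ_eq v z.2 j]
  push_cast
  ring

/-- The constant in the null form estimate for constant frames. -/
noncomputable def flatConst (d : ℕ) : ℝ := 2 * nullDirConst d + 2 * d

theorem flatConst_nonneg (d : ℕ) : 0 ≤ flatConst d := by
  have := nullDirConst_nonneg d
  unfold flatConst
  positivity

theorem formBound_wedge (h₁ : SupBound v φ ε a₁) (h₂ : FreqBound v p₂ ε a₂)
    (h₃ : FreqBound v p₃ ε a₃) (hε : 0 < ε) (hε1 : ε ≤ 1) (c a b : Fin (d + 1)) :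
    FormBound φ p₂ p₃ (fun z => ((freq v c z.1 * (freq v a z.1 * freq v b z.2
      - freq v b z.1 * freq v a z.2) : ℝ) : ℂ))
      (flatConst d * ε ^ (1 / 4 : ℝ) * (a₁ * a₂ * a₃)) := by
  have n₁ := h₁.nonneg
  have n₂ := h₂.nonneg
  have n₃ := h₃.nonneg
  have hC := nullDirConst_nonneg d
  have hε' : 0 ≤ ε ^ (1 / 4 : ℝ) := by positivity
  have hC0 : (nullDirConst d + 2 * d) * ε ^ (1 / 4 : ℝ) * (a₁ * a₂ * a₃)
      ≤ flatConst d * ε ^ (1 / 4 : ℝ) * (a₁ * a₂ * a₃) := by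
    unfold flatConst
    gcongr
    linarith
  induction a using Fin.cases with
  | zero =>
    induction b using Fin.cases with
    | zero =>
      refine ⟨?_, ?_⟩
      · simpa using PolyGrowth.const (E := V × V) 0
      · have := flatConst_nonneg d
        have h0 : symbolForm (𝓕 φ) p₂ p₃ (fun z => ((freq v c z.1 * (freq v 0 z.1 * freq v 0 z.2
            - freq v 0 z.1 * freq v 0 z.2) : ℝ) : ℂ)) = 0 := by simp [symbolForm]
        rw [h0, norm_zero]
        positivity
    | succ j => exact (formBound_wedge_zero h₁ h₂ h₃ hε hε1 c j).mono hC0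
  | succ i =>
    induction b using Fin.cases with
    | zero =>
      refine ((formBound_wedge_zero h₁ h₂ h₃ hε hε1 c i).neg.congr fun z => ?_).mono hC0
      push_cast; ring
    | succ j =>
      refine (formBound_wedge_succ h₁ h₂ h₃ hε hε1 c i j).mono ?_
      unfold flatConst
      gcongr
      linarith

/-- The null form estimate for a constant frame, at unit scale. -/
theorem norm_integral_nullForm_le {φ₁ φ₂ φ₃ : 𝓢(V, ℂ)} (h₁ : SupBound v φ₁ ε a₁)
    (h₂ : FreqBound v (𝓕 φ₂) ε a₂) (h₃ : FreqBound v (𝓕 φ₃) ε a₃) (hε : 0 < ε) (hε1 : ε ≤ 1)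
    (c a b : Fin (d + 1)) :
    ‖∫ x, conj ((∂_{v c} φ₃) x) * ((∂_{v a} φ₁) x * (∂_{v b} φ₂) x
      - (∂_{v b} φ₁) x * (∂_{v a} φ₂) x)‖ ≤ flatConst d * ε ^ (1 / 4 : ℝ) * (a₁ * a₂ * a₃) := by
  refine le_trans (le_of_eq ?_) (formBound_wedge h₁ h₂ h₃ hε hε1 c a b).le
  -- The three derivatives contribute conj(i)·i·i = i.
  have key : ∀ a b : Fin (d + 1), ∫ x, conj ((∂_{v c} φ₃) x) * ((∂_{v a} φ₁) x * (∂_{v b} φ₂) x)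
      = Complex.I * symbolForm (𝓕 φ₁) (𝓕 φ₂) (𝓕 φ₃) (fun z => (freq v c z.1 : ℂ) *
        ((freq v a (z.1 - z.2) : ℂ) * freq v b z.2)) := by
    intro a b
    have h := integral_prod_fourier_sub (φ := (∂_{v a} φ₁ : 𝓢(V, ℂ)))
      (v₂ := (𝓕 (∂_{v b} φ₂ : 𝓢(V, ℂ)) : 𝓢(V, ℂ))) (v₃ := (𝓕 (∂_{v c} φ₃ : 𝓢(V, ℂ)) : 𝓢(V, ℂ)))
      (SchwartzMap.integrable _) (SchwartzMap.integrable _) (SchwartzMap.integrable _)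
    have inv : ∀ (ψ : 𝓢(V, ℂ)) (x : V), 𝓕⁻ ((𝓕 ψ : 𝓢(V, ℂ)) : V → ℂ) x = ψ x := by
      intro ψ x
      rw [← fourierInv_coe, fourierInv_fourier_eq]
    simp_rw [inv, ← fourier_coe, fourier_lineDeriv_apply] at h
    calc _ = ∫ x, (∂_{v a} φ₁) x * (conj ((∂_{v c} φ₃) x) * (∂_{v b} φ₂) x) := by
          congr 1; funext x; ring
      _ = _ := h.symm
      _ = _ := by
          rw [symbolForm, ← integral_const_mul]
          congr 1; funext z
          simp only [map_mul, Complex.conj_I, Complex.conj_ofReal]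
          linear_combination (-Complex.I * freq v c z.1 * conj (𝓕 φ₃ z.1) * freq v a (z.1 - z.2)
            * 𝓕 φ₁ (z.1 - z.2) * freq v b z.2 * 𝓕 φ₂ z.2) * Complex.I_sq
  have hint : ∀ a b : Fin (d + 1),
      Integrable fun x => conj ((∂_{v c} φ₃) x) * ((∂_{v a} φ₁) x * (∂_{v b} φ₂) x) := by
    intro a b
    have h3 : MemLp (fun x => conj ((∂_{v c} φ₃) x)) 2 := by
      have hc : Continuous fun x => conj ((∂_{v c} φ₃) x) :=
        Complex.continuous_conj.comp (∂_{v c} φ₃).continuous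
      exact ((∂_{v c} φ₃).memLp 2).congr_norm hc.aestronglyMeasurable
        (Filter.Eventually.of_forall fun x => by simp)
    obtain ⟨M, hM⟩ := (PolyGrowth.const (E := V) 1).exists_norm_mul_schwartz_le (∂_{v a} φ₁)
    refine ((h3.integrable_mul ((∂_{v b} φ₂).memLp 2)).bdd_mul (c := M)
      (∂_{v a} φ₁).continuous.aestronglyMeasurable
      (Filter.Eventually.of_forall fun x => by simpa using hM x)).congr
      (Filter.Eventually.of_forall fun x => ?_)
    simp only [Pi.mul_apply]
    ring
  have hg : ∀ a b : Fin (d + 1), PolyGrowth fun z : V × V => (freq v c z.1 : ℂ) *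
        ((freq v a (z.1 - z.2) : ℂ) * freq v b z.2) := fun a b =>
    (polyGrowth_freq v c).comp_fst.mul ((polyGrowth_freq_sub v a).mul (polyGrowth_freq v b).comp_snd)
  simp_rw [mul_sub]
  rw [integral_sub (hint a b) (hint b a), key, key, ← mul_sub, norm_mul, Complex.norm_I, one_mul]
  congr 1
  rw [sub_eq_add_neg, ← neg_one_mul, ← symbolForm_const_mul, ← symbolForm_add _ _ _ (hg a b)
    ((PolyGrowth.const (-1)).mul (hg b a))]
  congr 1
  funext z
  -- The wedge of ξ-ζ with ζ equals the wedge of ξ with ζ. This antisymmetry moves the derivative of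
  -- φ₁ onto the other two factors.
  rw [freq_sub, freq_sub]
  push_cast
  ring

end FlatNullForm

/-! ### From pointwise bounds at scale λ to unit-scale frequency bounds -/

section FrozenEstimate

open FourierTransform SchwartzMap ComplexConjugate LineDeriv

variable {V : Type*} [NormedAddCommGroup V] [InnerProductSpace ℝ V] [FiniteDimensional ℝ V]
  [MeasurableSpace V] [BorelSpace V] {d : ℕ}

theorem polyGrowth_quadForm (v : Fin (d + 1) → V) : PolyGrowth (fun ξ => (quadForm v ξ : ℂ)) := by
  have h : (fun ξ => (quadForm v ξ : ℂ)) = fun ξ =>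
      (∑ i : Fin d, (freq v i.succ ξ : ℂ) * freq v i.succ ξ) - freq v 0 ξ * freq v 0 ξ := by
    funext z
    rw [quadForm, norm_spaceFreq_sq]
    push_cast
    simp_rw [sq]
  rw [h]
  exact (PolyGrowth.sum _ fun i => (polyGrowth_freq v _).mul (polyGrowth_freq v _)).sub
    ((polyGrowth_freq v _).mul (polyGrowth_freq v _))

theorem multBound_of_fourier_eq {φ ψ : 𝓢(V, ℂ)} {m : V → ℂ} {k : ℂ} (hk : ‖k‖ = 1)
    (hm : PolyGrowth m) (h : ∀ ξ, 𝓕 ψ ξ = k * (m ξ * 𝓕 φ ξ)) {e : V → ℝ} (he : MemLp e 2) {C : ℝ}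
    (hC : 0 ≤ C) (hψ : ∀ x, ‖ψ x‖ ≤ C * e x) :
    MultBound (𝓕 φ) m (C * (eLpNorm e 2 volume).toReal) := by
  refine ⟨hm, ?_⟩
  have h1 : normL2 (fun ξ => m ξ * 𝓕 φ ξ) = normL2 (ψ : V → ℂ) := by
    have e1 : eLpNorm (fun ξ => m ξ * 𝓕 φ ξ) 2 volume = eLpNorm (𝓕 ψ : 𝓢(V, ℂ)) 2 volume :=
      eLpNorm_congr_norm_ae (Filter.Eventually.of_forall fun ξ => by
        rw [h, norm_mul k, hk, one_mul])
    have e2 := eLpNorm_fourierInv (𝓕 ψ : 𝓢(V, ℂ)).integrable ((𝓕 ψ : 𝓢(V, ℂ)).memLp 2)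
    have e3 : 𝓕⁻ ((𝓕 ψ : 𝓢(V, ℂ)) : V → ℂ) = ψ := by
      rw [← fourierInv_coe, fourierInv_fourier_eq]
    rw [e3] at e2
    rw [normL2, normL2, e1, e2]
  rw [h1, normL2]
  have h2 : eLpNorm (ψ : V → ℂ) 2 volume ≤ eLpNorm (fun x => C * e x) 2 volume :=
    eLpNorm_mono_real hψ
  have h3 : eLpNorm (fun x => C * e x) 2 volume = ENNReal.ofReal C * eLpNorm e 2 volume := by
    have := eLpNorm_const_smul C e 2 (volume : Measure V)
    rw [Real.enorm_eq_ofReal hC] at this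
    exact this
  have h4 := ENNReal.toReal_mono (ENNReal.mul_ne_top ENNReal.ofReal_ne_top he.2.ne) (h2.trans_eq h3)
  rwa [ENNReal.toReal_mul, ENNReal.toReal_ofReal hC] at h4

/-- The second derivative of `φ` along `w` and `w'`. -/
noncomputable def secondDeriv (φ : V → ℂ) (w w' : V) (x : V) : ℂ :=
  fderiv ℝ (fun y => fderiv ℝ φ y w) x w'

/-- Pointwise bounds by `e` for a function at frequency scale `lam`: its first two derivatives along
the frame `v`, and a better one for the wave operator of the frame. -/
structure LocalBound (v : Fin (d + 1) → V) (φ : V → ℂ) (lam ε : ℝ) (e : V → ℝ) : Prop where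
  zero : ∀ x, ‖φ x‖ ≤ lam * e x
  one : ∀ c x, ‖fderiv ℝ φ x (v c)‖ ≤ e x
  two : ∀ c c' x, ‖secondDeriv φ (v c) (v c') x‖ ≤ e x / lam
  quad : ∀ x, ‖(∑ i : Fin d, secondDeriv φ (v i.succ) (v i.succ) x)
    - secondDeriv φ (v 0) (v 0) x‖ ≤ ε / lam * e x

theorem lineDerivOp_toFun (φ : 𝓢(V, ℂ)) (w : V) (x : V) :
    (∂_{w} φ) x = fderiv ℝ (φ : V → ℂ) x w := lineDerivOp_apply_eq_fderiv _ _ _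

theorem lineDerivOp_lineDerivOp_toFun (φ : 𝓢(V, ℂ)) (w w' : V) (x : V) :
    (∂_{w'} (∂_{w} φ)) x = secondDeriv φ w w' x := by
  rw [lineDerivOp_toFun, secondDeriv]
  congr 2

theorem fderiv_smul_dir (φ : V → ℂ) (l : ℝ) (w x : V) :
    fderiv ℝ φ x (l • w) = l * fderiv ℝ φ x w := by
  rw [map_smul, Complex.real_smul]

theorem secondDeriv_smul_smul {φ : V → ℂ} (hφ : ContDiff ℝ ∞ φ) (l : ℝ) (w w' x : V) :
    secondDeriv φ (l • w) (l • w') x = l ^ 2 * secondDeriv φ w w' x := by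
  have h1 : (fun y => fderiv ℝ φ y (l • w)) = fun y => (l : ℂ) * fderiv ℝ φ y w := by
    funext y; exact fderiv_smul_dir φ l w y
  have hd : DifferentiableAt ℝ (fun y => fderiv ℝ φ y w) x :=
    (((hφ.fderiv_right (m := 1) (by norm_cast)).differentiable (by norm_num)).clm_apply
      (differentiable_const w)) x
  rw [secondDeriv, h1, fderiv_smul_dir, fderiv_const_mul hd, secondDeriv]
  simp
  ring

variable {v : Fin (d + 1) → V} {lam ε : ℝ}

theorem LocalBound.boxFlat_le {φ : 𝓢(V, ℂ)} {e : V → ℝ} (h : LocalBound v φ lam ε e)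
    (hlam : 0 < lam) (x : V) :
    ‖boxFlat (fun c => lam • v c) φ x‖ ≤ lam * ε * e x := by
  have h1 : boxFlat (fun c => lam • v c) φ x
      = lam ^ 2 * ((∑ i : Fin d, secondDeriv φ (v i.succ) (v i.succ) x)
        - secondDeriv φ (v 0) (v 0) x) := by
    rw [boxFlat, sub_apply, sum_apply]
    simp_rw [lineDerivOp_lineDerivOp_toFun, secondDeriv_smul_smul (φ.smooth ⊤)]
    rw [mul_sub, Finset.mul_sum]
  rw [h1, norm_mul, norm_pow, Complex.norm_real, Real.norm_of_nonneg hlam.le]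
  calc _ ≤ lam ^ 2 * (ε / lam * e x) := by gcongr; exact h.quad x
    _ = _ := by field_simp

/-- Along the dilated frame `lam • v` each derivative gains a factor `lam`, so the function and its
first two derivatives all have size `lam * e`, and the flat wave operator has size `ε * (lam * e)`.
Plancherel turns these into multiplier bounds. -/
theorem LocalBound.freqBound {φ : 𝓢(V, ℂ)} {e : V → ℝ} (h : LocalBound v φ lam ε e)
    (hlam : 0 < lam) (hε : 0 ≤ ε) (he : MemLp e 2) :
    FreqBound (fun c => lam • v c) (𝓕 φ) ε (lam * (eLpNorm e 2 volume).toReal) := by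
  have hq : MultBound (𝓕 φ) (fun ξ => (quadForm (fun c => lam • v c) ξ : ℂ))
      (lam * ε * (eLpNorm e 2 volume).toReal) :=
    multBound_of_fourier_eq (ψ := boxFlat (fun c => lam • v c) φ) (k := -1) (by simp)
      (polyGrowth_quadForm _) (fun ξ => by
        rw [fourier_boxFlat_apply]; ring) he (by positivity) (h.boxFlat_le hlam)
  refine ⟨?_, fun c => ?_, fun c c' => ?_, ?_⟩
  · exact multBound_of_fourier_eq (ψ := φ) (k := 1) (by simp) (.const 1) (by simp) he hlam.le h.zero
  · refine multBound_of_fourier_eq (ψ := ∂_{lam • v c} φ) (k := Complex.I) (by simp)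
      (polyGrowth_freq _ c) (fun ξ => fourier_lineDeriv_apply (fun c => lam • v c) c φ ξ) he hlam.le
      fun x => ?_
    rw [lineDerivOp_toFun, fderiv_smul_dir, norm_mul, Complex.norm_real, Real.norm_of_nonneg hlam.le]
    gcongr
    exact h.one c x
  · refine multBound_of_fourier_eq (ψ := ∂_{lam • v c'} (∂_{lam • v c} φ)) (k := -1) (by simp)
      ?_ (fun ξ => ?_) he hlam.le fun x => ?_
    · push_cast
      exact (polyGrowth_freq _ c).mul (polyGrowth_freq _ c')
    · rw [fourier_lineDeriv_apply (fun c => lam • v c) c',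
        fourier_lineDeriv_apply (fun c => lam • v c) c]
      push_cast
      linear_combination (freq (fun c => lam • v c) c ξ * freq (fun c => lam • v c) c' ξ * 𝓕 φ ξ)
        * Complex.I_sq
    · rw [lineDerivOp_lineDerivOp_toFun, secondDeriv_smul_smul (φ.smooth ⊤), norm_mul, norm_pow,
        Complex.norm_real, Real.norm_of_nonneg hlam.le]
      calc _ ≤ lam ^ 2 * (e x / lam) := by gcongr; exact h.two c c' x
        _ = _ := by field_simp
  · convert! hq using 1
    ring

theorem LocalBound.supBound {φ : 𝓢(V, ℂ)} {e : V → ℝ} (h : LocalBound v φ lam ε e)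
    (hlam : 0 < lam) (hε : 0 ≤ ε) {a : ℝ} (ha : 0 ≤ a) (he : ∀ᵐ x, e x ≤ a) :
    SupBound (fun c => lam • v c) φ ε (lam * a) := by
  refine ⟨by positivity, ?_, fun c => ?_, ?_⟩
  · filter_upwards [he] with x hx
    exact (h.zero x).trans (by gcongr)
  · filter_upwards [he] with x hx
    rw [lineDerivOp_toFun, fderiv_smul_dir, norm_mul, Complex.norm_real, Real.norm_of_nonneg hlam.le]
    gcongr
    exact (h.one c x).trans hx
  · filter_upwards [he] with x hx
    refine (h.boxFlat_le hlam x).trans ?_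
    calc _ ≤ lam * ε * a := by gcongr
      _ = _ := by ring

/-- The null form estimate for a constant frame. -/
theorem norm_integral_nullForm_le_of_localBound {φ₁ φ₂ φ₃ : V → ℂ} (hφ₁ : ContDiff ℝ ∞ φ₁)
    (hc₁ : HasCompactSupport φ₁) (hφ₂ : ContDiff ℝ ∞ φ₂) (hc₂ : HasCompactSupport φ₂)
    (hφ₃ : ContDiff ℝ ∞ φ₃) (hc₃ : HasCompactSupport φ₃) {e₁ e₂ e₃ : V → ℝ}
    (h₁ : LocalBound v φ₁ lam ε e₁) (h₂ : LocalBound v φ₂ lam ε e₂)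
    (h₃ : LocalBound v φ₃ lam ε e₃) (hlam : 0 < lam) (hε : 0 < ε) (hε1 : ε ≤ 1) {a₁ : ℝ}
    (ha₁ : 0 ≤ a₁) (he₁ : ∀ᵐ x, e₁ x ≤ a₁) (he₂ : MemLp e₂ 2) (he₃ : MemLp e₃ 2)
    (c a b : Fin (d + 1)) :
    ‖∫ x, conj (fderiv ℝ φ₃ x (v c)) * (fderiv ℝ φ₁ x (v a) * fderiv ℝ φ₂ x (v b)
      - fderiv ℝ φ₁ x (v b) * fderiv ℝ φ₂ x (v a))‖
      ≤ flatConst d * ε ^ (1 / 4 : ℝ) *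
        (a₁ * (eLpNorm e₂ 2 volume).toReal * (eLpNorm e₃ 2 volume).toReal) := by
  set ψ₁ : 𝓢(V, ℂ) := hc₁.toSchwartzMap hφ₁
  set ψ₂ : 𝓢(V, ℂ) := hc₂.toSchwartzMap hφ₂
  set ψ₃ : 𝓢(V, ℂ) := hc₃.toSchwartzMap hφ₃
  have g₁ : LocalBound v ψ₁ lam ε e₁ := h₁
  have g₂ : LocalBound v ψ₂ lam ε e₂ := h₂
  have g₃ : LocalBound v ψ₃ lam ε e₃ := h₃
  have key := norm_integral_nullForm_le (g₁.supBound hlam hε.le ha₁ he₁)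
    (g₂.freqBound hlam hε.le he₂) (g₃.freqBound hlam hε.le he₃) hε hε1 c a b
  -- The three dilated derivatives give `lam ^ 3`, as do the three size bounds; the powers cancel.
  have e1 : ∀ x, conj ((∂_{lam • v c} ψ₃) x) * ((∂_{lam • v a} ψ₁) x * (∂_{lam • v b} ψ₂) x
      - (∂_{lam • v b} ψ₁) x * (∂_{lam • v a} ψ₂) x)
      = (lam : ℂ) ^ 3 * (conj (fderiv ℝ φ₃ x (v c)) * (fderiv ℝ φ₁ x (v a) * fderiv ℝ φ₂ x (v b)
      - fderiv ℝ φ₁ x (v b) * fderiv ℝ φ₂ x (v a))) := by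
    intro x
    have s₁ : (ψ₁ : V → ℂ) = φ₁ := rfl
    have s₂ : (ψ₂ : V → ℂ) = φ₂ := rfl
    have s₃ : (ψ₃ : V → ℂ) = φ₃ := rfl
    simp_rw [lineDerivOp_toFun, fderiv_smul_dir, s₁, s₂, s₃, map_mul, Complex.conj_ofReal]
    ring
  simp_rw [e1] at key
  rw [integral_const_mul, norm_mul, norm_pow, Complex.norm_real, Real.norm_of_nonneg hlam.le] at key
  refine le_of_mul_le_mul_left (key.trans_eq ?_) (pow_pos hlam 3)
  ring

end FrozenEstimate

/-! ### Orthonormal frames for the metric -/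

section Frame

open Matrix

variable {d : ℕ}

theorem minkowskiMatrix_mul_self (d : ℕ) : minkowskiMatrix d * minkowskiMatrix d = 1 := by
  rw [minkowskiMatrix, diagonal_mul_diagonal, ← diagonal_one]
  congr 1
  funext c
  induction c using Fin.cases <;> simp

theorem isUnit_det_of_isLorentzianMatrix {G : Matrix (Fin (d + 1)) (Fin (d + 1)) ℝ}
    (h : IsLorentzianMatrix G) : IsUnit G.det := by
  obtain ⟨P, -, hP⟩ := h
  have h1 : (minkowskiMatrix d).det * (minkowskiMatrix d).det = 1 := by
    rw [← det_mul, minkowskiMatrix_mul_self, det_one]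
  rw [← hP, det_mul, det_mul] at h1
  refine isUnit_iff_ne_zero.2 fun h0 => ?_
  simp [h0] at h1

/-- A metric of the form `framedMetric` has an orthonormal frame, bounded in terms of the inverse
metric. -/
theorem exists_frame {N : ℝ} {a b c : Fin d → ℝ} {B : Fin d → Fin d → ℝ}
    (hN : |N - 1| ≤ 1 / 10 ^ 5) (hc : ∀ i, |c i - 1| ≤ 1 / 10 ^ 5) (ha : ∀ i, |a i| ≤ 1 / 10 ^ 5)
    (hb : ∀ i, |b i| ≤ 1 / 10 ^ 5) (hB : ∀ i j, |B i j| ≤ 1 / 10 ^ 5)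
    {G : Matrix (Fin (d + 1)) (Fin (d + 1)) ℝ} (hG : G = framedMetric N a b c B)
    (hdet : IsUnit G.det) {H : ℝ} (hH : ∀ μ ν, |G⁻¹ μ ν| ≤ H) :
    ∃ (v : Fin (d + 1) → Spacetime d) (W : Fin (d + 1) → Fin (d + 1) → ℝ),
      (∀ k μ, |v k μ| ≤ (d + 1) * (H * 3)) ∧ (∀ k μ, |W k μ| ≤ 3) ∧
      (∀ μ, EuclideanSpace.single μ (1 : ℝ) = ∑ k, W k μ • v k) ∧
      ∀ μ ν, G⁻¹ μ ν = (∑ i : Fin d, v i.succ μ * v i.succ ν) - v 0 μ * v 0 ν := by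
  set s : Fin (d + 1) → ℝ := Fin.cons (√N) fun i => √(c i)
  set E : Fin (d + 1) → Fin (d + 1) → ℝ := Fin.cons (timeCovector a) (spaceCovector b B)
  set W : Matrix (Fin (d + 1)) (Fin (d + 1)) ℝ := of fun k μ => s k * E k μ with hW
  have hN0 : 0 ≤ N := by linarith [(abs_le.1 hN).1]
  have hc0 : ∀ i, 0 ≤ c i := fun i => by linarith [(abs_le.1 (hc i)).1]
  have hGW : G = Wᵀ * minkowskiMatrix d * W := by
    ext μ ν
    rw [hG, minkowskiMatrix, Matrix.mul_apply]
    simp only [mul_diagonal, transpose_apply, hW, of_apply, Fin.sum_univ_succ, framedMetric, s, E,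
      Fin.cons_zero, Fin.cons_succ]
    congr 1
    · linear_combination (-timeCovector a μ * timeCovector a ν) * -(Real.mul_self_sqrt hN0)
    · refine Finset.sum_congr rfl fun i _ => ?_
      linear_combination (spaceCovector b B i μ * spaceCovector b B i ν)
        * -(Real.mul_self_sqrt (hc0 i))
  -- Invertibility comes from `G`: entrywise smallness alone would not give it in every dimension.
  -- Likewise the entries of `W⁻¹` are bounded below through W⁻¹ = G⁻¹WᵀJ with J the Minkowski
  -- matrix, at the price of the bound `H` for `G⁻¹`.
  have hWdet : IsUnit W.det := by
    refine isUnit_iff_ne_zero.2 fun h0 => hdet.ne_zero ?_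
    rw [hGW, det_mul, h0, mul_zero]
  have hs : ∀ k, |s k| ≤ 2 := by
    intro k
    have h1 : ∀ x : ℝ, |x - 1| ≤ 1 / 10 ^ 5 → |√x| ≤ 2 := fun x hx => by
      rw [abs_of_nonneg (Real.sqrt_nonneg _), Real.sqrt_le_left (by norm_num)]
      linarith [(abs_le.1 hx).2]
    induction k using Fin.cases with
    | zero => exact h1 _ hN
    | succ i => exact h1 _ (hc i)
  have hE : ∀ k μ, |E k μ| ≤ 3 / 2 := by
    intro k μ
    induction k using Fin.cases with
    | zero =>
      induction μ using Fin.cases with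
      | zero => simp [E, timeCovector]; norm_num
      | succ j =>
        simp only [E, timeCovector, Fin.cons_zero, Fin.cons_succ, abs_neg]
        exact (ha j).trans (by norm_num)
    | succ i =>
      induction μ using Fin.cases with
      | zero =>
        simp only [E, spaceCovector, Fin.cons_zero, Fin.cons_succ]
        exact (hb i).trans (by norm_num)
      | succ j =>
        simp only [E, spaceCovector, Fin.cons_succ]
        have := abs_le.1 (hB i j)
        rw [abs_le]
        split_ifs <;> constructor <;> linarith
  have hWb : ∀ k μ, |W k μ| ≤ 3 := by
    intro k μ
    rw [hW, of_apply, abs_mul]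
    calc _ ≤ (2 : ℝ) * (3 / 2) := mul_le_mul (hs k) (hE k μ) (abs_nonneg _) (by norm_num)
      _ = 3 := by norm_num
  have hP : W⁻¹ = G⁻¹ * (Wᵀ * minkowskiMatrix d) := by
    have h1 : G * W⁻¹ = Wᵀ * minkowskiMatrix d := by
      rw [hGW, mul_assoc, mul_nonsing_inv W hWdet, mul_one]
    rw [← h1, ← mul_assoc, nonsing_inv_mul G hdet, one_mul]
  refine ⟨fun k => WithLp.toLp 2 fun μ => W⁻¹ μ k, W, fun k μ => ?_, hWb, fun μ => ?_, fun μ ν => ?_⟩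
  · have h1 : W⁻¹ μ k = ∑ ν, G⁻¹ μ ν * (Wᵀ * minkowskiMatrix d) ν k := by
      conv_lhs => rw [hP]
      rfl
    have h2 : ∀ ν, |(Wᵀ * minkowskiMatrix d) ν k| ≤ 3 := by
      intro ν
      rw [minkowskiMatrix, mul_diagonal, abs_mul, transpose_apply]
      have : |(Fin.cons (-1) (fun _ : Fin d => (1 : ℝ)) : Fin (d + 1) → ℝ) k| = 1 := by
        induction k using Fin.cases <;> simp
      rw [this, mul_one]
      exact hWb k ν
    show |W⁻¹ μ k| ≤ _
    rw [h1]
    refine (Finset.abs_sum_le_sum_abs _ _).trans ?_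
    calc _ ≤ ∑ _ν : Fin (d + 1), H * 3 := Finset.sum_le_sum fun ν _ => by
          rw [abs_mul]
          exact mul_le_mul (hH μ ν) (h2 ν) (abs_nonneg _) ((abs_nonneg _).trans (hH μ ν))
      _ = _ := by simp
  · ext ν
    have h1 := congrFun (congrFun (nonsing_inv_mul W hWdet) ν) μ
    rw [Matrix.mul_apply, Matrix.one_apply] at h1
    simp only [WithLp.ofLp_sum, Finset.sum_apply, PiLp.smul_apply, smul_eq_mul,
      PiLp.single_apply]
    rw [← h1]
    exact Finset.sum_congr rfl fun _ _ => mul_comm _ _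
  · have h1 : G⁻¹ = W⁻¹ * minkowskiMatrix d * W⁻¹ᵀ := by
      refine inv_eq_right_inv ?_
      have h2 : Wᵀ * W⁻¹ᵀ = 1 := by
        rw [← transpose_mul, nonsing_inv_mul W hWdet, transpose_one]
      calc G * (W⁻¹ * minkowskiMatrix d * W⁻¹ᵀ)
          = Wᵀ * (minkowskiMatrix d * (W * W⁻¹) * minkowskiMatrix d) * W⁻¹ᵀ := by
            rw [hGW]; simp only [mul_assoc]
        _ = 1 := by
          rw [mul_nonsing_inv W hWdet, mul_one, minkowskiMatrix_mul_self, mul_one, h2]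
    rw [h1, minkowskiMatrix, Matrix.mul_apply]
    simp only [mul_diagonal, transpose_apply, Fin.sum_univ_succ, Fin.cons_zero, Fin.cons_succ]
    simp only [mul_neg, mul_one, neg_mul]
    ring

end Frame

/-! ### Smooth coefficients of the wave operator and the volume form -/

section Coefficients

open scoped Manifold Topology
open Matrix

variable {d : ℕ}

/-- A smooth function on an open set agrees on a compact subset with a test function. -/
theorem exists_contDiff_eqOn_compact {V E : Type*} [NormedAddCommGroup V] [NormedSpace ℝ V]
    [FiniteDimensional ℝ V] [NormedAddCommGroup E] [NormedSpace ℝ E] {U K : Set V} (hU : IsOpen U)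
    (hK : IsCompact K) (hKU : K ⊆ U) {F₀ : V → E} (hF : ContDiffOn ℝ ∞ F₀ U) :
    ∃ F : V → E, ContDiff ℝ ∞ F ∧ HasCompactSupport F ∧ ∀ x ∈ K, F x = F₀ x := by
  obtain ⟨L, hL, hKL, hLU⟩ := exists_compact_between hK hU hKU
  obtain ⟨θ, h1, h0, -⟩ := exists_contMDiffMap_one_nhds_of_subset_interior (n := (⊤ : ℕ∞)) 𝓘(ℝ, V)
    hK.isClosed hKL
  have hθ : ContDiff ℝ ∞ θ := θ.contMDiff.contDiff
  have hzero : ∀ x ∉ L, θ x • F₀ x = 0 := fun x hx => by rw [h0 x hx, zero_smul]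
  refine ⟨fun x => θ x • F₀ x, ?_, HasCompactSupport.intro hL hzero, fun x hx => ?_⟩
  · rw [contDiff_iff_contDiffAt]
    intro x
    by_cases hx : x ∈ U
    · exact hθ.contDiffAt.smul (hF.contDiffAt (hU.mem_nhds hx))
    · have hxL : Lᶜ ∈ 𝓝 x := hL.isClosed.isOpen_compl.mem_nhds fun h => hx (hLU h)
      refine (contDiffAt_const (c := (0 : E))).congr_of_eventuallyEq ?_
      filter_upwards [hxL] with y hy using hzero y hy
  · have : θ x = 1 := h1.self_of_nhdsSet x hx
    simp [this]

theorem contDiffOn_det {V ι : Type*} [NormedAddCommGroup V] [NormedSpace ℝ V] [Fintype ι]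
    [DecidableEq ι] {M : V → Matrix ι ι ℝ} {U : Set V}
    (h : ∀ μ ν, ContDiffOn ℝ ∞ (fun x => M x μ ν) U) : ContDiffOn ℝ ∞ (fun x => (M x).det) U := by
  simp_rw [det_apply]
  exact ContDiffOn.sum fun σ _ => (contDiffOn_prod fun i _ => h _ _).const_smul _

/-- Cramer's rule: the entries of the adjugate are determinants of matrices with smooth entries. -/
theorem contDiffOn_inv_apply {V ι : Type*} [NormedAddCommGroup V] [NormedSpace ℝ V] [Fintype ι]
    [DecidableEq ι] {M : V → Matrix ι ι ℝ} {U : Set V}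
    (h : ∀ μ ν, ContDiffOn ℝ ∞ (fun x => M x μ ν) U) (hdet : ∀ x ∈ U, IsUnit (M x).det) (μ ν : ι) :
    ContDiffOn ℝ ∞ (fun x => (M x)⁻¹ μ ν) U := by
  have h1 : ContDiffOn ℝ ∞ (fun x => ((M x).det)⁻¹ * (M x).adjugate μ ν) U := by
    refine ((contDiffOn_det h).inv fun x hx => (hdet x hx).ne_zero).mul ?_
    simp_rw [adjugate_apply]
    refine contDiffOn_det fun i j => ?_
    simp_rw [updateRow_apply]
    by_cases hi : i = ν
    · simp only [hi, if_true]; exact contDiffOn_const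
    · simp only [hi, if_false]; exact h i j
  refine h1.congr fun x _ => ?_
  rw [inv_def, Ring.inverse_eq_inv', Matrix.smul_apply, smul_eq_mul]

variable {F : Type*} [NormedAddCommGroup F] [NormedSpace ℝ F]

theorem contDiffOn_partialD {u : Spacetime d → F} {U : Set (Spacetime d)} (hU : IsOpen U)
    (hu : ContDiffOn ℝ ∞ u U) (μ : Fin (d + 1)) : ContDiffOn ℝ ∞ (partialD μ u) U :=
  (hu.fderiv_of_isOpen hU (by norm_cast)).clm_apply contDiffOn_const

theorem contDiff_partialD {u : Spacetime d → F} (hu : ContDiff ℝ ∞ u) (μ : Fin (d + 1)) :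
    ContDiff ℝ ∞ (partialD μ u) :=
  (hu.fderiv_right (by norm_cast)).clm_apply contDiff_const

theorem tsupport_partialD_subset (u : Spacetime d → F) (μ : Fin (d + 1)) :
    tsupport (partialD μ u) ⊆ tsupport u := tsupport_fderiv_apply_subset ℝ _

theorem partialD_eq_zero {u : Spacetime d → F} {K : Set (Spacetime d)} (hu : tsupport u ⊆ K)
    (μ : Fin (d + 1)) {x : Spacetime d} (hx : x ∉ K) : partialD μ u x = 0 :=
  image_eq_zero_of_notMem_tsupport fun h => hx (hu (tsupport_partialD_subset u μ h))

theorem partialD_partialD_eq_zero {u : Spacetime d → F} {K : Set (Spacetime d)}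
    (hu : tsupport u ⊆ K) (μ ν : Fin (d + 1)) {x : Spacetime d} (hx : x ∉ K) :
    partialD μ (partialD ν u) x = 0 :=
  partialD_eq_zero ((tsupport_partialD_subset u ν).trans hu) μ hx

/-- On functions supported in a compact set, the wave operator has smooth, compactly supported
coefficients. -/
theorem exists_waveOp_coefficients {U K : Set (Spacetime d)} (hU : IsOpen U) (hK : IsCompact K)
    (hKU : K ⊆ U) {g : Spacetime d → Matrix (Fin (d + 1)) (Fin (d + 1)) ℝ}
    (hg : IsSmoothLorentzianMetricOn g U) :
    ∃ (h : Fin (d + 1) → Fin (d + 1) → Spacetime d → ℝ) (k : Fin (d + 1) → Spacetime d → ℝ),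
      (∀ μ ν, ContDiff ℝ ∞ (h μ ν) ∧ HasCompactSupport (h μ ν)) ∧
      (∀ α, ContDiff ℝ ∞ (k α) ∧ HasCompactSupport (k α)) ∧
      (∀ μ ν, ∀ x ∈ K, h μ ν x = (g x)⁻¹ μ ν) ∧
      ∀ φ : Spacetime d → ℂ, tsupport φ ⊆ K → ∀ x, waveOp g φ x =
        (∑ μ, ∑ ν, (h μ ν x : ℂ) * partialD μ (partialD ν φ) x)
          - ∑ α, (k α x : ℂ) * partialD α φ x := by
  have hdet : ∀ x ∈ U, IsUnit (g x).det := fun x hx => isUnit_det_of_isLorentzianMatrix (hg.2 x hx)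
  have hinv := contDiffOn_inv_apply hg.1 hdet
  have hΓ : ∀ α μ ν, ContDiffOn ℝ ∞ (christoffel g α μ ν) U := fun α μ ν => by
    refine contDiffOn_const.mul (ContDiffOn.sum fun β _ => (hinv α β).mul ?_)
    exact ((contDiffOn_partialD hU (hg.1 β ν) μ).add (contDiffOn_partialD hU (hg.1 β μ) ν)).sub
      (contDiffOn_partialD hU (hg.1 μ ν) β)
  have hk₀ : ∀ α, ContDiffOn ℝ ∞ (fun x => ∑ μ, ∑ ν, (g x)⁻¹ μ ν * christoffel g α μ ν x) U :=
    fun α => ContDiffOn.sum fun μ _ => ContDiffOn.sum fun ν _ => (hinv μ ν).mul (hΓ α μ ν)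
  choose h hh₁ hh₂ hh₃ using fun μ ν => exists_contDiff_eqOn_compact hU hK hKU (hinv μ ν)
  choose k hk₁ hk₂ hk₃ using fun α => exists_contDiff_eqOn_compact hU hK hKU (hk₀ α)
  refine ⟨h, k, fun μ ν => ⟨hh₁ μ ν, hh₂ μ ν⟩, fun α => ⟨hk₁ α, hk₂ α⟩, hh₃, fun φ hφ x => ?_⟩
  by_cases hx : x ∈ K
  · rw [waveOp]
    simp_rw [mul_sub, Finset.sum_sub_distrib, hh₃ _ _ x hx, hk₃ _ x hx]
    congr 1
    push_cast
    simp_rw [Finset.mul_sum, Finset.sum_mul]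
    symm
    rw [Finset.sum_comm]
    refine Finset.sum_congr rfl fun μ _ => ?_
    rw [Finset.sum_comm]
    exact Finset.sum_congr rfl fun ν _ => Finset.sum_congr rfl fun α _ => mul_assoc _ _ _
  · simp [waveOp, partialD_eq_zero hφ _ hx, partialD_partialD_eq_zero hφ _ _ hx]

theorem exists_volume_coefficient {U K : Set (Spacetime d)} (hU : IsOpen U) (hK : IsCompact K)
    (hKU : K ⊆ U) {g : Spacetime d → Matrix (Fin (d + 1)) (Fin (d + 1)) ℝ}
    (hg : IsSmoothLorentzianMetricOn g U) {f : Spacetime d → ℂ} (hf : ContDiffOn ℝ ∞ f U) :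
    ∃ F : Spacetime d → ℂ, ContDiff ℝ ∞ F ∧ HasCompactSupport F ∧
      ∀ x ∈ K, F x = ((Real.sqrt |(g x).det| : ℝ) : ℂ) * f x := by
  have hdet : ∀ x ∈ U, (g x).det ≠ 0 := fun x hx =>
    (isUnit_det_of_isLorentzianMatrix (hg.2 x hx)).ne_zero
  refine exists_contDiff_eqOn_compact hU hK hKU (ContDiffOn.mul ?_ hf)
  exact Complex.ofRealCLM.contDiff.comp_contDiffOn (((contDiffOn_det hg.1).abs hdet).sqrt
    fun x hx => abs_ne_zero.2 (hdet x hx))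

end Coefficients

/-! ### Cutoffs at scale r = √λ and the frozen wave operator -/

section CutoffEstimate

variable {d : ℕ}

/-- Pointwise bounds by `e` for a function at frequency scale `lam` and its first two partial
derivatives. -/
structure JetBound (u : Spacetime d → ℂ) (lam : ℝ) (e : Spacetime d → ℝ) : Prop where
  zero : ∀ x, ‖u x‖ ≤ lam * e x
  one : ∀ μ x, ‖partialD μ u x‖ ≤ e x
  two : ∀ μ ν x, ‖partialD μ (partialD ν u) x‖ ≤ e x / lam

theorem eq_sum_smul_single (w : Spacetime d) :
    w = ∑ μ, w μ • EuclideanSpace.single μ (1 : ℝ) := by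
  ext ν
  simp [Pi.single_apply]

theorem fderiv_apply_eq_sum_partialD (u : Spacetime d → ℂ) (x w : Spacetime d) :
    fderiv ℝ u x w = ∑ μ, (w μ : ℂ) * partialD μ u x := by
  conv_lhs => rw [eq_sum_smul_single w, map_sum]
  refine Finset.sum_congr rfl fun μ _ => ?_
  rw [map_smul, Complex.real_smul, partialD]

theorem secondDeriv_eq_sum_partialD {u : Spacetime d → ℂ} (hu : ContDiff ℝ ∞ u)
    (w w' x : Spacetime d) :
    secondDeriv u w w' x = ∑ μ, ∑ ν, ((w' μ * w ν : ℝ) : ℂ) * partialD μ (partialD ν u) x := by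
  have h1 : (fun y => fderiv ℝ u y w) = fun y => ∑ ν, (w ν : ℂ) * partialD ν u y := by
    funext y; exact fderiv_apply_eq_sum_partialD u y w
  have hd : ∀ ν, DifferentiableAt ℝ (partialD ν u) x := fun ν =>
    (contDiff_partialD hu ν).differentiable (by norm_num) x
  rw [secondDeriv, h1, fderiv_apply_eq_sum_partialD]
  refine Finset.sum_congr rfl fun μ _ => ?_
  rw [partialD, fderiv_fun_sum fun ν _ => (hd ν).const_mul _]
  simp only [FunLike.coe_sum, Finset.sum_apply, Finset.mul_sum]
  refine Finset.sum_congr rfl fun ν _ => ?_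
  rw [fderiv_const_mul (hd ν), partialD]
  simp
  ring

theorem partialD_mul {X u : Spacetime d → ℂ} (hX : ContDiff ℝ ∞ X) (hu : ContDiff ℝ ∞ u)
    (μ : Fin (d + 1)) :
    partialD μ (fun x => X x * u x) = fun x => X x * partialD μ u x + partialD μ X x * u x := by
  funext x
  rw [partialD, fderiv_fun_mul (hX.differentiable (by norm_num) x)
    (hu.differentiable (by norm_num) x)]
  simp [partialD]
  ring

theorem partialD_add {X u : Spacetime d → ℂ} (hX : ContDiff ℝ ∞ X) (hu : ContDiff ℝ ∞ u)
    (μ : Fin (d + 1)) (x : Spacetime d) :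
    partialD μ (fun x => X x + u x) x = partialD μ X x + partialD μ u x := by
  rw [partialD, fderiv_fun_add (hX.differentiable (by norm_num) x)
    (hu.differentiable (by norm_num) x)]
  rfl

theorem partialD_partialD_mul {X u : Spacetime d → ℂ} (hX : ContDiff ℝ ∞ X)
    (hu : ContDiff ℝ ∞ u) (μ ν : Fin (d + 1)) (x : Spacetime d) :
    partialD μ (partialD ν (fun x => X x * u x)) x = X x * partialD μ (partialD ν u) x
      + partialD μ X x * partialD ν u x + partialD ν X x * partialD μ u x
      + partialD μ (partialD ν X) x * u x := by
  rw [partialD_mul hX hu ν, partialD_add (hX.mul (contDiff_partialD hu ν))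
    ((contDiff_partialD hX ν).mul hu), partialD_mul hX (contDiff_partialD hu ν),
    partialD_mul (contDiff_partialD hX ν) hu]
  ring

theorem norm_sum_sum_mul_le {ι : Type*} [Fintype ι] {h : ι → ι → ℂ} {p : ι → ι → ℂ} {H P : ℝ}
    (hh : ∀ μ ν, ‖h μ ν‖ ≤ H) (hp : ∀ μ ν, ‖p μ ν‖ ≤ P) :
    ‖∑ μ, ∑ ν, h μ ν * p μ ν‖ ≤ (Fintype.card ι : ℝ) ^ 2 * (H * P) := by
  refine (norm_sum_le _ _).trans ((Finset.sum_le_sum fun μ _ => (norm_sum_le _ _).trans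
    (Finset.sum_le_sum fun ν _ => (norm_mul _ _).le.trans
      (mul_le_mul (hh μ ν) (hp μ ν) (norm_nonneg _) ((norm_nonneg _).trans (hh μ ν))))).trans_eq ?_)
  simp [sq]
  ring

theorem norm_sum_mul_le {ι : Type*} [Fintype ι] {h : ι → ℂ} {p : ι → ℂ} {H P : ℝ}
    (hh : ∀ μ, ‖h μ‖ ≤ H) (hp : ∀ μ, ‖p μ‖ ≤ P) :
    ‖∑ μ, h μ * p μ‖ ≤ (Fintype.card ι : ℝ) * (H * P) := by
  refine (norm_sum_le _ _).trans ((Finset.sum_le_sum fun μ _ => (norm_mul _ _).le.trans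
      (mul_le_mul (hh μ) (hp μ) (norm_nonneg _) ((norm_nonneg _).trans (hh μ)))).trans_eq ?_)
  simp

/-- Passage from partial derivatives to derivatives along a frame. -/
theorem JetBound.localBound {u : Spacetime d → ℂ} (hu : ContDiff ℝ ∞ u) {lam ε : ℝ}
    {e : Spacetime d → ℝ} (h : JetBound u lam e) (hlam : 0 < lam) (hε : 0 ≤ ε) {P : ℝ} (hP0 : 0 ≤ P)
    {v : Fin (d + 1) → Spacetime d} (hP : ∀ c μ, |v c μ| ≤ P)
    {G : Fin (d + 1) → Fin (d + 1) → ℝ}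
    (hG : ∀ μ ν, G μ ν = (∑ i : Fin d, v i.succ μ * v i.succ ν) - v 0 μ * v 0 ν)
    (hq : ∀ x, ‖∑ μ, ∑ ν, (G μ ν : ℂ) * partialD μ (partialD ν u) x‖ ≤ ε / lam * e x) :
    LocalBound v u lam ε (fun x => (1 + (d + 1) * P + (d + 1) ^ 2 * P ^ 2) * e x) := by
  have he : ∀ x, 0 ≤ e x := fun x => (norm_nonneg _).trans (h.one 0 x)
  have hle : ∀ {A : ℝ}, A ≤ 1 + (d + 1) * P + (d + 1) ^ 2 * P ^ 2 → ∀ x,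
      A * e x ≤ (1 + (d + 1) * P + (d + 1) ^ 2 * P ^ 2) * e x := fun hA x =>
    mul_le_mul_of_nonneg_right hA (he x)
  have p1 : 0 ≤ (d + 1) * P := by positivity
  have p2 : 0 ≤ (d + 1) ^ 2 * P ^ 2 := by positivity
  refine ⟨fun x => ?_, fun c x => ?_, fun c c' x => ?_, fun x => ?_⟩
  · refine (h.zero x).trans ?_
    gcongr
    simpa using hle (A := 1) (by linarith) x
  · rw [fderiv_apply_eq_sum_partialD]
    refine (norm_sum_mul_le (H := P) (P := e x) (fun μ => ?_) (fun μ => h.one μ x)).trans ?_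
    · rw [Complex.norm_real]; exact hP c μ
    · rw [Fintype.card_fin, ← mul_assoc]
      push_cast
      exact hle (by linarith) x
  · rw [secondDeriv_eq_sum_partialD hu]
    refine (norm_sum_sum_mul_le (H := P * P) (P := e x / lam) (fun μ ν => ?_)
      (fun μ ν => h.two μ ν x)).trans ?_
    · rw [Complex.norm_real, norm_mul]
      exact mul_le_mul (hP c' μ) (hP c ν) (norm_nonneg _) hP0
    · rw [Fintype.card_fin, ← mul_div_assoc, ← mul_div_assoc]
      refine div_le_div_of_nonneg_right ?_ hlam.le
      rw [← mul_assoc]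
      push_cast
      exact hle (by linarith) x
  · have e1 : (∑ i : Fin d, secondDeriv u (v i.succ) (v i.succ) x) - secondDeriv u (v 0) (v 0) x
        = ∑ μ, ∑ ν, (G μ ν : ℂ) * partialD μ (partialD ν u) x := by
      simp_rw [secondDeriv_eq_sum_partialD hu, hG]
      rw [Finset.sum_comm, ← Finset.sum_sub_distrib]
      refine Finset.sum_congr rfl fun μ _ => ?_
      rw [Finset.sum_comm, ← Finset.sum_sub_distrib]
      refine Finset.sum_congr rfl fun ν _ => ?_
      push_cast
      rw [sub_mul, Finset.sum_mul]
    rw [e1]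
    refine (hq x).trans ?_
    gcongr
    simpa using hle (A := 1) (by linarith) x

/-- Bounds for a smooth cutoff at spatial scale `r`. -/
structure CutoffBound (X : Spacetime d → ℂ) (r C : ℝ) : Prop where
  smooth : ContDiff ℝ ∞ X
  zero : ∀ x, ‖X x‖ ≤ C
  one : ∀ μ x, ‖partialD μ X x‖ ≤ C / r
  two : ∀ μ ν x, ‖partialD μ (partialD ν X) x‖ ≤ C / r ^ 2

/-- A derivative costs 1/r on the cutoff and 1/r² on `u`, so for r ≤ 1 the terms with all
derivatives on `u` dominate. The 4 bounds (1 + r)². -/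
theorem CutoffBound.jetBound_mul {X u : Spacetime d → ℂ} {r C : ℝ} {e : Spacetime d → ℝ}
    (hX : CutoffBound X r C) (hu : ContDiff ℝ ∞ u) (h : JetBound u (r ^ 2) e) (hr : 0 < r)
    (hr1 : r ≤ 1) : JetBound (fun x => X x * u x) (r ^ 2) (fun x => 4 * C * e x) := by
  have he : ∀ x, 0 ≤ e x := fun x => (norm_nonneg _).trans (h.one 0 x)
  have hC : 0 ≤ C := (norm_nonneg _).trans (hX.zero 0)
  have hCe : ∀ x, 0 ≤ C * e x := fun x => mul_nonneg hC (he x)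
  refine ⟨fun x => ?_, fun μ x => ?_, fun μ ν x => ?_⟩
  · rw [norm_mul]
    calc _ ≤ C * (r ^ 2 * e x) := mul_le_mul (hX.zero x) (h.zero x) (norm_nonneg _) hC
      _ ≤ _ := by nlinarith [mul_nonneg (sq_nonneg r) (hCe x)]
  · rw [partialD_mul hX.smooth hu]
    calc _ ≤ ‖X x‖ * ‖partialD μ u x‖ + ‖partialD μ X x‖ * ‖u x‖ := by
          refine (norm_add_le _ _).trans_eq ?_
          rw [norm_mul, norm_mul]
      _ ≤ C * e x + (C / r) * (r ^ 2 * e x) := by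
          gcongr
          · exact hX.zero x
          · exact h.one μ x
          · exact hX.one μ x
          · exact h.zero x
      _ = C * e x * (1 + r) := by field_simp
      _ ≤ C * e x * 4 := mul_le_mul_of_nonneg_left (by linarith) (hCe x)
      _ = _ := by ring
  · rw [partialD_partialD_mul hX.smooth hu]
    calc _ ≤ ‖X x‖ * ‖partialD μ (partialD ν u) x‖ + ‖partialD μ X x‖ * ‖partialD ν u x‖
          + ‖partialD ν X x‖ * ‖partialD μ u x‖ + ‖partialD μ (partialD ν X) x‖ * ‖u x‖ := by
          refine (norm_add₄_le ..).trans_eq ?_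
          simp only [norm_mul]
      _ ≤ C * (e x / r ^ 2) + (C / r) * e x + (C / r) * e x + (C / r ^ 2) * (r ^ 2 * e x) := by
          gcongr
          · exact hX.zero x
          · exact h.two μ ν x
          · exact hX.one μ x
          · exact h.one ν x
          · exact hX.one ν x
          · exact h.one μ x
          · exact hX.two μ ν x
          · exact h.zero x
      _ = C * e x * (1 + 2 * r + r ^ 2) / r ^ 2 := by field_simp; ring
      _ ≤ C * e x * 4 / r ^ 2 := by
          gcongr
          · exact hCe x
          · nlinarith
      _ = _ := by ring

/-- The commutator of the frozen wave operator with a cutoff. -/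
theorem CutoffBound.norm_frozenBox_mul_le {X u : Spacetime d → ℂ} {r C H L : ℝ}
    {e : Spacetime d → ℝ} (hX : CutoffBound X r C) (hu : ContDiff ℝ ∞ u)
    (hj : JetBound u (r ^ 2) e) (hr : 0 < r) (hr1 : r ≤ 1) (hH : 0 ≤ H)
    {h : Fin (d + 1) → Fin (d + 1) → Spacetime d → ℝ} {k : Fin (d + 1) → Spacetime d → ℝ}
    {w : Spacetime d → ℂ} (hw : ∀ x, w x = (∑ μ, ∑ ν, (h μ ν x : ℂ) * partialD μ (partialD ν u) x)
          - ∑ α, (k α x : ℂ) * partialD α u x) (hwe : ∀ x, ‖w x‖ ≤ e x)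
    (hh : ∀ μ ν x, |h μ ν x| ≤ H) (hk : ∀ α x, |k α x| ≤ H) {z x : Spacetime d}
    (hz : ∀ μ ν, |h μ ν z - h μ ν x| ≤ L * r) :
    ‖∑ μ, ∑ ν, (h μ ν z : ℂ) * partialD μ (partialD ν fun x => X x * u x) x‖
      ≤ r / r ^ 2 * (C * (1 + (d + 1) * H + (d + 1) ^ 2 * (L + 3 * H)) * e x) := by
  have he : 0 ≤ e x := (norm_nonneg _).trans (hj.one 0 x)
  have hC : 0 ≤ C := (norm_nonneg _).trans (hX.zero 0)
  -- The principal part at z is the true operator `w`, plus its first-order terms, plus the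
  -- variation of the coefficients, plus the commutator with `X`. The variation Lr·e/r² and the
  -- terms with one derivative on `X` are of order e/r; the rest is O(e). So the total is O(e/r),
  -- that is r/λ times e.
  have e1 : ∑ μ, ∑ ν, (h μ ν z : ℂ) * partialD μ (partialD ν fun x => X x * u x) x
      = X x * (w x + (∑ α, (k α x : ℂ) * partialD α u x)
          + ∑ μ, ∑ ν, ((h μ ν z - h μ ν x : ℝ) : ℂ) * partialD μ (partialD ν u) x)
        + (∑ μ, ∑ ν, (h μ ν z : ℂ) * (partialD μ X x * partialD ν u x))
        + (∑ μ, ∑ ν, (h μ ν z : ℂ) * (partialD ν X x * partialD μ u x))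
        + ∑ μ, ∑ ν, (h μ ν z : ℂ) * (partialD μ (partialD ν X) x * u x) := by
    rw [hw, sub_add_cancel, ← Finset.sum_add_distrib]
    simp_rw [partialD_partialD_mul hX.smooth hu, ← Finset.sum_add_distrib, Finset.mul_sum,
      ← Finset.sum_add_distrib]
    refine Finset.sum_congr rfl fun μ _ => Finset.sum_congr rfl fun ν _ => ?_
    push_cast
    ring
  have hn : ∀ y : ℝ, ‖(y : ℂ)‖ = |y| := fun y => by rw [Complex.norm_real, Real.norm_eq_abs]
  have b1 : ‖∑ α, (k α x : ℂ) * partialD α u x‖ ≤ (d + 1) * (H * e x) := by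
    have := norm_sum_mul_le (h := fun α => (k α x : ℂ)) (p := fun α => partialD α u x) (H := H)
      (fun α => by rw [hn]; exact hk α x) (fun α => hj.one α x)
    simpa using this
  have b2 : ‖∑ μ, ∑ ν, ((h μ ν z - h μ ν x : ℝ) : ℂ) * partialD μ (partialD ν u) x‖
      ≤ (d + 1) ^ 2 * ((L * r) * (e x / r ^ 2)) := by
    have := norm_sum_sum_mul_le (h := fun μ ν => ((h μ ν z - h μ ν x : ℝ) : ℂ))
      (p := fun μ ν => partialD μ (partialD ν u) x) (H := L * r)
      (fun μ ν => by rw [hn]; exact hz μ ν) (fun μ ν => hj.two μ ν x)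
    simpa using this
  have b3 : ‖∑ μ, ∑ ν, (h μ ν z : ℂ) * (partialD μ X x * partialD ν u x)‖
      ≤ (d + 1) ^ 2 * (H * (C / r * e x)) := by
    have := norm_sum_sum_mul_le (h := fun μ ν => (h μ ν z : ℂ))
      (p := fun μ ν => partialD μ X x * partialD ν u x) (H := H)
      (fun μ ν => by rw [hn]; exact hh μ ν z) (fun μ ν => by
        rw [norm_mul]
        exact mul_le_mul (hX.one μ x) (hj.one ν x) (norm_nonneg _) (by positivity))
    simpa using this
  have b4 : ‖∑ μ, ∑ ν, (h μ ν z : ℂ) * (partialD ν X x * partialD μ u x)‖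
      ≤ (d + 1) ^ 2 * (H * (C / r * e x)) := by
    have := norm_sum_sum_mul_le (h := fun μ ν => (h μ ν z : ℂ))
      (p := fun μ ν => partialD ν X x * partialD μ u x) (H := H)
      (fun μ ν => by rw [hn]; exact hh μ ν z) (fun μ ν => by
        rw [norm_mul]
        exact mul_le_mul (hX.one ν x) (hj.one μ x) (norm_nonneg _) (by positivity))
    simpa using this
  have b5 : ‖∑ μ, ∑ ν, (h μ ν z : ℂ) * (partialD μ (partialD ν X) x * u x)‖
      ≤ (d + 1) ^ 2 * (H * (C / r ^ 2 * (r ^ 2 * e x))) := by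
    have := norm_sum_sum_mul_le (h := fun μ ν => (h μ ν z : ℂ))
      (p := fun μ ν => partialD μ (partialD ν X) x * u x) (H := H)
      (fun μ ν => by rw [hn]; exact hh μ ν z) (fun μ ν => by
        rw [norm_mul]
        exact mul_le_mul (hX.two μ ν x) (hj.zero x) (norm_nonneg _) (by positivity))
    simpa using this
  rw [e1]
  refine (norm_add₄_le ..).trans ?_
  rw [norm_mul]
  have b0 : ‖X x‖ * ‖w x + (∑ α, (k α x : ℂ) * partialD α u x)
          + ∑ μ, ∑ ν, ((h μ ν z - h μ ν x : ℝ) : ℂ) * partialD μ (partialD ν u) x‖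
      ≤ C * (e x + (d + 1) * (H * e x) + (d + 1) ^ 2 * ((L * r) * (e x / r ^ 2))) := by
    refine mul_le_mul (hX.zero x) ((norm_add₃_le ..).trans ?_) (norm_nonneg _) hC
    exact add_le_add (add_le_add (hwe x) b1) b2
  refine (add_le_add (add_le_add (add_le_add b0 b3) b4) b5).trans ?_
  have e2 : C * (e x + (d + 1) * (H * e x) + (d + 1) ^ 2 * ((L * r) * (e x / r ^ 2)))
        + (d + 1) ^ 2 * (H * (C / r * e x)) + (d + 1) ^ 2 * (H * (C / r * e x))
        + (d + 1) ^ 2 * (H * (C / r ^ 2 * (r ^ 2 * e x)))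
      = C * e x * ((1 + (d + 1) * H) * r + (d + 1) ^ 2 * L + 2 * (d + 1) ^ 2 * H
        + (d + 1) ^ 2 * H * r) / r := by
    field_simp
    ring
  have e3 : r / r ^ 2 * (C * (1 + (d + 1) * H + (d + 1) ^ 2 * (L + 3 * H)) * e x)
      = C * e x * ((1 + (d + 1) * H) * 1 + (d + 1) ^ 2 * L + 2 * (d + 1) ^ 2 * H
        + (d + 1) ^ 2 * H * 1) / r := by
    field_simp
    ring
  rw [e2, e3]
  gcongr

end CutoffEstimate

/-! ### Localized functions in a frozen frame -/

section LocalizedEstimate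

variable {d : ℕ}

theorem CutoffBound.mul {X Y : Spacetime d → ℂ} {r C D : ℝ} (hX : CutoffBound X r C)
    (hY : CutoffBound Y r D) (hr : 0 < r) : CutoffBound (fun x => X x * Y x) r (4 * (C * D)) := by
  have hC : 0 ≤ C := (norm_nonneg _).trans (hX.zero 0)
  have hD : 0 ≤ D := (norm_nonneg _).trans (hY.zero 0)
  have hCD := mul_nonneg hC hD
  refine ⟨hX.smooth.mul hY.smooth, fun x => ?_, fun μ x => ?_, fun μ ν x => ?_⟩
  · rw [norm_mul]
    exact (mul_le_mul (hX.zero x) (hY.zero x) (norm_nonneg _) hC).trans (by linarith)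
  · rw [partialD_mul hX.smooth hY.smooth]
    calc _ ≤ ‖X x‖ * ‖partialD μ Y x‖ + ‖partialD μ X x‖ * ‖Y x‖ := by
          refine (norm_add_le _ _).trans_eq ?_
          rw [norm_mul, norm_mul]
      _ ≤ C * (D / r) + (C / r) * D := by
          gcongr
          · exact hX.zero x
          · exact hY.one μ x
          · exact hX.one μ x
          · exact hY.zero x
      _ = 2 * (C * D) / r := by ring
      _ ≤ _ := by gcongr; norm_num
  · rw [partialD_partialD_mul hX.smooth hY.smooth]
    calc _ ≤ ‖X x‖ * ‖partialD μ (partialD ν Y) x‖ + ‖partialD μ X x‖ * ‖partialD ν Y x‖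
          + ‖partialD ν X x‖ * ‖partialD μ Y x‖ + ‖partialD μ (partialD ν X) x‖ * ‖Y x‖ := by
          refine (norm_add₄_le ..).trans_eq ?_
          simp only [norm_mul]
      _ ≤ C * (D / r ^ 2) + (C / r) * (D / r) + (C / r) * (D / r) + (C / r ^ 2) * D := by
          gcongr
          · exact hX.zero x
          · exact hY.two μ ν x
          · exact hX.one μ x
          · exact hY.one ν x
          · exact hX.one ν x
          · exact hY.one μ x
          · exact hX.two μ ν x
          · exact hY.zero x
      _ = _ := by field_simp; ring

theorem exists_bound_partialD {ψ : Spacetime d → ℂ} (hψ : ContDiff ℝ ∞ ψ)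
    (hc : HasCompactSupport ψ) : ∃ C, 0 ≤ C ∧ (∀ x, ‖ψ x‖ ≤ C) ∧ (∀ μ x, ‖partialD μ ψ x‖ ≤ C) ∧
      ∀ μ ν x, ‖partialD μ (partialD ν ψ) x‖ ≤ C := by
  have hc1 : ∀ μ, HasCompactSupport (partialD μ ψ) := fun μ =>
    hc.of_isClosed_subset (isClosed_tsupport _) (tsupport_partialD_subset ψ μ)
  have hc2 : ∀ μ ν, HasCompactSupport (partialD μ (partialD ν ψ)) := fun μ ν =>
    (hc1 ν).of_isClosed_subset (isClosed_tsupport _) (tsupport_partialD_subset _ μ)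
  obtain ⟨C₀, h₀⟩ := hc.exists_bound_of_continuous hψ.continuous
  choose C₁ h₁ using fun μ => (hc1 μ).exists_bound_of_continuous (contDiff_partialD hψ μ).continuous
  choose C₂ h₂ using fun μ ν => (hc2 μ ν).exists_bound_of_continuous
    (contDiff_partialD (contDiff_partialD hψ ν) μ).continuous
  have p₀ : 0 ≤ C₀ := (norm_nonneg _).trans (h₀ 0)
  have p₁ : ∀ μ, 0 ≤ C₁ μ := fun μ => (norm_nonneg _).trans (h₁ μ 0)
  have p₂ : ∀ μ ν, 0 ≤ C₂ μ ν := fun μ ν => (norm_nonneg _).trans (h₂ μ ν 0)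
  have s₁ : 0 ≤ ∑ μ, C₁ μ := Finset.sum_nonneg fun μ _ => p₁ μ
  have s₂' : ∀ μ, 0 ≤ ∑ ν, C₂ μ ν := fun μ => Finset.sum_nonneg fun ν _ => p₂ μ ν
  have s₂ : 0 ≤ ∑ μ, ∑ ν, C₂ μ ν := Finset.sum_nonneg fun μ _ => s₂' μ
  refine ⟨C₀ + (∑ μ, C₁ μ) + ∑ μ, ∑ ν, C₂ μ ν, by positivity, fun x => ?_, fun μ x => ?_,
    fun μ ν x => ?_⟩
  · linarith [h₀ x]
  · linarith [h₁ μ x, Finset.single_le_sum (fun μ _ => p₁ μ) (Finset.mem_univ μ)]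
  · linarith [h₂ μ ν x, Finset.single_le_sum (fun ν _ => p₂ μ ν) (Finset.mem_univ ν),
      Finset.single_le_sum (fun μ _ => s₂' μ) (Finset.mem_univ μ)]

theorem exists_cutoffBound_const {F : Spacetime d → ℂ} (hF : ContDiff ℝ ∞ F)
    (hc : HasCompactSupport F) : ∃ C, ∀ r, 0 < r → r ≤ 1 → CutoffBound F r C := by
  obtain ⟨C, hC, h₀, h₁, h₂⟩ := exists_bound_partialD hF hc
  refine ⟨C, fun r hr hr1 => ⟨hF, h₀, fun μ x => (h₁ μ x).trans ?_, fun μ ν x => (h₂ μ ν x).trans ?_⟩⟩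
  · exact (le_div_iff₀ hr).2 (mul_le_of_le_one_right hC hr1)
  · exact (le_div_iff₀ (by positivity)).2 (mul_le_of_le_one_right hC (pow_le_one₀ hr.le hr1))

/-- The function `ψ` recentred at `y` and rescaled to size `r`. -/
noncomputable def rescale {E : Type*} (ψ : Spacetime d → E) (r : ℝ) (y x : Spacetime d) : E := ψ (r⁻¹ • (x - y))

theorem partialD_rescale {ψ : Spacetime d → ℂ} (hψ : ContDiff ℝ ∞ ψ) (r : ℝ) (y : Spacetime d)
    (μ : Fin (d + 1)) :
    partialD μ (rescale ψ r y) = fun x => ((r⁻¹ : ℝ) : ℂ) * rescale (partialD μ ψ) r y x := by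
  funext x
  have h1 : HasFDerivAt (fun x : Spacetime d => r⁻¹ • (x - y))
      (r⁻¹ • ContinuousLinearMap.id ℝ (Spacetime d)) x :=
    ((hasFDerivAt_id x).sub_const y).const_smul r⁻¹
  have h2 := ((hψ.differentiable (by norm_num)) (r⁻¹ • (x - y))).hasFDerivAt.comp x h1
  rw [partialD, show rescale ψ r y = ψ ∘ fun x => r⁻¹ • (x - y) from rfl, h2.fderiv]
  simp [rescale, partialD]

theorem contDiff_rescale {E : Type*} [NormedAddCommGroup E] [NormedSpace ℝ E] {ψ : Spacetime d → E}
    (hψ : ContDiff ℝ ∞ ψ) (r : ℝ) (y : Spacetime d) : ContDiff ℝ ∞ (rescale ψ r y) :=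
  hψ.comp (by fun_prop : ContDiff ℝ ∞ fun x : Spacetime d => r⁻¹ • (x - y))

theorem exists_cutoffBound_rescale {ψ : Spacetime d → ℂ} (hψ : ContDiff ℝ ∞ ψ)
    (hc : HasCompactSupport ψ) : ∃ C, ∀ r, 0 < r → ∀ y, CutoffBound (rescale ψ r y) r C := by
  obtain ⟨C, hC, h₀, h₁, h₂⟩ := exists_bound_partialD hψ hc
  refine ⟨C, fun r hr y => ⟨contDiff_rescale hψ r y, fun x => h₀ _, fun μ x => ?_, fun μ ν x => ?_⟩⟩
  · rw [partialD_rescale hψ, norm_mul, Complex.norm_real, Real.norm_of_nonneg (by positivity),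
      div_eq_inv_mul]
    gcongr
    exact h₁ μ _
  · have h3 : partialD μ (partialD ν (rescale ψ r y)) x
        = ((r⁻¹ : ℝ) : ℂ) * (((r⁻¹ : ℝ) : ℂ) * rescale (partialD μ (partialD ν ψ)) r y x) := by
      rw [partialD_rescale hψ]
      have h4 := partialD_mul (X := fun _ => ((r⁻¹ : ℝ) : ℂ)) contDiff_const
        (contDiff_rescale (contDiff_partialD hψ ν) r y) μ
      rw [h4, partialD_rescale (contDiff_partialD hψ ν)]
      simp [partialD]
    rw [h3, norm_mul, norm_mul, Complex.norm_real, Real.norm_of_nonneg (by positivity),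
      ← mul_assoc, ← mul_inv, ← sq, div_eq_inv_mul]
    gcongr
    exact h₂ μ ν _

theorem tsupport_rescale_subset {E : Type*} [NormedAddCommGroup E] {ψ : Spacetime d → E} {R r : ℝ}
    (hr : 0 < r) (hψ : ∀ x, R ≤ ‖x‖ → ψ x = 0) (y : Spacetime d) :
    tsupport (rescale ψ r y) ⊆ Metric.closedBall y (R * r) := by
  refine closure_minimal (fun x hx => ?_) Metric.isClosed_closedBall
  by_contra hxy
  refine hx (hψ _ ?_)
  rw [Metric.mem_closedBall, not_le, dist_eq_norm] at hxy
  rw [norm_smul, Real.norm_of_nonneg (by positivity), inv_mul_eq_div, le_div_iff₀ hr]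
  exact hxy.le

/-- All derivatives vanish off the support, so the majorant may be cut to it; the L² norms thereby
become local. -/
theorem JetBound.indicator {u : Spacetime d → ℂ} {lam : ℝ} {e : Spacetime d → ℝ}
    (h : JetBound u lam e) {S : Set (Spacetime d)} (hS : tsupport u ⊆ S) :
    JetBound u lam (S.indicator e) := by
  refine ⟨fun x => ?_, fun μ x => ?_, fun μ ν x => ?_⟩
  all_goals by_cases hx : x ∈ S
  · rw [Set.indicator_of_mem hx]; exact h.zero x
  · rw [image_eq_zero_of_notMem_tsupport fun h => hx (hS h), Set.indicator_of_notMem hx]; simp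
  · rw [Set.indicator_of_mem hx]; exact h.one μ x
  · rw [partialD_eq_zero hS μ hx, Set.indicator_of_notMem hx]; simp
  · rw [Set.indicator_of_mem hx]; exact h.two μ ν x
  · rw [partialD_partialD_eq_zero hS μ ν hx, Set.indicator_of_notMem hx]; simp

theorem JetBound.mono {u : Spacetime d → ℂ} {lam : ℝ} {e e' : Spacetime d → ℝ} (hlam : 0 < lam)
    (h : JetBound u lam e) (hle : ∀ x, e x ≤ e' x) : JetBound u lam e' :=
  ⟨fun x => (h.zero x).trans (by gcongr; exact hle x), fun μ x => (h.one μ x).trans (hle x),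
    fun μ ν x => (h.two μ ν x).trans (by gcongr; exact hle x)⟩

/-- The constant in the estimate for localized functions in a frozen frame. -/
def localConst (d : ℕ) (P H L C : ℝ) : ℝ :=
  (1 + (d + 1) * P + (d + 1) ^ 2 * P ^ 2)
    * (4 * C + C * (1 + (d + 1) * H + (d + 1) ^ 2 * (6 * L + 3 * H)))

/-- This is where the gain is fixed: λ = r² and ε = r. The freezing point z lies within 2r of the
centre and the support within 4r, so the coefficients vary by at most L·6r, whence 6L in
`localConst`. -/
theorem CutoffBound.localBound_mul {X u : Spacetime d → ℂ} {r C H L P : ℝ}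
    {e : Spacetime d → ℝ} (hX : CutoffBound X r C) (hu : ContDiff ℝ ∞ u)
    (hj : JetBound u (r ^ 2) e) (hr : 0 < r) (hr1 : r ≤ 1) (hH : 0 ≤ H) (hL : 0 ≤ L) (hP0 : 0 ≤ P)
    {h : Fin (d + 1) → Fin (d + 1) → Spacetime d → ℝ} {k : Fin (d + 1) → Spacetime d → ℝ}
    {w : Spacetime d → ℂ} (hw : ∀ x, w x = (∑ μ, ∑ ν, (h μ ν x : ℂ) * partialD μ (partialD ν u) x)
          - ∑ α, (k α x : ℂ) * partialD α u x) (hwe : ∀ x, ‖w x‖ ≤ e x)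
    (hh : ∀ μ ν x, |h μ ν x| ≤ H) (hk : ∀ α x, |k α x| ≤ H)
    (hLip : ∀ μ ν x z, |h μ ν z - h μ ν x| ≤ L * dist z x)
    {y z : Spacetime d} (hXy : tsupport X ⊆ Metric.closedBall y (4 * r)) (hzy : dist z y ≤ 2 * r)
    {v : Fin (d + 1) → Spacetime d} (hP : ∀ c μ, |v c μ| ≤ P)
    (hG : ∀ μ ν, h μ ν z = (∑ i : Fin d, v i.succ μ * v i.succ ν) - v 0 μ * v 0 ν) :
    LocalBound v (fun x => X x * u x) (r ^ 2) r
      (fun x => localConst d P H L C * (Metric.closedBall y (4 * r)).indicator e x) := by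
  have he : ∀ x, 0 ≤ e x := fun x => (norm_nonneg _).trans (hj.one 0 x)
  have hC : 0 ≤ C := (norm_nonneg _).trans (hX.zero 0)
  set S := Metric.closedBall y (4 * r)
  set D := 4 * C + C * (1 + (d + 1) * H + (d + 1) ^ 2 * (6 * L + 3 * H)) with hD
  have hD1 : 4 * C ≤ D := by
    rw [hD]
    have : 0 ≤ C * (1 + (d + 1) * H + (d + 1) ^ 2 * (6 * L + 3 * H)) := by positivity
    linarith
  have hD2 : C * (1 + (d + 1) * H + (d + 1) ^ 2 * (6 * L + 3 * H)) ≤ D := by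
    rw [hD]; linarith
  have hsupp : tsupport (fun x => X x * u x) ⊆ S := (tsupport_mul_subset_left).trans hXy
  have hsm : ContDiff ℝ ∞ fun x => X x * u x := hX.smooth.mul hu
  have hjet : JetBound (fun x => X x * u x) (r ^ 2) (S.indicator fun x => D * e x) :=
    ((hX.jetBound_mul hu hj hr hr1).mono (by positivity) fun x => by
      have := he x
      gcongr).indicator hsupp
  have hind : ∀ x, (S.indicator fun x => D * e x) x = D * S.indicator e x := fun x => by
    by_cases hx : x ∈ S
    · rw [Set.indicator_of_mem hx, Set.indicator_of_mem hx]
    · rw [Set.indicator_of_notMem hx, Set.indicator_of_notMem hx, mul_zero]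
  have := hjet.localBound hsm (by positivity) hr.le hP0 hP hG (fun x => by
    by_cases hx : x ∈ S
    · rw [Set.indicator_of_mem hx]
      refine (hX.norm_frozenBox_mul_le (L := 6 * L) hu hj hr hr1 hH hw hwe hh hk fun μ ν => ?_).trans
        ?_
      · refine (hLip μ ν x z).trans ?_
        have h1 : dist z x ≤ 6 * r := by
          have := dist_triangle z y x
          rw [dist_comm y x] at this
          linarith [Metric.mem_closedBall.1 hx]
        calc L * dist z x ≤ L * (6 * r) := by gcongr
          _ = _ := by ring
      · have := he x
        gcongr
    · rw [Set.indicator_of_notMem hx]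
      simp [partialD_partialD_eq_zero hsupp _ _ hx])
  simp_rw [hind, ← mul_assoc] at this
  exact this

end LocalizedEstimate

/-! ### The pointwise majorant behind the X norm -/

section JetSize

variable {d : ℕ}

/-- The pointwise quantity whose `L^p` norm is controlled by `XNorm p`. -/
noncomputable def jetSize (g : Spacetime d → Matrix (Fin (d + 1)) (Fin (d + 1)) ℝ) (lam : ℝ)
    (φ : Spacetime d → ℂ) (x : Spacetime d) : ℝ :=
  (∑ k ∈ Finset.range 3, lam ^ ((k : ℤ) - 1) * ‖iteratedFDeriv ℝ k φ x‖) + ‖waveOp g φ x‖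

variable {g : Spacetime d → Matrix (Fin (d + 1)) (Fin (d + 1)) ℝ} {lam : ℝ}

theorem jetSize_nonneg (hlam : 0 < lam) (φ : Spacetime d → ℂ) (x : Spacetime d) :
    0 ≤ jetSize g lam φ x := by
  rw [jetSize]
  positivity

theorem norm_waveOp_le_jetSize (hlam : 0 < lam) (φ : Spacetime d → ℂ) (x : Spacetime d) :
    ‖waveOp g φ x‖ ≤ jetSize g lam φ x :=
  le_add_of_nonneg_left (Finset.sum_nonneg fun _ _ => by positivity)

theorem zpow_mul_norm_le_jetSize (hlam : 0 < lam) (φ : Spacetime d → ℂ) (x : Spacetime d) {k : ℕ}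
    (hk : k < 3) : lam ^ ((k : ℤ) - 1) * ‖iteratedFDeriv ℝ k φ x‖ ≤ jetSize g lam φ x :=
  (Finset.single_le_sum (f := fun k : ℕ => lam ^ ((k : ℤ) - 1) * ‖iteratedFDeriv ℝ k φ x‖)
    (fun _ _ => by positivity) (Finset.mem_range.2 hk)).trans
    (le_add_of_nonneg_right (norm_nonneg _))

theorem jetBound_jetSize (hlam : 0 < lam) {φ : Spacetime d → ℂ} (hφ : ContDiff ℝ ∞ φ) :
    JetBound φ lam (jetSize g lam φ) := by
  refine ⟨fun x => ?_, fun μ x => ?_, fun μ ν x => ?_⟩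
  · have := zpow_mul_norm_le_jetSize (g := g) hlam φ x (k := 0) (by norm_num)
    simp only [Nat.cast_zero, zero_sub, zpow_neg, zpow_one, norm_iteratedFDeriv_zero] at this
    rwa [inv_mul_le_iff₀ hlam] at this
  · have := zpow_mul_norm_le_jetSize (g := g) hlam φ x (k := 1) (by norm_num)
    simp only [Nat.cast_one, sub_self, zpow_zero, one_mul] at this
    refine le_trans ?_ this
    have h := (iteratedFDeriv ℝ 1 φ x).le_opNorm fun _ => EuclideanSpace.single μ (1 : ℝ)
    simpa [partialD] using h
  · have := zpow_mul_norm_le_jetSize (g := g) hlam φ x (k := 2) (by norm_num)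
    norm_num at this
    rw [le_div_iff₀ hlam, mul_comm]
    refine le_trans ?_ this
    gcongr
    have h := (iteratedFDeriv ℝ 2 φ x).le_opNorm
      ![EuclideanSpace.single μ (1 : ℝ), EuclideanSpace.single ν (1 : ℝ)]
    rw [iteratedFDeriv_two_apply] at h
    have hd : DifferentiableAt ℝ (fderiv ℝ φ) x :=
      (hφ.fderiv_right (m := ∞) (by norm_num)).differentiable (by norm_num) x
    have e1 : partialD μ (partialD ν φ) x = fderiv ℝ (fderiv ℝ φ) x (EuclideanSpace.single μ (1 : ℝ))
        (EuclideanSpace.single ν (1 : ℝ)) := by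
      rw [partialD]
      unfold partialD
      rw [fderiv_clm_apply hd (differentiableAt_const _)]
      simp
    rw [e1]
    simpa [Fin.prod_univ_two] using h

/-- Smooth coefficients of the wave operator near a compact set, with uniform bounds and frames
diagonalizing the principal part at each point. -/
structure FrozenCoefficients (g : Spacetime d → Matrix (Fin (d + 1)) (Fin (d + 1)) ℝ)
    (K : Set (Spacetime d)) (h : Fin (d + 1) → Fin (d + 1) → Spacetime d → ℝ)
    (k : Fin (d + 1) → Spacetime d → ℝ) (H L P : ℝ) : Prop where
  contPrincipal : ∀ μ ν, Continuous (h μ ν)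
  contLower : ∀ α, Continuous (k α)
  boundPrincipal : ∀ μ ν x, |h μ ν x| ≤ H
  boundLower : ∀ α x, |k α x| ≤ H
  lipschitz : ∀ μ ν x z, |h μ ν z - h μ ν x| ≤ L * dist z x
  waveOp_eq : ∀ φ : Spacetime d → ℂ, tsupport φ ⊆ K → ∀ x, waveOp g φ x =
    (∑ μ, ∑ ν, (h μ ν x : ℂ) * partialD μ (partialD ν φ) x) - ∑ α, (k α x : ℂ) * partialD α φ x
  nonnegH : 0 ≤ H
  nonnegL : 0 ≤ L
  nonnegP : 0 ≤ P
  frame : ∀ z ∈ K, ∃ (v : Fin (d + 1) → Spacetime d) (W : Fin (d + 1) → Fin (d + 1) → ℝ),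
    (∀ c μ, |v c μ| ≤ P) ∧ (∀ c μ, |W c μ| ≤ 3) ∧
    (∀ μ, EuclideanSpace.single μ (1 : ℝ) = ∑ c, W c μ • v c) ∧
    ∀ μ ν, h μ ν z = (∑ i : Fin d, v i.succ μ * v i.succ ν) - v 0 μ * v 0 ν

variable {K : Set (Spacetime d)} {h : Fin (d + 1) → Fin (d + 1) → Spacetime d → ℝ}
  {k : Fin (d + 1) → Spacetime d → ℝ} {H L P : ℝ}

theorem hasCompactSupport_of_tsupport_subset {E : Type*} [NormedAddCommGroup E]
    {φ : Spacetime d → E} (hK : IsCompact K) (hφ : tsupport φ ⊆ K) : HasCompactSupport φ :=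
  hK.of_isClosed_subset (isClosed_tsupport _) hφ

theorem FrozenCoefficients.continuous_waveOp (hF : FrozenCoefficients g K h k H L P)
    {φ : Spacetime d → ℂ} (hφ : ContDiff ℝ ∞ φ) (hs : tsupport φ ⊆ K) :
    Continuous (waveOp g φ) := by
  rw [show waveOp g φ = _ from funext (hF.waveOp_eq φ hs)]
  have h1 := fun μ => (contDiff_partialD hφ μ).continuous
  have h2 := fun μ ν => (contDiff_partialD (contDiff_partialD hφ ν) μ).continuous
  have h3 := hF.contPrincipal
  have h4 := hF.contLower
  fun_prop

theorem FrozenCoefficients.waveOp_eq_zero (hF : FrozenCoefficients g K h k H L P)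
    {φ : Spacetime d → ℂ} (hs : tsupport φ ⊆ K) {x : Spacetime d} (hx : x ∉ K) :
    waveOp g φ x = 0 := by
  rw [hF.waveOp_eq φ hs]
  simp [partialD_partialD_eq_zero hs _ _ hx, partialD_eq_zero hs _ hx]

theorem FrozenCoefficients.memLp_waveOp (hF : FrozenCoefficients g K h k H L P) (hK : IsCompact K)
    {φ : Spacetime d → ℂ} (hφ : ContDiff ℝ ∞ φ) (hs : tsupport φ ⊆ K) (p : ℝ≥0∞) :
    MemLp (waveOp g φ) p :=
  (hF.continuous_waveOp hφ hs).memLp_of_hasCompactSupport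
    (HasCompactSupport.intro hK fun _ hx => hF.waveOp_eq_zero hs hx)

theorem memLp_iteratedFDeriv (hK : IsCompact K) {φ : Spacetime d → ℂ} (hφ : ContDiff ℝ ∞ φ)
    (hs : tsupport φ ⊆ K) (j : ℕ) (p : ℝ≥0∞) : MemLp (iteratedFDeriv ℝ j φ) p :=
  (hφ.continuous_iteratedFDeriv (by exact_mod_cast le_top)).memLp_of_hasCompactSupport
    ((hasCompactSupport_of_tsupport_subset hK hs).iteratedFDeriv j)

theorem FrozenCoefficients.memLp_jetSize (hF : FrozenCoefficients g K h k H L P) (hK : IsCompact K)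
    {φ : Spacetime d → ℂ} (hφ : ContDiff ℝ ∞ φ) (hs : tsupport φ ⊆ K) (p : ℝ≥0∞) :
    MemLp (jetSize g lam φ) p := by
  refine MemLp.add (memLp_finsetSum _ fun j _ => ?_) (hF.memLp_waveOp hK hφ hs p).norm
  exact (memLp_iteratedFDeriv hK hφ hs j p).norm.const_mul _

theorem FrozenCoefficients.toReal_eLpNorm_jetSize_le (hF : FrozenCoefficients g K h k H L P)
    (hK : IsCompact K) (hlam : 0 < lam) {φ : Spacetime d → ℂ} (hφ : ContDiff ℝ ∞ φ)
    (hs : tsupport φ ⊆ K) {p : ℝ≥0∞} (hp : 1 ≤ p) :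
    (eLpNorm (jetSize g lam φ) p volume).toReal ≤ XNorm p lam g φ := by
  have h1 := fun j => memLp_iteratedFDeriv hK hφ hs j p
  have h2 := hF.memLp_waveOp hK hφ hs p
  have h3 : ∀ j : ℕ, MemLp (fun x => lam ^ ((j : ℤ) - 1) * ‖iteratedFDeriv ℝ j φ x‖) p := fun j =>
    (h1 j).norm.const_mul _
  have h4 : ∀ j : ℕ, eLpNorm (fun x => lam ^ ((j : ℤ) - 1) * ‖iteratedFDeriv ℝ j φ x‖) p volume
      = ENNReal.ofReal (lam ^ ((j : ℤ) - 1)) * eLpNorm (iteratedFDeriv ℝ j φ) p volume := fun j => by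
    rw [← eLpNorm_norm (iteratedFDeriv ℝ j φ), ← Real.enorm_of_nonneg (by positivity)]
    exact eLpNorm_const_smul (lam ^ ((j : ℤ) - 1)) (fun x => ‖iteratedFDeriv ℝ j φ x‖) p volume
  have e1 : jetSize g lam φ
      = (∑ j ∈ Finset.range 3, fun x => lam ^ ((j : ℤ) - 1) * ‖iteratedFDeriv ℝ j φ x‖)
        + fun x => ‖waveOp g φ x‖ := by
    funext x
    simp [jetSize]
  have h5 : eLpNorm (jetSize g lam φ) p volume
      ≤ (∑ j ∈ Finset.range 3, ENNReal.ofReal (lam ^ ((j : ℤ) - 1))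
          * eLpNorm (iteratedFDeriv ℝ j φ) p volume) + eLpNorm (waveOp g φ) p volume := by
    rw [e1]
    refine (eLpNorm_add_le (memLp_finsetSum' _ fun j _ => h3 j).1 h2.norm.1 hp).trans ?_
    rw [eLpNorm_norm]
    gcongr
    refine (eLpNorm_sum_le (fun j _ => (h3 j).1) hp).trans_eq ?_
    exact Finset.sum_congr rfl fun j _ => h4 j
  have h6 : ∀ j ∈ Finset.range 3, ENNReal.ofReal (lam ^ ((j : ℤ) - 1))
      * eLpNorm (iteratedFDeriv ℝ j φ) p volume ≠ ⊤ := fun j _ =>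
    ENNReal.mul_ne_top ENNReal.ofReal_ne_top (h1 j).eLpNorm_ne_top
  refine (ENNReal.toReal_mono (ENNReal.add_ne_top.2 ⟨ENNReal.sum_ne_top.2 h6, h2.eLpNorm_ne_top⟩)
    h5).trans_eq ?_
  rw [ENNReal.toReal_add (ENNReal.sum_ne_top.2 h6) h2.eLpNorm_ne_top, ENNReal.toReal_sum h6, XNorm]
  congr 1
  refine Finset.sum_congr rfl fun j _ => ?_
  rw [ENNReal.toReal_mul, ENNReal.toReal_ofReal (by positivity)]

theorem FrozenCoefficients.ae_jetSize_le (hF : FrozenCoefficients g K h k H L P)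
    (hK : IsCompact K) (hlam : 0 < lam) {φ : Spacetime d → ℂ} (hφ : ContDiff ℝ ∞ φ)
    (hs : tsupport φ ⊆ K) : ∀ᵐ x, jetSize g lam φ x ≤ XNorm ⊤ lam g φ := by
  have hm := hF.memLp_jetSize (lam := lam) hK hφ hs ⊤
  have h1 := hF.toReal_eLpNorm_jetSize_le hK hlam hφ hs (p := ⊤) le_top
  filter_upwards [enorm_ae_le_eLpNormEssSup (jetSize g lam φ) volume] with x hx
  rw [← eLpNorm_exponent_top] at hx
  have h2 := ENNReal.toReal_mono hm.eLpNorm_ne_top hx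
  rw [toReal_enorm] at h2
  exact (le_abs_self _).trans (h2.trans h1)

theorem XNorm_nonneg (hlam : 0 < lam) (p : ℝ≥0∞) (φ : Spacetime d → ℂ) :
    0 ≤ XNorm p lam g φ := by
  rw [XNorm]
  positivity

theorem exists_frozenCoefficients {U : Set (Spacetime d)} (hU : IsOpen U)
    (hg : IsSmoothLorentzianMetricOn g U)
    {N : Spacetime d → ℝ} {a b c : Fin d → Spacetime d → ℝ} {B : Fin d → Fin d → Spacetime d → ℝ}
    (hframe : ∀ x ∈ U, g x =
      framedMetric (N x) (fun i => a i x) (fun i => b i x) (fun i => c i x) (fun i j => B i j x))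
    (hNsmall : ∀ x ∈ U, |N x - 1| ≤ 1 / 10 ^ 5)
    (hcsmall : ∀ x ∈ U, ∀ i, |c i x - 1| ≤ 1 / 10 ^ 5)
    (hasmall : ∀ x ∈ U, ∀ i, |a i x| ≤ 1 / 10 ^ 5)
    (hbsmall : ∀ x ∈ U, ∀ i, |b i x| ≤ 1 / 10 ^ 5)
    (hBsmall : ∀ x ∈ U, ∀ i j, |B i j x| ≤ 1 / 10 ^ 5)
    (hK : IsCompact K) (hKU : K ⊆ U) : ∃ h k H L P, FrozenCoefficients g K h k H L P := by
  obtain ⟨h, k, hh, hk, hinv, hwave⟩ := exists_waveOp_coefficients hU hK hKU hg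
  -- The extended coefficients are test functions, hence globally bounded and Lipschitz. Only on `K`
  -- do they come from the metric, so frames exist only there.
  choose A hA using fun μ ν => (hh μ ν).2.exists_bound_of_continuous (hh μ ν).1.continuous
  choose A' hA' using fun α => (hk α).2.exists_bound_of_continuous (hk α).1.continuous
  choose M hM using fun μ ν =>
    (hh μ ν).1.lipschitzWith_of_hasCompactSupport (hh μ ν).2 (by norm_num)
  have pA : ∀ μ ν, 0 ≤ A μ ν := fun μ ν => (norm_nonneg _).trans (hA μ ν 0)
  have pA' : ∀ μ, 0 ≤ A' μ := fun μ => (norm_nonneg _).trans (hA' μ 0)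
  have s1 : ∀ μ, 0 ≤ ∑ ν, A μ ν := fun μ => Finset.sum_nonneg fun ν _ => pA μ ν
  have s2 : 0 ≤ ∑ μ, ∑ ν, A μ ν := Finset.sum_nonneg fun μ _ => s1 μ
  have s3 : 0 ≤ ∑ μ, A' μ := Finset.sum_nonneg fun μ _ => pA' μ
  set H := (∑ μ, ∑ ν, A μ ν) + ∑ μ, A' μ with hH
  have bh : ∀ μ ν x, |h μ ν x| ≤ H := fun μ ν x => by
    have := hA μ ν x
    rw [Real.norm_eq_abs] at this
    linarith [Finset.single_le_sum (fun ν _ => pA μ ν) (Finset.mem_univ ν),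
      Finset.single_le_sum (fun μ _ => s1 μ) (Finset.mem_univ μ)]
  refine ⟨h, k, H, ∑ μ, ∑ ν, (M μ ν : ℝ), (d + 1) * (H * 3), ⟨fun μ ν => (hh μ ν).1.continuous,
    fun α => (hk α).1.continuous, bh, fun α x => ?_, fun μ ν x z => ?_, hwave, by positivity,
    by positivity, by positivity, fun z hz => ?_⟩⟩
  · have := hA' α x
    rw [Real.norm_eq_abs] at this
    linarith [Finset.single_le_sum (fun ν _ => pA' ν) (Finset.mem_univ α)]
  · rw [← Real.dist_eq]
    refine ((hM μ ν).dist_le_mul z x).trans ?_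
    gcongr
    have h1 : ∀ μ, (0 : ℝ) ≤ ∑ ν, (M μ ν : ℝ) := fun μ => by positivity
    have h2 : ∀ ν, (0 : ℝ) ≤ (M μ ν : ℝ) := fun ν => by positivity
    linarith [Finset.single_le_sum (fun ν _ => h2 ν) (Finset.mem_univ ν),
      Finset.single_le_sum (fun μ _ => h1 μ) (Finset.mem_univ μ)]
  · have hzU := hKU hz
    obtain ⟨v, W, hv, hW, hs, hG⟩ := exists_frame (hNsmall z hzU) (hcsmall z hzU) (hasmall z hzU)
      (hbsmall z hzU) (hBsmall z hzU) (hframe z hzU)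
      (isUnit_det_of_isLorentzianMatrix (hg.2 z hzU)) (H := H)
      (fun μ ν => by rw [← hinv μ ν z hz]; exact bh μ ν z)
    exact ⟨v, W, hv, hW, hs, fun μ ν => by rw [hinv μ ν z hz, hG]⟩

end JetSize

/-! ### The null form estimate on a small ball -/

section LocalizedNullForm

variable {d : ℕ}

open ComplexConjugate

/-- The null form along a frame controls the null form in coordinates. -/
theorem norm_integral_nullFormQ_le_of_frame {φ₁ φ₂ φ₃ : Spacetime d → ℂ} (h₁ : ContDiff ℝ ∞ φ₁)
    (h₂ : ContDiff ℝ ∞ φ₂) (h₃ : ContDiff ℝ ∞ φ₃) (hc₃ : HasCompactSupport φ₃)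
    {v : Fin (d + 1) → Spacetime d} {W : Fin (d + 1) → Fin (d + 1) → ℝ} {S M : ℝ} (hS : 0 ≤ S)
    (hW : ∀ c μ, |W c μ| ≤ S) (hv : ∀ μ, EuclideanSpace.single μ (1 : ℝ) = ∑ c, W c μ • v c)
    (hM : ∀ c a b, ‖∫ x, conj (fderiv ℝ φ₃ x (v c)) * (fderiv ℝ φ₁ x (v a) * fderiv ℝ φ₂ x (v b)
        - fderiv ℝ φ₁ x (v b) * fderiv ℝ φ₂ x (v a))‖ ≤ M) (α μ ν : Fin (d + 1)) :
    ‖∫ x, conj (partialD α φ₃ x) * nullFormQ μ ν φ₁ φ₂ x‖ ≤ ((d + 1) * S) ^ 3 * M := by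
  have e0 : ∀ (φ : Spacetime d → ℂ) μ x, partialD μ φ x = ∑ c, (W c μ : ℂ) * fderiv ℝ φ x (v c) :=
    fun φ μ x => by
      rw [partialD, hv, map_sum]
      exact Finset.sum_congr rfl fun c _ => by rw [map_smul, Complex.real_smul]
  set J : Fin (d + 1) → Fin (d + 1) → Fin (d + 1) → Spacetime d → ℂ := fun c a b x =>
    conj (fderiv ℝ φ₃ x (v c)) * (fderiv ℝ φ₁ x (v a) * fderiv ℝ φ₂ x (v b)
        - fderiv ℝ φ₁ x (v b) * fderiv ℝ φ₂ x (v a)) with hJ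
  have hcd : ∀ {φ : Spacetime d → ℂ}, ContDiff ℝ ∞ φ → ∀ w, Continuous fun x => fderiv ℝ φ x w :=
    fun h w => (h.continuous_fderiv (by norm_num)).clm_apply continuous_const
  have hJi : ∀ c a b, Integrable (J c a b) := fun c a b => by
    refine Continuous.integrable_of_hasCompactSupport ?_ ?_
    · have a1 := hcd h₁ (v a)
      have a2 := hcd h₁ (v b)
      have a3 := hcd h₂ (v a)
      have a4 := hcd h₂ (v b)
      have a5 := Complex.continuous_conj.comp (hcd h₃ (v c))
      exact a5.mul ((a1.mul a4).sub (a2.mul a3))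
    · refine HasCompactSupport.mul_right ?_
      exact (hc₃.fderiv_apply (𝕜 := ℝ) (v c)).comp_left (g := conj) (map_zero _)
  have e1 : ∀ x, conj (partialD α φ₃ x) * nullFormQ μ ν φ₁ φ₂ x
      = ∑ c, ∑ a, ∑ b, ((W c α * W a μ * W b ν : ℝ) : ℂ) * J c a b x := fun x => by
    simp only [nullFormQ, e0, map_sum, map_mul, Complex.conj_ofReal, Complex.ofReal_mul, hJ]
    rw [Finset.sum_mul]
    refine Finset.sum_congr rfl fun c _ => ?_
    rw [Finset.sum_mul_sum, Finset.sum_mul_sum, Finset.sum_comm (f := fun i j =>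
      (W i ν : ℂ) * fderiv ℝ φ₁ x (v i) * ((W j μ : ℂ) * fderiv ℝ φ₂ x (v j))),
      ← Finset.sum_sub_distrib, Finset.mul_sum]
    refine Finset.sum_congr rfl fun a _ => ?_
    rw [← Finset.sum_sub_distrib, Finset.mul_sum]
    refine Finset.sum_congr rfl fun b _ => ?_
    ring
  have e2 : ∫ x, conj (partialD α φ₃ x) * nullFormQ μ ν φ₁ φ₂ x
      = ∑ c, ∑ a, ∑ b, ((W c α * W a μ * W b ν : ℝ) : ℂ) * ∫ x, J c a b x := by
    simp_rw [e1]
    rw [integral_finsetSum _ fun c _ => integrable_finsetSum _ fun a _ =>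
      integrable_finsetSum _ fun b _ => (hJi c a b).const_mul _]
    refine Finset.sum_congr rfl fun c _ => ?_
    rw [integral_finsetSum _ fun a _ => integrable_finsetSum _ fun b _ => (hJi c a b).const_mul _]
    refine Finset.sum_congr rfl fun a _ => ?_
    rw [integral_finsetSum _ fun b _ => (hJi c a b).const_mul _]
    exact Finset.sum_congr rfl fun b _ => integral_const_mul _ _
  have hM0 : 0 ≤ M := (norm_nonneg _).trans (hM 0 0 0)
  rw [e2]
  refine (norm_sum_le _ _).trans ((Finset.sum_le_sum fun c _ => (norm_sum_le _ _).trans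
    (Finset.sum_le_sum fun a _ => (norm_sum_le _ _).trans
    (Finset.sum_le_sum fun b _ => ?_))).trans_eq (b := ∑ _c : Fin (d + 1), ∑ _a : Fin (d + 1),
      ∑ _b : Fin (d + 1), S * S * S * M) ?_)
  · rw [norm_mul, Complex.norm_real, Real.norm_eq_abs, abs_mul, abs_mul]
    have := hW c α
    have := hW a μ
    have := hW b ν
    have := hM c a b
    gcongr
  · simp
    ring

theorem rescale_eq_one {ψ : Spacetime d → ℂ} {R r : ℝ} (hr : 0 < r) (hψ : ∀ x, ‖x‖ ≤ R → ψ x = 1)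
    {x y : Spacetime d} (hx : dist x y ≤ R * r) : rescale ψ r y x = 1 := by
  refine hψ _ ?_
  rwa [norm_smul, Real.norm_of_nonneg (by positivity), inv_mul_le_iff₀ hr, ← dist_eq_norm, mul_comm]

/-- The localized null form estimate, on a ball of radius comparable to the square root of the
wavelength, where the metric is essentially constant. -/
theorem FrozenCoefficients.exists_norm_integral_localized_le
    {g : Spacetime d → Matrix (Fin (d + 1)) (Fin (d + 1)) ℝ} {K : Set (Spacetime d)}
    {h : Fin (d + 1) → Fin (d + 1) → Spacetime d → ℝ} {k : Fin (d + 1) → Spacetime d → ℝ}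
    {H L P : ℝ} (hF : FrozenCoefficients g K h k H L P) (hK : IsCompact K)
    {F ψ : Spacetime d → ℂ} (hFs : ContDiff ℝ ∞ F) (hFc : HasCompactSupport F)
    (hψs : ContDiff ℝ ∞ ψ) (hψ : ∀ x, 2 ≤ ‖x‖ → ψ x = 0) :
    ∃ C, 0 ≤ C ∧ ∀ (α μ ν : Fin (d + 1)) (r : ℝ), 0 < r → r ≤ 1 → ∀ φ₁ φ₂ φ₃ : Spacetime d → ℂ,
      ContDiff ℝ ∞ φ₁ → tsupport φ₁ ⊆ K → ContDiff ℝ ∞ φ₂ → tsupport φ₂ ⊆ K →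
      ContDiff ℝ ∞ φ₃ → tsupport φ₃ ⊆ K → ∀ a₁, 0 ≤ a₁ → (∀ᵐ x, jetSize g (r ^ 2) φ₁ x ≤ a₁) →
      ∀ y, ‖∫ x, conj (partialD α (fun x => rescale ψ r y x * (F x * φ₃ x)) x)
          * nullFormQ μ ν φ₁ φ₂ x‖ ≤ C * r ^ (1 / 4 : ℝ) * (a₁
        * (eLpNorm ((Metric.closedBall y (4 * r)).indicator (jetSize g (r ^ 2) φ₂)) 2 volume).toReal
        * (eLpNorm ((Metric.closedBall y (4 * r)).indicator
            (jetSize g (r ^ 2) φ₃)) 2 volume).toReal) := by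
  have hψc : HasCompactSupport ψ :=
    HasCompactSupport.intro (isCompact_closedBall (0 : Spacetime d) 2) fun x hx => hψ x (by
      rw [Metric.mem_closedBall, dist_zero_right, not_le] at hx; exact hx.le)
  -- φ₁ and φ₂ get a wider cutoff, equal to 1 on radius 3r. It is 1 in an r-neighbourhood of the
  -- ball of radius 2r supporting the cutoff on φ₃, so it does not change the derivatives that enter
  -- the integral.
  let b : ContDiffBump (0 : Spacetime d) := ⟨3, 4, by norm_num, by norm_num⟩
  set χ : Spacetime d → ℂ := fun x => (b x : ℂ) with hχ
  have hχs : ContDiff ℝ ∞ χ := Complex.ofRealCLM.contDiff.comp b.contDiff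
  have hχ1 : ∀ x, ‖x‖ ≤ 3 → χ x = 1 := fun x hx => by
    rw [hχ]
    simp only
    rw [b.one_of_mem_closedBall (by simpa using hx), Complex.ofReal_one]
  have hχ0 : ∀ x, 4 ≤ ‖x‖ → χ x = 0 := fun x hx => by
    rw [hχ]
    simp only
    rw [b.zero_of_le_dist (by simpa using hx), Complex.ofReal_zero]
  have hχc : HasCompactSupport χ :=
    HasCompactSupport.intro (isCompact_closedBall (0 : Spacetime d) 4) fun x hx => hχ0 x (by
      rw [Metric.mem_closedBall, dist_zero_right, not_le] at hx; exact hx.le)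
  obtain ⟨Cχ, hCχ⟩ := exists_cutoffBound_rescale hχs hχc
  obtain ⟨Cψ, hCψ⟩ := exists_cutoffBound_rescale hψs hψc
  obtain ⟨CF, hCF⟩ := exists_cutoffBound_const hFs hFc
  have hH := hF.nonnegH
  have hL := hF.nonnegL
  have hP := hF.nonnegP
  set D := localConst d P H L Cχ
  set D' := localConst d P H L (4 * (Cψ * CF))
  have hCχ0 : 0 ≤ Cχ := (norm_nonneg _).trans ((hCχ 1 one_pos 0).zero 0)
  have hCψ0 : 0 ≤ Cψ := (norm_nonneg _).trans ((hCψ 1 one_pos 0).zero 0)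
  have hCF0 : 0 ≤ CF := (norm_nonneg _).trans ((hCF 1 one_pos le_rfl).zero 0)
  have hD : 0 ≤ D := by simp only [D, localConst]; positivity
  have hD' : 0 ≤ D' := by simp only [D', localConst]; positivity
  have hfl := flatConst_nonneg d
  refine ⟨((d + 1) * 3) ^ 3 * (flatConst d * (D * D * D')), by positivity, ?_⟩
  intro α μ ν r hr hr1 φ₁ φ₂ φ₃ h₁ s₁ h₂ s₂ h₃ s₃ a₁ ha₁ he₁ y
  have hr2 : 0 < r ^ 2 := by positivity
  have hj0 : ∀ φ x, 0 ≤ jetSize g (r ^ 2) φ x := fun φ x => jetSize_nonneg hr2 φ x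
  have hball : tsupport (fun x => rescale ψ r y x * (F x * φ₃ x)) ⊆ Metric.closedBall y (2 * r) :=
    (tsupport_mul_subset_left).trans (tsupport_rescale_subset hr hψ y)
  -- Frames are available only at points of `K`. If the ball misses `K`, the localized φ₃ vanishes;
  -- otherwise the coefficients are frozen at a point of `K` in the ball, not at the centre y.
  by_cases hz : ∃ z ∈ K, dist z y ≤ 2 * r
  swap
  · have : ∀ x, rescale ψ r y x * (F x * φ₃ x) = 0 := fun x => by
      by_cases hx : x ∈ K
      · rw [image_eq_zero_of_notMem_tsupport (f := rescale ψ r y), zero_mul]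
        exact fun h => hz ⟨x, hx, tsupport_rescale_subset hr hψ y h⟩
      · rw [image_eq_zero_of_notMem_tsupport (f := φ₃) fun h => hx (s₃ h), mul_zero, mul_zero]
    simp_rw [this]
    simp only [partialD, fderiv_const_apply, FunLike.coe_zero, Pi.zero_apply, map_zero, zero_mul,
      integral_zero, norm_zero]
    positivity
  obtain ⟨z, hzK, hzy⟩ := hz
  obtain ⟨v, W, hvP, hW, hs, hG⟩ := hF.frame z hzK
  have hX := hCχ r hr y
  have hY := (hCψ r hr y).mul (hCF r hr hr1) hr
  have hXy : tsupport (rescale χ r y) ⊆ Metric.closedBall y (4 * r) :=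
    tsupport_rescale_subset hr hχ0 y
  have hYy : tsupport (fun x => rescale ψ r y x * F x) ⊆ Metric.closedBall y (4 * r) :=
    (tsupport_mul_subset_left).trans ((tsupport_rescale_subset hr hψ y).trans
      (Metric.closedBall_subset_closedBall (by linarith)))
  have key : ∀ {X : Spacetime d → ℂ} {C : ℝ}, CutoffBound X r C →
      tsupport X ⊆ Metric.closedBall y (4 * r) → ∀ {φ : Spacetime d → ℂ}, ContDiff ℝ ∞ φ →
      tsupport φ ⊆ K → LocalBound v (fun x => X x * φ x) (r ^ 2) r (fun x => localConst d P H L C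
        * (Metric.closedBall y (4 * r)).indicator (jetSize g (r ^ 2) φ) x) :=
    fun hX hXy φ hφ hs => hX.localBound_mul hφ (jetBound_jetSize hr2 hφ) hr hr1 hH hL hP
      (hF.waveOp_eq φ hs) (norm_waveOp_le_jetSize hr2 φ) hF.boundPrincipal hF.boundLower
      hF.lipschitz hXy hzy hvP hG
  have k₁ := key hX hXy h₁ s₁
  have k₂ := key hX hXy h₂ s₂
  have k₃ := key hY hYy h₃ s₃
  have c₁ : HasCompactSupport fun x => rescale χ r y x * φ₁ x :=
    (hasCompactSupport_of_tsupport_subset hK s₁).mul_left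
  have c₂ : HasCompactSupport fun x => rescale χ r y x * φ₂ x :=
    (hasCompactSupport_of_tsupport_subset hK s₂).mul_left
  have c₃ : HasCompactSupport fun x => rescale ψ r y x * F x * φ₃ x :=
    (hasCompactSupport_of_tsupport_subset hK s₃).mul_left
  have hm : ∀ {φ : Spacetime d → ℂ}, ContDiff ℝ ∞ φ → tsupport φ ⊆ K → ∀ E : ℝ,
      MemLp (fun x => E * (Metric.closedBall y (4 * r)).indicator (jetSize g (r ^ 2) φ) x) 2 :=
    fun hφ hs E => ((hF.memLp_jetSize hK hφ hs 2).indicator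
      Metric.isClosed_closedBall.measurableSet).const_mul E
  have hM := norm_integral_nullForm_le_of_localBound (a₁ := D * a₁) (hX.smooth.mul h₁) c₁
    (hX.smooth.mul h₂) c₂ (hY.smooth.mul h₃) c₃ k₁ k₂ k₃ hr2 hr hr1 (by positivity) (by
      filter_upwards [he₁] with x hx
      refine mul_le_mul_of_nonneg_left ?_ hD
      exact (Set.indicator_le_self' (fun _ _ => hj0 _ _) x).trans hx) (hm h₂ s₂ _) (hm h₃ s₃ _)
  have hfin := norm_integral_nullFormQ_le_of_frame (hX.smooth.mul h₁) (hX.smooth.mul h₂)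
    (hY.smooth.mul h₃) c₃ (by norm_num : (0 : ℝ) ≤ 3) hW hs hM α μ ν
  have hn : ∀ (E : ℝ) (e : Spacetime d → ℝ), 0 ≤ E →
      (eLpNorm (fun x => E * e x) 2 volume).toReal = E * (eLpNorm e 2 volume).toReal :=
    fun E e hE => by
      rw [show (fun x => E * e x) = E • e from rfl, eLpNorm_const_smul, ENNReal.toReal_mul,
        toReal_enorm, Real.norm_of_nonneg hE]
  rw [hn _ _ hD, hn _ _ hD'] at hfin
  refine le_trans (le_of_eq ?_) (hfin.trans_eq (by ring))
  congr 1
  refine integral_congr_ae (Filter.Eventually.of_forall fun x => ?_)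
  simp only
  have e3 : (fun x => rescale ψ r y x * (F x * φ₃ x)) = fun x => rescale ψ r y x * F x * φ₃ x := by
    funext x
    ring
  rw [e3] at hball ⊢
  by_cases hx : x ∈ Metric.closedBall y (2 * r)
  · have hev : ∀ φ : Spacetime d → ℂ, φ =ᶠ[nhds x] fun x => rescale χ r y x * φ x := fun φ => by
      filter_upwards [Metric.ball_mem_nhds x hr] with x' hx'
      rw [rescale_eq_one hr hχ1, one_mul]
      have := dist_triangle x' x y
      rw [Metric.mem_closedBall] at hx
      rw [Metric.mem_ball] at hx'
      linarith
    have hp : ∀ (φ : Spacetime d → ℂ) μ, partialD μ (fun x => rescale χ r y x * φ x) x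
        = partialD μ φ x := fun φ μ => by
      rw [partialD, partialD, (hev φ).fderiv_eq]
    simp only [nullFormQ, hp]
  · rw [partialD_eq_zero hball _ hx, map_zero, zero_mul, zero_mul]

end LocalizedNullForm

/-! ### Averaging over the centres of the balls -/

section Averaging

variable {d : ℕ}

open ComplexConjugate

theorem integrable_rescale_mul {𝕜 : Type*} [RCLike 𝕜] {η w : Spacetime d → 𝕜} (hη : Integrable η)
    (hw : Integrable w) {r : ℝ} (hr : 0 < r) :
    Integrable (fun p : Spacetime d × Spacetime d => rescale η r p.1 p.2 * w p.2)
      (volume.prod volume) := by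
  have h1 : Integrable fun t : Spacetime d => η ((-r⁻¹) • t) :=
    hη.comp_smul (neg_ne_zero.2 (inv_ne_zero hr.ne'))
  refine (hw.convolution_integrand (ContinuousLinearMap.mul ℝ 𝕜) h1).congr
    (Filter.Eventually.of_forall fun p => ?_)
  simp only [ContinuousLinearMap.mul_apply', rescale]
  rw [mul_comm, neg_smul, ← smul_neg, neg_sub]

/-- Averaging over the centres of a family of rescaled functions. -/
theorem integral_integral_rescale_mul {𝕜 : Type*} [RCLike 𝕜] {η w : Spacetime d → 𝕜}
    (hη : Integrable η) (hw : Integrable w) {r : ℝ} (hr : 0 < r) :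
    ∫ y, ∫ x, rescale η r y x * w x = ((r ^ (d + 1) : ℝ) : 𝕜) * (∫ x, η x) * ∫ x, w x := by
  have h1 : ∀ x : Spacetime d, ∫ y, rescale η r y x = ((r ^ (d + 1) : ℝ) : 𝕜) * ∫ x, η x :=
    fun x => by
      simp only [rescale]
      rw [integral_sub_left_eq_self (fun t => η (r⁻¹ • t)), Measure.integral_comp_smul]
      simp only [finrank_euclideanSpace, Fintype.card_fin, inv_pow, inv_inv]
      rw [abs_of_pos (by positivity), RCLike.real_smul_eq_coe_mul]
  rw [integral_integral_swap (integrable_rescale_mul hη hw hr)]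
  simp_rw [integral_mul_const, h1]
  rw [integral_const_mul]

theorem integral_partialD_eq_zero {ψ : Spacetime d → ℂ} (hψ : ContDiff ℝ ∞ ψ)
    (hc : HasCompactSupport ψ) (μ : Fin (d + 1)) : ∫ x, partialD μ ψ x = 0 := by
  have h1 : Integrable (partialD μ ψ) :=
    (contDiff_partialD hψ μ).continuous.integrable_of_hasCompactSupport
      (hc.of_isClosed_subset (isClosed_tsupport _) (tsupport_partialD_subset ψ μ))
  have h2 : Integrable ψ := hψ.continuous.integrable_of_hasCompactSupport hc
  have := integral_mul_fderiv_eq_neg_fderiv_mul_of_integrable (μ := (volume : Measure (Spacetime d)))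
    (f := fun _ => (1 : ℂ)) (g := ψ) (v := EuclideanSpace.single μ (1 : ℝ)) (by simp)
    (by simp only [one_mul]; exact h1) (by simpa using h2) (fun x _ => differentiableAt_const _)
    (fun x _ => hψ.differentiable (by norm_num) x)
  simpa [partialD] using this

/-- The derivative of a function, as an average of derivatives of its localizations. -/
theorem integral_integral_conj_partialD_localized {ψ u G : Spacetime d → ℂ} (hψ : ContDiff ℝ ∞ ψ)
    (hψc : HasCompactSupport ψ) (hu : ContDiff ℝ ∞ u) (huc : HasCompactSupport u)
    (hG : Continuous G) {r : ℝ} (hr : 0 < r) (α : Fin (d + 1)) :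
    ∫ y, ∫ x, conj (partialD α (fun x => rescale ψ r y x * u x) x) * G x
      = ((r ^ (d + 1) : ℝ) : ℂ) * (∫ x, conj (ψ x)) * ∫ x, conj (partialD α u x) * G x := by
  have hcs : ∀ {φ : Spacetime d → ℂ}, HasCompactSupport φ → HasCompactSupport (partialD α φ) :=
    fun h => h.of_isClosed_subset (isClosed_tsupport _) (tsupport_partialD_subset _ α)
  have hcj : ∀ {φ : Spacetime d → ℂ}, HasCompactSupport φ → HasCompactSupport fun x => conj (φ x) :=
    fun h => h.comp_left (g := conj) (map_zero _)
  have hct : ∀ {φ : Spacetime d → ℂ}, Continuous φ → Continuous fun x => conj (φ x) :=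
    fun h => Complex.continuous_conj.comp h
  have i1 : Integrable fun x => conj (ψ x) :=
    (hct hψ.continuous).integrable_of_hasCompactSupport (hcj hψc)
  have i2 : Integrable fun x => conj (partialD α ψ x) :=
    (hct (contDiff_partialD hψ α).continuous).integrable_of_hasCompactSupport (hcj (hcs hψc))
  have w1 : Integrable fun x => conj (partialD α u x) * G x :=
    ((hct (contDiff_partialD hu α).continuous).mul hG).integrable_of_hasCompactSupport
      (hcj (hcs huc)).mul_right
  have w2 : Integrable fun x => conj (u x) * G x :=
    ((hct hu.continuous).mul hG).integrable_of_hasCompactSupport (hcj huc).mul_right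
  -- The derivative of the cutoff carries a dangerous factor 1/r, but its average over the centre is
  -- a multiple of ∫ ∂ψ = 0.
  have e1 : ∀ y x, conj (partialD α (fun x => rescale ψ r y x * u x) x) * G x
      = rescale (fun x => conj (ψ x)) r y x * (conj (partialD α u x) * G x)
        + ((r⁻¹ : ℝ) : ℂ) * (rescale (fun x => conj (partialD α ψ x)) r y x
          * (conj (u x) * G x)) := fun y x => by
    rw [partialD_mul (contDiff_rescale hψ r y) hu, partialD_rescale hψ]
    simp only [rescale, map_add, map_mul, Complex.conj_ofReal]
    ring
  have p1 := integrable_rescale_mul i1 w1 hr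
  have p2 := integrable_rescale_mul i2 w2 hr
  have e2 : ∀ᵐ y, ∫ x, conj (partialD α (fun x => rescale ψ r y x * u x) x) * G x
      = (∫ x, rescale (fun x => conj (ψ x)) r y x * (conj (partialD α u x) * G x))
        + ((r⁻¹ : ℝ) : ℂ) * ∫ x, rescale (fun x => conj (partialD α ψ x)) r y x
          * (conj (u x) * G x) := by
    filter_upwards [p1.prod_right_ae, p2.prod_right_ae] with y hy1 hy2
    simp_rw [e1]
    rw [integral_add hy1 (hy2.const_mul _), integral_const_mul]
  rw [integral_congr_ae e2, integral_add p1.integral_prod_left (p2.integral_prod_left.const_mul _),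
    integral_const_mul, integral_integral_rescale_mul i1 w1 hr,
    integral_integral_rescale_mul i2 w2 hr, integral_conj (f := partialD α ψ),
    integral_partialD_eq_zero hψ hψc]
  simp

theorem toReal_eLpNorm_two_sq {e : Spacetime d → ℝ} (he : MemLp e 2) :
    (eLpNorm e 2 volume).toReal ^ 2 = ∫ x, e x ^ 2 := by
  rw [he.eLpNorm_eq_integral_rpow_norm (by norm_num) (by norm_num),
    ENNReal.toReal_ofReal (by positivity), ← Real.rpow_natCast, ← Real.rpow_mul (by positivity)]
  simp

theorem integral_mul_le_eLpNorm_mul {e e' : Spacetime d → ℝ} (he : MemLp e 2) (he' : MemLp e' 2) :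
    ∫ x, e x * e' x ≤ (eLpNorm e 2 volume).toReal * (eLpNorm e' 2 volume).toReal := by
  have h1 : ∫ x, e x * e' x ≤ ∫ x, ‖e x‖ * ‖e' x‖ := by
    refine integral_mono (he.integrable_mul he') (he.norm.integrable_mul he'.norm) fun x => ?_
    simp only [← norm_mul]
    exact le_abs_self _
  refine h1.trans ((integral_mul_norm_le_Lp_mul_Lq (f := e) (g := e') (p := 2) (q := 2)
    Real.HolderConjugate.two_two (by simpa using he) (by simpa using he')).trans_eq ?_)
  rw [he.eLpNorm_eq_integral_rpow_norm (by norm_num) (by norm_num),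
    he'.eLpNorm_eq_integral_rpow_norm (by norm_num) (by norm_num),
    ENNReal.toReal_ofReal (by positivity), ENNReal.toReal_ofReal (by positivity)]
  simp

/-- The local `L^2` norm over a ball of radius `4 r`. -/
noncomputable def localL2 (r : ℝ) (e : Spacetime d → ℝ) (y : Spacetime d) : ℝ :=
  (eLpNorm ((Metric.closedBall y (4 * r)).indicator e) 2 volume).toReal

/-- In this form the squared local norm is itself a rescaled average, so
`integral_integral_rescale_mul` integrates it over y and no covering or overlap count is needed. -/
theorem localL2_sq {r : ℝ} (hr : 0 < r) {e : Spacetime d → ℝ} (he : MemLp e 2) (y : Spacetime d) :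
    localL2 r e y ^ 2
      = ∫ x, rescale ((Metric.closedBall (0 : Spacetime d) 4).indicator fun _ => (1 : ℝ)) r y x
        * e x ^ 2 := by
  rw [localL2, toReal_eLpNorm_two_sq (he.indicator Metric.isClosed_closedBall.measurableSet)]
  congr 1 with x
  have : x ∈ Metric.closedBall y (4 * r)
      ↔ r⁻¹ • (x - y) ∈ Metric.closedBall (0 : Spacetime d) 4 := by
    rw [mem_closedBall_zero_iff, norm_smul, Real.norm_of_nonneg (by positivity),
      inv_mul_le_iff₀ hr, Metric.mem_closedBall, dist_eq_norm, mul_comm]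
  by_cases hx : x ∈ Metric.closedBall y (4 * r)
  · rw [Set.indicator_of_mem hx, rescale, Set.indicator_of_mem (this.1 hx), one_mul]
  · rw [Set.indicator_of_notMem hx, rescale, Set.indicator_of_notMem fun h => hx (this.2 h)]
    simp

theorem memLp_localL2 {r : ℝ} (hr : 0 < r) {e : Spacetime d → ℝ} (he : MemLp e 2) :
    MemLp (localL2 r e) 2 ∧ (eLpNorm (localL2 r e) 2 volume).toReal
      = √(r ^ (d + 1) * (volume (Metric.closedBall (0 : Spacetime d) 4)).toReal)
        * (eLpNorm e 2 volume).toReal := by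
  have hη : Integrable ((Metric.closedBall (0 : Spacetime d) 4).indicator fun _ => (1 : ℝ)) :=
    (integrable_indicator_iff Metric.isClosed_closedBall.measurableSet).2
      (integrableOn_const measure_closedBall_lt_top.ne)
  have hi : Integrable fun y => localL2 r e y ^ 2 := by
    simp_rw [localL2_sq hr he]
    exact (integrable_rescale_mul hη he.integrable_sq hr).integral_prod_left
  have hm : AEStronglyMeasurable (localL2 r e) volume := by
    have := Real.continuous_sqrt.comp_aestronglyMeasurable hi.1
    refine this.congr (Filter.Eventually.of_forall fun y => ?_)
    exact Real.sqrt_sq ENNReal.toReal_nonneg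
  have h2 : MemLp (localL2 r e) 2 := (memLp_two_iff_integrable_sq hm).2 hi
  refine ⟨h2, ?_⟩
  have h3 : ∫ y, localL2 r e y ^ 2
      = r ^ (d + 1) * (volume (Metric.closedBall (0 : Spacetime d) 4)).toReal
        * (eLpNorm e 2 volume).toReal ^ 2 := by
    simp_rw [localL2_sq hr he]
    rw [integral_integral_rescale_mul hη he.integrable_sq hr,
      integral_indicator Metric.isClosed_closedBall.measurableSet, toReal_eLpNorm_two_sq he]
    simp [Measure.real]
  rw [← Real.sqrt_sq (ENNReal.toReal_nonneg (a := eLpNorm (localL2 r e) 2 volume)),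
    toReal_eLpNorm_two_sq h2, h3, Real.sqrt_mul (by positivity), Real.sqrt_sq ENNReal.toReal_nonneg]

/-- Cauchy-Schwarz in the centre y. The volume factor `r ^ (d + 1)` is the one produced by averaging
the cutoff, so it drops out of the final estimate. -/
theorem integral_localL2_mul_le {r : ℝ} (hr : 0 < r) {e e' : Spacetime d → ℝ} (he : MemLp e 2)
    (he' : MemLp e' 2) : ∫ y, localL2 r e y * localL2 r e' y
      ≤ r ^ (d + 1) * (volume (Metric.closedBall (0 : Spacetime d) 4)).toReal
        * ((eLpNorm e 2 volume).toReal * (eLpNorm e' 2 volume).toReal) := by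
  obtain ⟨h1, h2⟩ := memLp_localL2 hr he
  obtain ⟨h3, h4⟩ := memLp_localL2 hr he'
  refine (integral_mul_le_eLpNorm_mul h1 h3).trans_eq ?_
  rw [h2, h4, mul_mul_mul_comm, Real.mul_self_sqrt (by positivity)]

end Averaging

/-! ### The global estimate for small λ -/

section NullFormEstimate

variable {d : ℕ}

open ComplexConjugate

variable {g : Spacetime d → Matrix (Fin (d + 1)) (Fin (d + 1)) ℝ} {K : Set (Spacetime d)}
  {h : Fin (d + 1) → Fin (d + 1) → Spacetime d → ℝ} {k : Fin (d + 1) → Spacetime d → ℝ}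
  {H L P : ℝ}

theorem norm_nullFormQ_le {φ₁ φ₂ : Spacetime d → ℂ} {lam : ℝ} {e₁ e₂ : Spacetime d → ℝ}
    (h₁ : JetBound φ₁ lam e₁) (h₂ : JetBound φ₂ lam e₂) (μ ν : Fin (d + 1)) (x : Spacetime d) :
    ‖nullFormQ μ ν φ₁ φ₂ x‖ ≤ 2 * (e₁ x * e₂ x) := by
  have p₁ : 0 ≤ e₁ x := (norm_nonneg _).trans (h₁.one 0 x)
  rw [nullFormQ]
  refine (norm_sub_le _ _).trans ?_
  rw [norm_mul, norm_mul, two_mul]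
  exact add_le_add (mul_le_mul (h₁.one μ x) (h₂.one ν x) (norm_nonneg _) p₁)
    (mul_le_mul (h₁.one ν x) (h₂.one μ x) (norm_nonneg _) p₁)

theorem continuous_nullFormQ {φ₁ φ₂ : Spacetime d → ℂ} (h₁ : ContDiff ℝ ∞ φ₁)
    (h₂ : ContDiff ℝ ∞ φ₂) (μ ν : Fin (d + 1)) : Continuous (nullFormQ μ ν φ₁ φ₂) := by
  have a := fun μ => (contDiff_partialD h₁ μ).continuous
  have b := fun μ => (contDiff_partialD h₂ μ).continuous
  unfold nullFormQ
  fun_prop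

/-- Hölder's inequality for the null form against a function of the size of `φ₃`. -/
theorem FrozenCoefficients.norm_integral_conj_mul_nullFormQ_le
    (hF : FrozenCoefficients g K h k H L P) (hK : IsCompact K) {lam : ℝ} (hlam : 0 < lam)
    {φ₁ φ₂ φ₃ w : Spacetime d → ℂ} (h₁ : ContDiff ℝ ∞ φ₁)
    (h₂ : ContDiff ℝ ∞ φ₂) (s₂ : tsupport φ₂ ⊆ K)
    (h₃ : ContDiff ℝ ∞ φ₃) (s₃ : tsupport φ₃ ⊆ K) {a₁ A : ℝ}
    (he₁ : ∀ᵐ x, jetSize g lam φ₁ x ≤ a₁) (hA : 0 ≤ A)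
    (hw : ∀ x, ‖w x‖ ≤ A * jetSize g lam φ₃ x) (μ ν : Fin (d + 1)) :
    ‖∫ x, conj (w x) * nullFormQ μ ν φ₁ φ₂ x‖ ≤ 2 * A * (a₁
      * (eLpNorm (jetSize g lam φ₂) 2 volume).toReal
      * (eLpNorm (jetSize g lam φ₃) 2 volume).toReal) := by
  have m₂ := hF.memLp_jetSize (lam := lam) hK h₂ s₂ 2
  have m₃ := hF.memLp_jetSize (lam := lam) hK h₃ s₃ 2
  have ha₁ : 0 ≤ a₁ := by
    obtain ⟨x, hx⟩ := he₁.exists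
    exact (jetSize_nonneg hlam φ₁ x).trans hx
  calc _ ≤ ∫ x, 2 * A * a₁ * (jetSize g lam φ₂ x * jetSize g lam φ₃ x) := by
        refine norm_integral_le_of_norm_le ((m₂.integrable_mul m₃).const_mul _) ?_
        filter_upwards [he₁] with x hx
        have n₂ := jetSize_nonneg (g := g) hlam φ₂ x
        have n₃ := jetSize_nonneg (g := g) hlam φ₃ x
        rw [norm_mul, RCLike.norm_conj]
        calc _ ≤ (A * jetSize g lam φ₃ x) * (2 * (jetSize g lam φ₁ x * jetSize g lam φ₂ x)) :=
              mul_le_mul (hw x) (norm_nullFormQ_le (jetBound_jetSize hlam h₁)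
                (jetBound_jetSize hlam h₂) μ ν x) (norm_nonneg _) (by positivity)
          _ ≤ (A * jetSize g lam φ₃ x) * (2 * (a₁ * jetSize g lam φ₂ x)) := by gcongr
          _ = _ := by ring
    _ ≤ 2 * A * a₁ * ((eLpNorm (jetSize g lam φ₂) 2 volume).toReal
        * (eLpNorm (jetSize g lam φ₃) 2 volume).toReal) := by
        rw [integral_const_mul]
        gcongr
        exact integral_mul_le_eLpNorm_mul m₂ m₃
    _ = _ := by ring

/-- The null form gain for small wavelengths, by averaging the localized estimates. -/
theorem FrozenCoefficients.exists_norm_integral_conj_partialD_le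
    (hF : FrozenCoefficients g K h k H L P) (hK : IsCompact K) {F : Spacetime d → ℂ}
    (hFs : ContDiff ℝ ∞ F) (hFc : HasCompactSupport F) :
    ∃ C, 0 ≤ C ∧ ∀ (α μ ν : Fin (d + 1)) (lam : ℝ), 0 < lam → lam ≤ 1 →
      ∀ φ₁ φ₂ φ₃ : Spacetime d → ℂ,
      ContDiff ℝ ∞ φ₁ → tsupport φ₁ ⊆ K → ContDiff ℝ ∞ φ₂ → tsupport φ₂ ⊆ K →
      ContDiff ℝ ∞ φ₃ → tsupport φ₃ ⊆ K → ∀ a₁, 0 ≤ a₁ → (∀ᵐ x, jetSize g lam φ₁ x ≤ a₁) →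
      ‖∫ x, conj (partialD α (fun x => F x * φ₃ x) x) * nullFormQ μ ν φ₁ φ₂ x‖
        ≤ C * lam ^ (1 / 8 : ℝ) * (a₁ * (eLpNorm (jetSize g lam φ₂) 2 volume).toReal
          * (eLpNorm (jetSize g lam φ₃) 2 volume).toReal) := by
  let b : ContDiffBump (0 : Spacetime d) := ⟨1, 2, by norm_num, by norm_num⟩
  set ψ : Spacetime d → ℂ := fun x => (b x : ℂ) with hψdef
  have hψs : ContDiff ℝ ∞ ψ := Complex.ofRealCLM.contDiff.comp b.contDiff
  have hψ0 : ∀ x, 2 ≤ ‖x‖ → ψ x = 0 := fun x hx => by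
    rw [hψdef]
    simp only
    rw [b.zero_of_le_dist (by simpa using hx), Complex.ofReal_zero]
  have hψc : HasCompactSupport ψ :=
    HasCompactSupport.intro (isCompact_closedBall (0 : Spacetime d) 2) fun x hx => hψ0 x (by
      rw [Metric.mem_closedBall, dist_zero_right, not_le] at hx; exact hx.le)
  have hI : 0 < ∫ x, b x := b.integral_pos
  have hIψ : ∫ x, conj (ψ x) = ((∫ x, b x : ℝ) : ℂ) := by
    rw [← integral_complex_ofReal]
    simp only [hψdef, Complex.conj_ofReal]
  set I := ∫ x, b x
  set V := (volume (Metric.closedBall (0 : Spacetime d) 4)).toReal with hV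
  have hV0 : 0 ≤ V := ENNReal.toReal_nonneg
  obtain ⟨C, hC, hloc⟩ := hF.exists_norm_integral_localized_le hK hFs hFc hψs hψ0
  refine ⟨C * V / I, by positivity, ?_⟩
  intro α μ ν lam hlam hlam1 φ₁ φ₂ φ₃ h₁ s₁ h₂ s₂ h₃ s₃ a₁ ha₁ he₁
  -- The scale √λ makes the variation of the coefficients, r/λ, and the commutator with the cutoff,
  -- 1/r, equal in size.
  set r := √lam with hr
  have hr0 : 0 < r := Real.sqrt_pos.2 hlam
  have hr1 : r ≤ 1 := Real.sqrt_le_one.2 hlam1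
  have hr2 : r ^ 2 = lam := Real.sq_sqrt hlam.le
  have hr8 : r ^ (1 / 4 : ℝ) = lam ^ (1 / 8 : ℝ) := by
    rw [hr, Real.sqrt_eq_rpow, ← Real.rpow_mul hlam.le]
    norm_num
  have m₂ := hF.memLp_jetSize (lam := lam) hK h₂ s₂ 2
  have m₃ := hF.memLp_jetSize (lam := lam) hK h₃ s₃ 2
  have havg := integral_integral_conj_partialD_localized hψs hψc (hFs.mul h₃)
    (hFc.mul_right) (continuous_nullFormQ h₁ h₂ μ ν) hr0 α
  have hT := hloc α μ ν r hr0 hr1 φ₁ φ₂ φ₃ h₁ s₁ h₂ s₂ h₃ s₃ a₁ ha₁ (by rwa [hr2])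
  rw [hr2, hr8] at hT
  have hle : ‖∫ y, ∫ x, conj (partialD α (fun x => rescale ψ r y x * (F x * φ₃ x)) x)
      * nullFormQ μ ν φ₁ φ₂ x‖ ≤ C * lam ^ (1 / 8 : ℝ) * a₁ * (r ^ (d + 1) * V
        * ((eLpNorm (jetSize g lam φ₂) 2 volume).toReal
          * (eLpNorm (jetSize g lam φ₃) 2 volume).toReal)) := by
    calc _ ≤ ∫ y, C * lam ^ (1 / 8 : ℝ) * a₁
          * (localL2 r (jetSize g lam φ₂) y * localL2 r (jetSize g lam φ₃) y) := by
          refine norm_integral_le_of_norm_le (((memLp_localL2 hr0 m₂).1.integrable_mul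
            (memLp_localL2 hr0 m₃).1).const_mul _) (Filter.Eventually.of_forall fun y => ?_)
          refine (hT y).trans_eq ?_
          rw [localL2, localL2]
          ring
      _ ≤ _ := by
          rw [integral_const_mul]
          gcongr
          exact integral_localL2_mul_le hr0 m₂ m₃
  rw [havg, hIψ, norm_mul, norm_mul, Complex.norm_real, Complex.norm_real,
    Real.norm_of_nonneg (by positivity), Real.norm_of_nonneg hI.le] at hle
  have hrn : 0 < r ^ (d + 1) * I := by positivity
  refine le_of_mul_le_mul_left (hle.trans_eq ?_) hrn
  field_simp

end NullFormEstimate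

/-! ### The theorem: small and large λ -/

theorem proposition2p4 {d : ℕ} (U : Set (Spacetime d)) (hU : IsOpen U)
    (g : Spacetime d → Matrix (Fin (d + 1)) (Fin (d + 1)) ℝ)
    (hg : IsSmoothLorentzianMetricOn g U)
    (N : Spacetime d → ℝ) (a b c : Fin d → Spacetime d → ℝ)
    (B : Fin d → Fin d → Spacetime d → ℝ)
    (hN : ContDiffOn ℝ ∞ N U) (ha : ∀ i, ContDiffOn ℝ ∞ (a i) U)
    (hb : ∀ i, ContDiffOn ℝ ∞ (b i) U) (hc : ∀ i, ContDiffOn ℝ ∞ (c i) U)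
    (hB : ∀ i j, ContDiffOn ℝ ∞ (B i j) U)
    (hframe : ∀ x ∈ U, g x =
      framedMetric (N x) (fun i => a i x) (fun i => b i x) (fun i => c i x) (fun i j => B i j x))
    (hNsmall : ∀ x ∈ U, |N x - 1| ≤ 1 / 10 ^ 5)
    (hcsmall : ∀ x ∈ U, ∀ i, |c i x - 1| ≤ 1 / 10 ^ 5)
    (hasmall : ∀ x ∈ U, ∀ i, |a i x| ≤ 1 / 10 ^ 5)
    (hbsmall : ∀ x ∈ U, ∀ i, |b i x| ≤ 1 / 10 ^ 5)
    (hBsmall : ∀ x ∈ U, ∀ i j, |B i j x| ≤ 1 / 10 ^ 5)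
    (K : Set (Spacetime d)) (hK : IsCompact K) (hKU : K ⊆ U)
    (f : Spacetime d → ℂ) (hf : ContDiffOn ℝ ∞ f U) :
    ∃ C : ℝ, ∀ (α μ ν : Fin (d + 1)) (lam : ℝ), 0 < lam →
      ∀ φ₁ φ₂ φ₃ : Spacetime d → ℂ,
        ContDiff ℝ ∞ φ₁ → tsupport φ₁ ⊆ K →
        ContDiff ℝ ∞ φ₂ → tsupport φ₂ ⊆ K →
        ContDiff ℝ ∞ φ₃ → tsupport φ₃ ⊆ K →
        ‖pairingL2 g U (fun x => f x * partialD α φ₃ x) (nullFormQ μ ν φ₁ φ₂)‖ ≤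
          C * lam ^ ((1 : ℝ) / 15) * XNorm ⊤ lam g φ₁ * XNorm 2 lam g φ₂ * XNorm 2 lam g φ₃ := by
  obtain ⟨h, k, H, L, P, hfc⟩ :=
    exists_frozenCoefficients hU hg hframe hNsmall hcsmall hasmall hbsmall hBsmall hK hKU
  obtain ⟨F, hFs, hFc, hFK⟩ := exists_volume_coefficient hU hK hKU hg hf
  obtain ⟨D, hD, hF0, hF1, -⟩ := exists_bound_partialD hFs hFc
  obtain ⟨C, hC, hgain⟩ := hfc.exists_norm_integral_conj_partialD_le hK hFs hFc
  refine ⟨C + 2 * D, fun α μ ν lam hlam φ₁ φ₂ φ₃ h₁ s₁ h₂ s₂ h₃ s₃ => ?_⟩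
  set G := nullFormQ μ ν φ₁ φ₂ with hG
  have hx₁ : 0 ≤ XNorm ⊤ lam g φ₁ := XNorm_nonneg hlam ⊤ φ₁
  have hx₂ : 0 ≤ XNorm 2 lam g φ₂ := XNorm_nonneg hlam 2 φ₂
  -- The volume density and f merge into the test function `F`. Taking the complex conjugate of the
  -- whole integral puts the conjugation on φ₃, and the support in `K` extends the integral from `U`
  -- to all of space.
  have hpair : ‖pairingL2 g U (fun x => f x * partialD α φ₃ x) G‖
      = ‖∫ x, (starRingEnd ℂ) (F x * partialD α φ₃ x) * G x‖ := by
    have e1 : pairingL2 g U (fun x => f x * partialD α φ₃ x) G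
        = ∫ x, (starRingEnd ℂ) ((starRingEnd ℂ) (F x * partialD α φ₃ x) * G x) := by
      have e0 : ∀ x ∉ U, (starRingEnd ℂ) ((starRingEnd ℂ) (F x * partialD α φ₃ x) * G x) = 0 :=
        fun x hx => by
          rw [partialD_eq_zero s₃ α fun h => hx (hKU h)]
          simp
      rw [pairingL2, ← setIntegral_eq_integral_of_forall_compl_eq_zero e0]
      refine setIntegral_congr_fun hU.measurableSet fun x _ => ?_
      simp only [map_mul, Complex.conj_conj]
      by_cases hx : x ∈ K
      · rw [hFK x hx]
        ring
      · rw [partialD_eq_zero s₃ α hx]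
        simp
    rw [e1, integral_conj, RCLike.norm_conj]
  have hE₂ := hfc.toReal_eLpNorm_jetSize_le hK hlam h₂ s₂ (p := 2) (by norm_num)
  have hE₃ := hfc.toReal_eLpNorm_jetSize_le hK hlam h₃ s₃ (p := 2) (by norm_num)
  have he₁ := hfc.ae_jetSize_le hK hlam h₁ s₁
  have hj₃ := jetBound_jetSize (g := g) hlam h₃
  set E₂ := (eLpNorm (jetSize g lam φ₂) 2 volume).toReal
  set E₃ := (eLpNorm (jetSize g lam φ₃) 2 volume).toReal
  have hE₂0 : 0 ≤ E₂ := ENNReal.toReal_nonneg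
  have hE₃0 : 0 ≤ E₃ := ENNReal.toReal_nonneg
  suffices hs : ‖∫ x, (starRingEnd ℂ) (F x * partialD α φ₃ x) * G x‖
      ≤ (C + 2 * D) * lam ^ ((1 : ℝ) / 15) * (XNorm ⊤ lam g φ₁ * E₂ * E₃) by
    rw [hpair]
    refine hs.trans ?_
    rw [mul_assoc ((C + 2 * D) * _ * _), mul_assoc ((C + 2 * D) * _), mul_assoc (XNorm _ _ _ _)]
    gcongr
  have hprod : 0 ≤ XNorm ⊤ lam g φ₁ * E₂ * E₃ := by positivity
  -- For λ ≥ 1 the power of λ is at least 1 and Hölder alone suffices.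
  rcases le_total 1 lam with h1 | h1
  · have hb := hfc.norm_integral_conj_mul_nullFormQ_le hK hlam h₁ h₂ s₂ h₃ s₃ he₁ hD
      (w := fun x => F x * partialD α φ₃ x) (fun x => by
        rw [norm_mul]
        exact mul_le_mul (hF0 x) (hj₃.one α x) (norm_nonneg _) hD) μ ν
    refine hb.trans (mul_le_mul_of_nonneg_right ?_ hprod)
    have := Real.one_le_rpow h1 (by norm_num : (0 : ℝ) ≤ 1 / 15)
    nlinarith
  · have i1 : Integrable fun x =>
        (starRingEnd ℂ) (partialD α (fun x => F x * φ₃ x) x) * G x := by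
      refine ((Complex.continuous_conj.comp
        (contDiff_partialD (hFs.mul h₃) α).continuous).mul
        (continuous_nullFormQ h₁ h₂ μ ν)).integrable_of_hasCompactSupport ?_
      refine HasCompactSupport.mul_right (HasCompactSupport.comp_left (g := starRingEnd ℂ) ?_
        (map_zero _))
      exact (HasCompactSupport.mul_right hFc).of_isClosed_subset (isClosed_tsupport _)
        (tsupport_partialD_subset _ α)
    have i2 : Integrable fun x => (starRingEnd ℂ) (partialD α F x * φ₃ x) * G x := by
      refine ((Complex.continuous_conj.comp
        ((contDiff_partialD hFs α).continuous.mul h₃.continuous)).mul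
        (continuous_nullFormQ h₁ h₂ μ ν)).integrable_of_hasCompactSupport ?_
      refine HasCompactSupport.mul_right (HasCompactSupport.comp_left (g := starRingEnd ℂ) ?_
        (map_zero _))
      exact HasCompactSupport.mul_left (hasCompactSupport_of_tsupport_subset hK s₃)
    -- F ∂φ₃ = ∂(Fφ₃) - (∂F)φ₃. The first term has the gain λ^(1/8); in the second, φ₃ carries no
    -- derivative and Hölder already gives a full factor λ. Both are at most λ^(1/15) for λ ≤ 1.
    have e2 : ∫ x, (starRingEnd ℂ) (F x * partialD α φ₃ x) * G x
        = (∫ x, (starRingEnd ℂ) (partialD α (fun x => F x * φ₃ x) x) * G x)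
          - ∫ x, (starRingEnd ℂ) (partialD α F x * φ₃ x) * G x := by
      rw [← integral_sub i1 i2, partialD_mul hFs h₃]
      congr 1 with x
      rw [map_add]
      ring
    have hb1 := hgain α μ ν lam hlam h1 φ₁ φ₂ φ₃ h₁ s₁ h₂ s₂ h₃ s₃ _ hx₁ he₁
    have hb2 := hfc.norm_integral_conj_mul_nullFormQ_le hK hlam h₁ h₂ s₂ h₃ s₃ he₁
      (by positivity : 0 ≤ D * lam) (w := fun x => partialD α F x * φ₃ x) (fun x => by
        rw [norm_mul, mul_assoc]
        exact mul_le_mul (hF1 α x) (hj₃.zero x) (norm_nonneg _) hD) μ ν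
    have l1 : lam ^ (1 / 8 : ℝ) ≤ lam ^ ((1 : ℝ) / 15) :=
      Real.rpow_le_rpow_of_exponent_ge hlam h1 (by norm_num)
    have l2 : lam ≤ lam ^ ((1 : ℝ) / 15) := by
      simpa using Real.rpow_le_rpow_of_exponent_ge hlam h1 (by norm_num : (1 : ℝ) / 15 ≤ 1)
    rw [e2]
    refine (norm_sub_le _ _).trans ((add_le_add hb1 hb2).trans ?_)
    rw [← add_mul]
    refine mul_le_mul_of_nonneg_right ?_ hprod
    have := mul_le_mul_of_nonneg_left l1 hC
    have := mul_le_mul_of_nonneg_left l2 hD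
    linarith
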